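/- Let $d\ge 1$ be an integer, and let $C_0([0,1]^d)$ be the space of continuous functions $f\colon[0,1]^d\to\mathbb R$ such that $f(x)=0$ whenever some $x_i=0$. **Strong charges.** $BV([0,1]^d)$ is the space of (classes of) integrable functions $u$ on $\mathbb R^d$ that vanish a.e. outside $[0,1]^d$ and whose variation $\|Du\|(\mathbb R^d)=\sup\{\int u\,\operatorname{div}v : v\in C^1_c(\mathbb R^d;\mathbb R^d),\ |v|\le 1\}$ is finite, with the norm $\|u\|_{BV}=\|u\|_1+\|Du\|(\mathbb R^d)$. For $g\in L^d([0,1]^d)$ let $T_g\in BV([0,1]^d)^*$ be the functional $T_g(u)=\int_{[0,1]^d}gu$, and let $SCH([0,1]^d)$ be the closure of $\{T_g: g\in L^d([0,1]^d)\}$ in $BV([0,1]^d)^*$. A $BV$-set is a measurable set $B\subset[0,1]^d$ of finite perimeter $\|B\|=\|D\mathbf 1_B\|(\mathbb R^d)$. A charge is a real function $\mu$ of $BV$-sets such that $\mu(B_1\cup B_2)=\mu(B_1)+\mu(B_2)$ whenever $|B_1\cap B_2|=0$, and $\mu(B_n)\to\mu(B)$ whenever $\sup_n\|B_n\|<\infty$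 and $|B_n\mathbin{\triangle}B|\to0$. A charge is strong if it has the form $B\mapsto\alpha(\mathbf 1_B)$ with $\alpha\in SCH([0,1]^d)$. **Strong chargeability.** For $f\in C_0([0,1]^d)$ and a rectangle $R=\prod_i[a_i,b_i]\subset[0,1]^d$ with $a_i<b_i$, let $\Delta_f(R)=\sum_{c\in\prod_i\{a_i,b_i\}}(-1)^{\#\{i:c_i=a_i\}}f(c)$. Extend $\Delta_f$ to the unique function of figures (finite unions of rectangles in $[0,1]^d$) that is additive on pairs of figures with negligible intersection. The function $f$ is strongly chargeable if $\Delta_f$ extends to a strong charge. **Haar functions and coefficients.** For every $n\ge0$ number the dyadic cubes of side $2^{-n}$ in $[0,1]^d$ as $K_{n,k}$, $0\le k<2^{nd}$, in such a way that $K_{n+1,2^dk+\ell}$, $0\le\ell<2^d$, are the $2^d$ subcubes of $K_{n,k}$ of side $2^{-(n+1)}$; any such numbering is allowed. Let $A_1=\begin{pmatrix}1&1\\1&-1\end{pmatrix}$ and $A_{m+1}=\begin{pmatrix}A_m&A_m\\A_m&-A_m\end{pmatrix}$, with rows and columns of $A_d$ numbered from $0$ to $2^d-1$. Put $g_{-1}=\mathbf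 1_{[0,1]^d}$, $\lambda_{-1}(f)=\Delta_f([0,1]^d)$ and, for $n\ge0$, $0\le k<2^{nd}$, $1\le r\le2^d-1$, $$g_{n,k,r}=2^{nd/2}\sum_{\ell=0}^{2^d-1}(A_d)_{r,\ell}\,\mathbf 1_{K_{n+1,2^dk+\ell}},\qquad \lambda_{n,k,r}(f)=2^{nd/2}\sum_{\ell=0}^{2^d-1}(A_d)_{r,\ell}\,\Delta_f(K_{n+1,2^dk+\ell}).$$ **Theorem.** A function $f\in C_0([0,1]^d)$ is strongly chargeable if and only if its Faber–Schauder series $$\lambda_{-1}(f)\,T_{g_{-1}}+\lambda_{0,0,1}(f)\,T_{g_{0,0,1}}+\lambda_{0,0,2}(f)\,T_{g_{0,0,2}}+\cdots,$$ in which the indices $(n,k,r)$ are ordered lexicographically, converges in $SCH([0,1]^d)$ (convergence in norm of the partial sums in this order). -/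

import Mathlib

open MeasureTheory Filter Topology
open scoped ENNReal

noncomputable section

namespace StrongCharge

/-- The ambient space `ℝ^d` with its Euclidean norm. -/
abbrev E (d : ℕ) : Type := EuclideanSpace ℝ (Fin d)

/-- The set `∏ i, [a i, b i]`. -/
def rect {d : ℕ} (a b : Fin d → ℝ) : Set (E d) := {x | ∀ i, a i ≤ x i ∧ x i ≤ b i}

/-- The unit cube `[0,1]^d`. -/
def cube (d : ℕ) : Set (E d) := rect (fun _ => 0) (fun _ => 1)

theorem measurableSet_rect {d : ℕ} (a b : Fin d → ℝ) : MeasurableSet (rect a b) := by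
  have : rect a b = ⋂ i, {x : E d | a i ≤ x i ∧ x i ≤ b i} := by
    ext x; simp [rect]
  rw [this]
  refine MeasurableSet.iInter fun i => ?_
  have h : Measurable fun x : E d => x i := by fun_prop
  exact (measurableSet_le measurable_const h).inter (measurableSet_le h measurable_const)

theorem isBounded_rect {d : ℕ} (a b : Fin d → ℝ) : Bornology.IsBounded (rect a b) := by
  have h : Bornology.IsBounded (Set.Icc a b) := Metric.isBounded_Icc a b
  have h2 := (PiLp.antilipschitzWith_ofLp 2 (fun _ : Fin d => ℝ)).isBounded_preimage h
  refine h2.subset fun x hx => ?_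
  exact ⟨fun i => (hx i).1, fun i => (hx i).2⟩

theorem volume_cube_lt_top (d : ℕ) : volume (cube d) < ∞ := (isBounded_rect _ _).measure_lt_top

/-! ### Functions of bounded variation -/

/-- The divergence `∑ i, ∂ v_i / ∂ x_i` of a vector field. -/
def divergence {d : ℕ} (v : E d → E d) (x : E d) : ℝ :=
  ∑ i, (fderiv ℝ v x (EuclideanSpace.single i 1)) i

/-- Compactly supported `C^1` vector fields on `ℝ^d` with `|v| ≤ 1`. -/
def IsTestField {d : ℕ} (v : E d → E d) : Prop :=
  ContDiff ℝ 1 v ∧ HasCompactSupport v ∧ ∀ x, ‖v x‖ ≤ 1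

/-- The variation `‖Du‖(ℝ^d)` of an integrable function `u`. -/
def variation {d : ℕ} (u : E d → ℝ) : ℝ≥0∞ :=
  ⨆ (v : E d → E d) (_ : IsTestField v), ENNReal.ofReal (∫ x, u x * divergence v x)

theorem continuous_divergence {d : ℕ} {v : E d → E d} (hv : IsTestField v) :
    Continuous (divergence v) := by
  have h := hv.1.continuous_fderiv (by norm_num)
  unfold divergence
  fun_prop

theorem integrable_mul_divergence {d : ℕ} {u : E d → ℝ} (hu : Integrable u) {v : E d → E d}
    (hv : IsTestField v) : Integrable (fun x => u x * divergence v x) := by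
  have hc := continuous_divergence hv
  have hs : HasCompactSupport (divergence v) := by
    refine (hv.2.1.fderiv (𝕜 := ℝ)).mono fun x hx => ?_
    contrapose! hx
    simp only [Function.mem_support, not_not] at hx ⊢
    simp [divergence, hx]
  obtain ⟨C, hC⟩ := hc.bounded_above_of_compact_support hs
  exact hu.mul_bdd hc.aestronglyMeasurable (Eventually.of_forall hC)

theorem variation_congr {d : ℕ} {u w : E d → ℝ} (h : u =ᵐ[volume] w) :
    variation u = variation w := by
  unfold variation
  refine iSup_congr fun v => iSup_congr fun _ => ?_
  congr 1
  refine integral_congr_ae ?_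
  filter_upwards [h] with x hx
  rw [hx]

theorem variation_zero {d : ℕ} : variation (fun _ : E d => (0 : ℝ)) = 0 := by
  simp [variation]

theorem variation_add_le {d : ℕ} {u w : E d → ℝ} (hu : Integrable u) (hw : Integrable w) :
    variation (fun x => u x + w x) ≤ variation u + variation w := by
  refine iSup₂_le fun v hv => ?_
  simp only [add_mul]
  rw [integral_add (integrable_mul_divergence hu hv) (integrable_mul_divergence hw hv)]
  refine ENNReal.ofReal_add_le.trans (add_le_add ?_ ?_)
  · exact le_iSup₂ (f := fun (v : E d → E d) (_ : IsTestField v) =>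
      ENNReal.ofReal (∫ x, u x * divergence v x)) v hv
  · exact le_iSup₂ (f := fun (v : E d → E d) (_ : IsTestField v) =>
      ENNReal.ofReal (∫ x, w x * divergence v x)) v hv

theorem IsTestField.neg {d : ℕ} {v : E d → E d} (hv : IsTestField v) :
    IsTestField (fun x => -v x) :=
  ⟨hv.1.neg, hv.2.1.neg, fun x => by simpa using hv.2.2 x⟩

theorem divergence_neg {d : ℕ} (v : E d → E d) (x : E d) :
    divergence (fun x => -v x) x = -divergence v x := by
  simp [divergence, fderiv_fun_neg]

theorem variation_smul_le {d : ℕ} (c : ℝ) (u : E d → ℝ) :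
    variation (fun x => c * u x) ≤ ENNReal.ofReal |c| * variation u := by
  refine iSup₂_le fun v hv => ?_
  simp only [mul_assoc]
  rw [integral_const_mul]
  rcases le_total 0 c with hc | hc
  · rw [ENNReal.ofReal_mul hc, abs_of_nonneg hc]
    gcongr
    exact le_iSup₂ (f := fun (v : E d → E d) (_ : IsTestField v) =>
      ENNReal.ofReal (∫ x, u x * divergence v x)) v hv
  · have h : c * ∫ x, u x * divergence v x
        = |c| * ∫ x, u x * divergence (fun x => -v x) x := by
      simp only [divergence_neg, mul_neg, integral_neg, abs_of_nonpos hc]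
      ring
    rw [h, ENNReal.ofReal_mul (abs_nonneg c)]
    gcongr
    exact le_iSup₂ (f := fun (v : E d → E d) (_ : IsTestField v) =>
      ENNReal.ofReal (∫ x, u x * divergence v x)) _ hv.neg

theorem variation_smul {d : ℕ} (c : ℝ) (u : E d → ℝ) :
    variation (fun x => c * u x) = ENNReal.ofReal |c| * variation u := by
  rcases eq_or_ne c 0 with rfl | hc
  · simp [variation_zero]
  · refine le_antisymm (variation_smul_le c u) ?_
    have h := variation_smul_le c⁻¹ (fun x => c * u x)
    simp only [inv_mul_cancel_left₀ hc] at h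
    calc ENNReal.ofReal |c| * variation u
        ≤ ENNReal.ofReal |c| * (ENNReal.ofReal |c⁻¹| * variation (fun x => c * u x)) := by gcongr
      _ = variation (fun x => c * u x) := by
        rw [← mul_assoc, ← ENNReal.ofReal_mul (abs_nonneg c), ← abs_mul, mul_inv_cancel₀ hc]
        simp

/-- The integrable functions on `ℝ^d` (up to a.e. equality) that vanish a.e. outside `[0,1]^d`
and have finite variation. -/
def bvSubmodule (d : ℕ) : Submodule ℝ (Lp ℝ 1 (volume : Measure (E d))) where
  carrier := {u | (∀ᵐ x, x ∉ cube d → u x = 0) ∧ variation u < ∞}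
  zero_mem' := by
    have h := Lp.coeFn_zero ℝ 1 (volume : Measure (E d))
    refine ⟨?_, ?_⟩
    · filter_upwards [h] with x hx _
      exact hx
    · rw [variation_congr (w := fun _ => 0) h, variation_zero]
      simp
  add_mem' := by
    rintro u w ⟨hu, hu'⟩ ⟨hw, hw'⟩
    have h := Lp.coeFn_add u w
    refine ⟨?_, ?_⟩
    · filter_upwards [h, hu, hw] with x hx h1 h2 hxc
      rw [hx, Pi.add_apply, h1 hxc, h2 hxc, add_zero]
    · rw [variation_congr (w := fun x => u x + w x) h]
      exact (variation_add_le (L1.integrable_coeFn u) (L1.integrable_coeFn w)).trans_lt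
        (ENNReal.add_lt_top.2 ⟨hu', hw'⟩)
  smul_mem' := by
    rintro c u ⟨hu, hu'⟩
    have h := Lp.coeFn_smul c u
    refine ⟨?_, ?_⟩
    · filter_upwards [h, hu] with x hx h1 hxc
      rw [hx, Pi.smul_apply, h1 hxc, smul_zero]
    · rw [variation_congr (w := fun x => c * u x) h, variation_smul]
      exact ENNReal.mul_lt_top (by simp) hu'

/-- The space `BV([0,1]^d)`. It is a type synonym of `bvSubmodule d`, because it carries the norm
`‖u‖₁ + ‖Du‖(ℝ^d)` instead of the `L¹` norm. -/
def BV (d : ℕ) : Type := bvSubmodule d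

namespace BV

variable {d : ℕ}

instance : AddCommGroup (BV d) := inferInstanceAs (AddCommGroup (bvSubmodule d))

instance : Module ℝ (BV d) := inferInstanceAs (Module ℝ (bvSubmodule d))

/-- The class in `L¹(ℝ^d)` of an element of `BV([0,1]^d)`. -/
def toL1 : BV d →ₗ[ℝ] Lp ℝ 1 (volume : Measure (E d)) := (bvSubmodule d).subtype

instance : CoeFun (BV d) (fun _ => E d → ℝ) := ⟨fun u => (toL1 u : E d → ℝ)⟩

theorem integrable (u : BV d) : Integrable (u : E d → ℝ) := L1.integrable_coeFn (toL1 u)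

theorem variation_lt_top (u : BV d) : variation (u : E d → ℝ) < ∞ :=
  (show toL1 u ∈ bvSubmodule d from Subtype.property (p := (· ∈ bvSubmodule d)) u).2

theorem coe_add (u w : BV d) : ((u + w : BV d) : E d → ℝ) =ᵐ[volume] fun x => u x + w x := by
  rw [map_add]; exact Lp.coeFn_add _ _

theorem coe_smul (c : ℝ) (u : BV d) : ((c • u : BV d) : E d → ℝ) =ᵐ[volume] fun x => c * u x := by
  rw [map_smul]; exact Lp.coeFn_smul _ _

instance : Norm (BV d) := ⟨fun u => ‖toL1 u‖ + (variation (u : E d → ℝ)).toReal⟩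

theorem norm_def (u : BV d) : ‖u‖ = ‖toL1 u‖ + (variation (u : E d → ℝ)).toReal := rfl

theorem normedSpaceCore : NormedSpace.Core ℝ (BV d) where
  norm_nonneg u := by rw [norm_def]; positivity
  norm_smul c u := by
    rw [norm_def, norm_def, variation_congr (coe_smul c u), variation_smul, map_smul, norm_smul,
      ENNReal.toReal_mul, ENNReal.toReal_ofReal (abs_nonneg c), Real.norm_eq_abs]
    ring
  norm_triangle u w := by
    have h1 : (variation ((u + w : BV d) : E d → ℝ)).toReal
        ≤ (variation (u : E d → ℝ)).toReal + (variation (w : E d → ℝ)).toReal := by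
      rw [variation_congr (coe_add u w),
        ← ENNReal.toReal_add u.variation_lt_top.ne w.variation_lt_top.ne]
      exact ENNReal.toReal_mono
        (ENNReal.add_lt_top.2 ⟨u.variation_lt_top, w.variation_lt_top⟩).ne
        (variation_add_le u.integrable w.integrable)
    have h2 := norm_add_le (toL1 u) (toL1 w)
    rw [norm_def, norm_def, norm_def, map_add]
    rw [map_add] at h1
    linarith
  norm_eq_zero_iff u := by
    constructor
    · intro h
      have h1 : ‖toL1 u‖ = 0 := by
        have := ENNReal.toReal_nonneg (a := variation (u : E d → ℝ))
        rw [norm_def] at h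
        have := norm_nonneg (toL1 u)
        linarith
      exact Subtype.ext (norm_eq_zero.1 h1)
    · rintro rfl
      have h : (((0 : BV d) : BV d) : E d → ℝ) =ᵐ[volume] fun _ => 0 := by
        rw [map_zero]; exact Lp.coeFn_zero _ _ _
      rw [norm_def, variation_congr h, variation_zero]
      simp

instance : NormedAddCommGroup (BV d) := NormedAddCommGroup.ofCore normedSpaceCore

instance : NormedSpace ℝ (BV d) := NormedSpace.ofCore normedSpaceCore

end BV

/-! ### Sets of bounded variation and charges -/

/-- The perimeter `‖B‖ = ‖D 1_B‖(ℝ^d)`. -/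
def perimeter {d : ℕ} (B : Set (E d)) : ℝ≥0∞ := variation (B.indicator fun _ => (1 : ℝ))

/-- The Lebesgue measurable subsets of `[0,1]^d` of finite perimeter. -/
def IsBVSet {d : ℕ} (B : Set (E d)) : Prop :=
  B ⊆ cube d ∧ NullMeasurableSet B ∧ perimeter B < ∞

theorem IsBVSet.integrable_indicator {d : ℕ} {B : Set (E d)} (hB : IsBVSet B) :
    Integrable (B.indicator fun _ => (1 : ℝ)) := by
  have h : IntegrableOn (fun _ => (1 : ℝ)) B :=
    integrableOn_const (((measure_mono hB.1).trans_lt (volume_cube_lt_top d)).ne)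
  exact h.integrable_indicator₀ hB.2.1

/-- The indicator function of a set of bounded variation, as an element of `BV([0,1]^d)`. -/
def IsBVSet.indicatorBV {d : ℕ} {B : Set (E d)} (hB : IsBVSet B) : BV d :=
  ⟨hB.integrable_indicator.toL1 _, by
    have h := hB.integrable_indicator.coeFn_toL1
    refine ⟨?_, ?_⟩
    · filter_upwards [h] with x hx hxc
      rw [hx, Set.indicator_of_notMem fun hxB => hxc (hB.1 hxB)]
    · rw [variation_congr h]
      exact hB.2.2⟩

/-- `BV`-convergence of a sequence of sets: bounded perimeters and convergence in measure. -/
def BVConverges {d : ℕ} (B : ℕ → Set (E d)) (B' : Set (E d)) : Prop :=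
  (⨆ n, perimeter (B n)) < ∞ ∧ Tendsto (fun n => volume (symmDiff (B n) B')) atTop (𝓝 0)

/-- `μ` is a charge on `[0,1]^d`. Only the values of `μ` on sets of bounded variation matter. -/
def IsCharge {d : ℕ} (μ : Set (E d) → ℝ) : Prop :=
  (∀ B₁ B₂, IsBVSet B₁ → IsBVSet B₂ → volume (B₁ ∩ B₂) = 0 → μ (B₁ ∪ B₂) = μ B₁ + μ B₂) ∧
  (∀ (B : ℕ → Set (E d)) (B' : Set (E d)), (∀ n, IsBVSet (B n)) → IsBVSet B' →
    BVConverges B B' → Tendsto (fun n => μ (B n)) atTop (𝓝 (μ B')))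

/-! ### Strong charge functionals -/

/-- `α = T_g`, that is, `α u = ∫_{[0,1]^d} g u` for all `u ∈ BV([0,1]^d)`. -/
def IsT {d : ℕ} (g : E d → ℝ) (α : BV d →L[ℝ] ℝ) : Prop :=
  ∀ u : BV d, Integrable (fun x => g x * u x) (volume.restrict (cube d)) ∧
    α u = ∫ x in cube d, g x * u x

/-- The functionals `T_g` with `g ∈ L^d([0,1]^d)`, as a subspace of `BV([0,1]^d)^*`. -/
def rangeT (d : ℕ) : Submodule ℝ (BV d →L[ℝ] ℝ) where
  carrier := {α | ∃ g : E d → ℝ, MemLp g d (volume.restrict (cube d)) ∧ IsT g α}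
  zero_mem' := ⟨fun _ => 0, MemLp.zero, fun u => by simp⟩
  add_mem' := by
    rintro α β ⟨g, hg, hα⟩ ⟨h, hh, hβ⟩
    refine ⟨fun x => g x + h x, hg.add hh, fun u => ?_⟩
    simp only [add_mul]
    refine ⟨(hα u).1.add (hβ u).1, ?_⟩
    rw [integral_add (hα u).1 (hβ u).1, ← (hα u).2, ← (hβ u).2]
    rfl
  smul_mem' := by
    rintro c α ⟨g, hg, hα⟩
    refine ⟨fun x => c * g x, hg.const_mul c, fun u => ?_⟩
    simp only [mul_assoc]
    refine ⟨(hα u).1.const_mul c, ?_⟩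
    rw [integral_const_mul, ← (hα u).2]
    rfl

/-- The space `SCH([0,1]^d)` of strong charge functionals: the closure of the range of `T` in
`BV([0,1]^d)^*`, with the operator norm. -/
def SCH (d : ℕ) : Submodule ℝ (BV d →L[ℝ] ℝ) := (rangeT d).topologicalClosure

/-- A strong charge: a charge of the form `B ↦ α(1_B)` for a strong charge functional `α`. -/
def IsStrongCharge {d : ℕ} (μ : Set (E d) → ℝ) : Prop :=
  IsCharge μ ∧ ∃ α ∈ SCH d, ∀ (B : Set (E d)) (hB : IsBVSet B), μ B = α hB.indicatorBV

/-! ### Strong chargeability -/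

/-- `f ∈ C_0([0,1]^d)`; only the values of `f` on `[0,1]^d` matter. -/
def MemC0 {d : ℕ} (f : E d → ℝ) : Prop :=
  ContinuousOn f (cube d) ∧ ∀ x ∈ cube d, (∃ i, x i = 0) → f x = 0

/-- The increment `Δ_f` on the rectangle `∏ i, [a i, b i]`. The sum runs over its vertices: `S` is
the set of the coordinates at which the lower bound is taken. -/
def rectIncrement {d : ℕ} (f : E d → ℝ) (a b : Fin d → ℝ) : ℝ :=
  ∑ S : Finset (Fin d), (-1) ^ S.card * f (WithLp.toLp 2 fun i => if i ∈ S then a i else b i)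

/-- `a` and `b` are the bounds of a rectangle of nonempty interior in `[0,1]^d`. -/
def IsRectBounds {d : ℕ} (a b : Fin d → ℝ) : Prop := ∀ i, 0 ≤ a i ∧ a i < b i ∧ b i ≤ 1

/-- Figures: finite unions of rectangles in `[0,1]^d`. -/
def IsFigure {d : ℕ} (F : Set (E d)) : Prop :=
  ∃ R : Finset ((Fin d → ℝ) × (Fin d → ℝ)),
    (∀ p ∈ R, IsRectBounds p.1 p.2) ∧ F = ⋃ p ∈ R, rect p.1 p.2

/-- The restriction of `Δ` to figures is the increment `Δ_f`, i.e. the (unique) finitely additive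
function of figures given on rectangles by `rectIncrement f`. -/
def IsFigureIncrement {d : ℕ} (f : E d → ℝ) (Δ : Set (E d) → ℝ) : Prop :=
  (∀ a b : Fin d → ℝ, IsRectBounds a b → Δ (rect a b) = rectIncrement f a b) ∧
  (∀ F₁ F₂ : Set (E d), IsFigure F₁ → IsFigure F₂ → volume (F₁ ∩ F₂) = 0 →
    Δ (F₁ ∪ F₂) = Δ F₁ + Δ F₂)

/-- `f` is strongly chargeable: `Δ_f` extends from figures to a strong charge. -/
def StronglyChargeable {d : ℕ} (f : E d → ℝ) : Prop :=
  ∃ μ : Set (E d) → ℝ, IsStrongCharge μ ∧ IsFigureIncrement f μ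

/-! ### Dyadic cubes and the Haar and Faber-Schauder systems -/

/-- Lower bounds of the dyadic cube `∏ i, [2^(-n) m_i, 2^(-n) (m_i + 1)]`. -/
def dyadicLo {d : ℕ} (n : ℕ) (m : Fin d → ℕ) : Fin d → ℝ := fun i => (m i : ℝ) / 2 ^ n

/-- Upper bounds of the dyadic cube `∏ i, [2^(-n) m_i, 2^(-n) (m_i + 1)]`. -/
def dyadicHi {d : ℕ} (n : ℕ) (m : Fin d → ℕ) : Fin d → ℝ := fun i => ((m i : ℝ) + 1) / 2 ^ n

/-- A numbering `K_{n,k}`, `0 ≤ k < 2^(nd)`, of the dyadic cubes of each generation `n`, such that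
the `2^d` subcubes of generation `n+1` of `K_{n,k}` are the cubes `K_{n+1, 2^d k + ℓ}`,
`0 ≤ ℓ < 2^d`. The cube `K_{n,k}` is given by the integer vector `2^n • (its lower corner)`. -/
structure DyadicNumbering (d : ℕ) where
  corner : ℕ → ℕ → Fin d → ℕ
  bijOn : ∀ n, Set.BijOn (corner n) {k | k < 2 ^ (n * d)} {m | ∀ i, m i < 2 ^ n}
  subcube : ∀ n k l, k < 2 ^ (n * d) → l < 2 ^ d →
    ∀ i, corner (n + 1) (2 ^ d * k + l) i / 2 = corner n k i

/-- Such numberings exist: the subcubes of each cube can be numbered by the binary digits of `ℓ`. -/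
theorem DyadicNumbering.nonempty (d : ℕ) : Nonempty (DyadicNumbering d) := by
  let e : Fin (2 ^ d) ≃ (Fin d → Fin 2) := finFunctionFinEquiv.symm
  have hpos : 0 < 2 ^ d := by positivity
  let c : ℕ → ℕ → Fin d → ℕ := fun n => Nat.rec (fun _ _ => 0)
    (fun _ F k i => 2 * F (k / 2 ^ d) i + (e ⟨k % 2 ^ d, Nat.mod_lt _ hpos⟩ i : ℕ)) n
  have hc : ∀ n k i, c (n + 1) k i
      = 2 * c n (k / 2 ^ d) i + (e ⟨k % 2 ^ d, Nat.mod_lt _ hpos⟩ i : ℕ) := fun _ _ _ => rfl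
  have hdiv : ∀ n k i, c (n + 1) k i / 2 = c n (k / 2 ^ d) i := fun n k i => by
    have := (e ⟨k % 2 ^ d, Nat.mod_lt _ hpos⟩ i).isLt
    rw [hc]; omega
  have hP : ∀ n, 2 ^ ((n + 1) * d) = 2 ^ d * 2 ^ (n * d) := fun n => by ring
  refine ⟨⟨c, fun n => ?_, fun n k l _ hl i => ?_⟩⟩
  · induction n with
    | zero =>
      refine ⟨fun k _ i => ?_, fun k hk k' hk' _ => ?_, fun m hm => ⟨0, ?_, ?_⟩⟩
      · show 0 < 2 ^ 0
        norm_num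
      · simp only [zero_mul, pow_zero, Set.mem_ofPred_eq] at hk hk'
        omega
      · simp
      · funext i
        have := hm i
        show 0 = m i
        simp only [pow_zero] at this
        omega
    | succ n ih =>
      refine ⟨fun k hk i => ?_, fun k hk k' hk' h => ?_, fun m hm => ?_⟩
      · have h1 := ih.mapsTo (show k / 2 ^ d < 2 ^ (n * d) by
          rw [Nat.div_lt_iff_lt_mul hpos, mul_comm, ← hP]; exact hk) i
        have := (e ⟨k % 2 ^ d, Nat.mod_lt _ hpos⟩ i).isLt
        rw [hc, pow_succ]; omega
      · have h1 : k / 2 ^ d = k' / 2 ^ d := by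
          refine ih.injOn ?_ ?_ ?_
          · show k / 2 ^ d < 2 ^ (n * d)
            rw [Nat.div_lt_iff_lt_mul hpos, mul_comm, ← hP]; exact hk
          · show k' / 2 ^ d < 2 ^ (n * d)
            rw [Nat.div_lt_iff_lt_mul hpos, mul_comm, ← hP]; exact hk'
          · funext i
            rw [← hdiv, ← hdiv, h]
        have h2 : (⟨k % 2 ^ d, Nat.mod_lt _ hpos⟩ : Fin (2 ^ d))
            = ⟨k' % 2 ^ d, Nat.mod_lt _ hpos⟩ := by
          refine e.injective (funext fun i => Fin.ext ?_)
          have := congrFun h i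
          rw [hc, hc, h1] at this
          omega
        rw [← Nat.div_add_mod k (2 ^ d), ← Nat.div_add_mod k' (2 ^ d), h1, Fin.mk.inj h2]
      · let m' : Fin d → ℕ := fun i => m i / 2
        have hm' : ∀ i, m' i < 2 ^ n := fun i => by
          have := hm i
          rw [pow_succ] at this
          show m i / 2 < 2 ^ n
          omega
        obtain ⟨q, hq, hqm⟩ := ih.surjOn (a := m') hm'
        obtain ⟨l, hl⟩ := e.surjective fun i => ⟨m i % 2, Nat.mod_lt _ (by norm_num)⟩
        have e1 : (2 ^ d * q + l) / 2 ^ d = q := by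
          rw [Nat.mul_add_div hpos, Nat.div_eq_of_lt l.isLt, add_zero]
        have e2 : (⟨(2 ^ d * q + l) % 2 ^ d, Nat.mod_lt _ hpos⟩ : Fin (2 ^ d)) = l := by
          refine Fin.ext ?_
          show (2 ^ d * q + l) % 2 ^ d = l
          rw [Nat.mul_add_mod, Nat.mod_eq_of_lt l.isLt]
        refine ⟨2 ^ d * q + l, ?_, ?_⟩
        · show 2 ^ d * q + l < 2 ^ ((n + 1) * d)
          have hl' := l.isLt
          have : 2 ^ d * (q + 1) ≤ 2 ^ d * 2 ^ (n * d) := Nat.mul_le_mul_left _ hq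
          rw [hP]
          rw [mul_add] at this
          omega
        · funext i
          rw [hc, e1, e2, hl, hqm]
          show 2 * (m i / 2) + m i % 2 = m i
          omega
  · rw [hdiv, Nat.mul_add_div hpos, Nat.div_eq_of_lt hl, add_zero]

namespace DyadicNumbering

variable {d : ℕ} (K : DyadicNumbering d)

/-- The cube `K_{n,k}`. -/
def set (n k : ℕ) : Set (E d) := rect (dyadicLo n (K.corner n k)) (dyadicHi n (K.corner n k))

/-- The increment `Δ_f(K_{n,k})`. -/
def increment (f : E d → ℝ) (n k : ℕ) : ℝ :=
  rectIncrement f (dyadicLo n (K.corner n k)) (dyadicHi n (K.corner n k))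

end DyadicNumbering

/-- The entry `(A_d)_{r,l}`, `0 ≤ r, l < 2^d`, of the matrix with `A_0 = (1)` and
`A_{d+1} = [[A_d, A_d], [A_d, -A_d]]`. -/
def hadamard : ℕ → ℕ → ℕ → ℝ
  | 0, _, _ => 1
  | d + 1, r, l =>
    (if 2 ^ d ≤ r ∧ 2 ^ d ≤ l then -1 else 1) * hadamard d (r % 2 ^ d) (l % 2 ^ d)

/-- The Haar function `g_{n,k,r}`. -/
def haar {d : ℕ} (K : DyadicNumbering d) (n k r : ℕ) (x : E d) : ℝ :=
  (2 : ℝ) ^ ((n * d : ℝ) / 2) * ∑ l ∈ Finset.range (2 ^ d),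
    hadamard d r l * (K.set (n + 1) (2 ^ d * k + l)).indicator (fun _ => (1 : ℝ)) x

/-- The coefficient `λ_{n,k,r}(f)`. -/
def lam {d : ℕ} (K : DyadicNumbering d) (f : E d → ℝ) (n k r : ℕ) : ℝ :=
  (2 : ℝ) ^ ((n * d : ℝ) / 2) * ∑ l ∈ Finset.range (2 ^ d),
    hadamard d r l * K.increment f (n + 1) (2 ^ d * k + l)

/- The lexicographic enumeration of the index set `-1, (n,k,r)`, where `n ≥ 0`, `0 ≤ k < 2^(nd)` and
`1 ≤ r ≤ 2^d - 1`. Rank `0` is the index `-1`. The indices of generation `n` have the ranks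
`2^(nd), …, 2^((n+1)d) - 1`, and the rank of `(n,k,r)` is `2^(nd) + (2^d - 1) k + (r - 1)`. -/

/-- The generation number of the index of rank `j ≥ 1`. -/
def genNo (d j : ℕ) : ℕ := Nat.log (2 ^ d) j

/-- The cube number of the index of rank `j ≥ 1`. -/
def cubeNo (d j : ℕ) : ℕ := (j - 2 ^ (genNo d j * d)) / (2 ^ d - 1)

/-- The type number of the index of rank `j ≥ 1`. -/
def typeNo (d j : ℕ) : ℕ := (j - 2 ^ (genNo d j * d)) % (2 ^ d - 1) + 1

theorem index_of_rank (d n k r : ℕ) (hd : 1 ≤ d) (hk : k < 2 ^ (n * d)) (hr : 1 ≤ r)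
    (hr' : r ≤ 2 ^ d - 1) :
    genNo d (2 ^ (n * d) + (2 ^ d - 1) * k + (r - 1)) = n ∧
    cubeNo d (2 ^ (n * d) + (2 ^ d - 1) * k + (r - 1)) = k ∧
    typeNo d (2 ^ (n * d) + (2 ^ d - 1) * k + (r - 1)) = r := by
  have h2 : 2 ≤ 2 ^ d := by
    calc 2 = 2 ^ 1 := rfl
      _ ≤ 2 ^ d := Nat.pow_le_pow_right (by norm_num) hd
  have hgen : genNo d (2 ^ (n * d) + (2 ^ d - 1) * k + (r - 1)) = n := by
    unfold genNo
    have hP : (2 ^ d) ^ n = 2 ^ (n * d) := by rw [← pow_mul, mul_comm]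
    refine Nat.log_eq_of_pow_le_of_lt_pow ?_ ?_
    · rw [hP]; omega
    · rw [pow_succ, hP]
      generalize 2 ^ (n * d) = P at *
      obtain ⟨m, hm⟩ : ∃ m, 2 ^ d = m + 1 := ⟨2 ^ d - 1, by omega⟩
      rw [hm] at hr' ⊢
      simp only [Nat.add_sub_cancel] at hr' ⊢
      have : m * (k + 1) ≤ m * P := Nat.mul_le_mul_left m hk
      have e1 : m * (k + 1) = m * k + m := by ring
      have e2 : P * (m + 1) = m * P + P := by ring
      omega
  have hsub : 2 ^ (n * d) + (2 ^ d - 1) * k + (r - 1) - 2 ^ (n * d)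
      = (r - 1) + (2 ^ d - 1) * k := by omega
  refine ⟨hgen, ?_, ?_⟩
  · unfold cubeNo
    rw [hgen, hsub, Nat.add_mul_div_left _ _ (by omega), Nat.div_eq_of_lt (by omega), zero_add]
  · unfold typeNo
    rw [hgen, hsub, Nat.add_mul_mod_self_left, Nat.mod_eq_of_lt (by omega)]
    omega

/-- The Haar basis `g_{-1}, g_{0,0,1}, …` as a sequence. -/
def haarSeq {d : ℕ} (K : DyadicNumbering d) : ℕ → E d → ℝ
  | 0 => (cube d).indicator fun _ => 1
  | j + 1 => haar K (genNo d (j + 1)) (cubeNo d (j + 1)) (typeNo d (j + 1))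

/-- The coefficients `λ_{-1}(f) = Δ_f([0,1]^d), λ_{0,0,1}(f), …` as a sequence. -/
def lamSeq {d : ℕ} (K : DyadicNumbering d) (f : E d → ℝ) : ℕ → ℝ
  | 0 => rectIncrement f (fun _ => 0) (fun _ => 1)
  | j + 1 => lam K f (genNo d (j + 1)) (cubeNo d (j + 1)) (typeNo d (j + 1))

/-- The functional `T_g` for a bounded measurable function `g`. -/
def T {d : ℕ} (g : E d → ℝ) (hg : Measurable g) (hb : ∃ C, ∀ x, ‖g x‖ ≤ C) : BV d →L[ℝ] ℝ :=
  LinearMap.mkContinuousOfExistsBound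
    { toFun := fun u => ∫ x in cube d, g x * u x
      map_add' := fun u w => by
        obtain ⟨C, hC⟩ := hb
        have hi : ∀ u : BV d, Integrable (fun x => g x * u x) (volume.restrict (cube d)) :=
          fun u => (u.integrable.restrict).bdd_mul hg.aestronglyMeasurable
            (Eventually.of_forall hC)
        rw [← integral_add (hi u) (hi w)]
        refine integral_congr_ae (ae_restrict_of_ae ?_)
        filter_upwards [BV.coe_add u w] with x hx
        rw [hx, mul_add]
      map_smul' := fun c u => by
        rw [RingHom.id_apply, smul_eq_mul, ← integral_const_mul]
        refine integral_congr_ae (ae_restrict_of_ae ?_)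
        filter_upwards [BV.coe_smul c u] with x hx
        rw [hx, mul_left_comm] }
    (by
      obtain ⟨C, hC⟩ := hb
      refine ⟨C, fun u => ?_⟩
      have h0 : 0 ≤ C := (norm_nonneg _).trans (hC 0)
      calc ‖∫ x in cube d, g x * u x‖ ≤ ∫ x in cube d, C * ‖u x‖ := by
            refine norm_integral_le_of_norm_le (u.integrable.restrict.norm.const_mul C)
              (Eventually.of_forall fun x => ?_)
            rw [norm_mul]
            exact mul_le_mul_of_nonneg_right (hC x) (norm_nonneg _)
        _ ≤ ∫ x, C * ‖u x‖ := setIntegral_le_integral (u.integrable.norm.const_mul C)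
            (Eventually.of_forall fun x => by positivity)
        _ = C * ‖BV.toL1 u‖ := by rw [integral_const_mul, L1.norm_eq_integral_norm]
        _ ≤ C * ‖u‖ := by
            refine mul_le_mul_of_nonneg_left ?_ h0
            rw [BV.norm_def]
            exact le_add_of_nonneg_right ENNReal.toReal_nonneg)

theorem T_mem_SCH {d : ℕ} (g : E d → ℝ) (hg : Measurable g) (hb : ∃ C, ∀ x, ‖g x‖ ≤ C) :
    T g hg hb ∈ SCH d := by
  have : IsFiniteMeasure ((volume : Measure (E d)).restrict (cube d)) :=
    isFiniteMeasure_restrict.2 (volume_cube_lt_top d).ne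
  refine (rangeT d).le_topologicalClosure ⟨g, ?_, fun u => ⟨?_, rfl⟩⟩
  · obtain ⟨C, hC⟩ := hb
    exact MemLp.of_bound hg.aestronglyMeasurable C (Eventually.of_forall hC)
  · obtain ⟨C, hC⟩ := hb
    exact (u.integrable.restrict).bdd_mul hg.aestronglyMeasurable (Eventually.of_forall hC)

theorem measurable_haarSeq {d : ℕ} (K : DyadicNumbering d) (j : ℕ) :
    Measurable (haarSeq K j) := by
  cases j with
  | zero => exact measurable_const.indicator (measurableSet_rect _ _)
  | succ j =>
    refine Measurable.const_mul ?_ _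
    refine Finset.measurable_fun_sum _ fun l _ => ?_
    exact (measurable_const.indicator (measurableSet_rect _ _)).const_mul _

theorem bounded_haarSeq {d : ℕ} (K : DyadicNumbering d) (j : ℕ) :
    ∃ C, ∀ x, ‖haarSeq K j x‖ ≤ C := by
  have hind : ∀ (s : Set (E d)) (x : E d), ‖s.indicator (fun _ => (1 : ℝ)) x‖ ≤ 1 := fun s x =>
    (norm_indicator_le_norm_self _ _).trans (by simp)
  cases j with
  | zero => exact ⟨1, hind _⟩
  | succ j =>
    refine ⟨‖(2 : ℝ) ^ ((genNo d (j + 1) * d : ℝ) / 2)‖ * ∑ l ∈ Finset.range (2 ^ d),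
      ‖hadamard d (typeNo d (j + 1)) l‖, fun x => ?_⟩
    simp only [haarSeq, haar, norm_mul]
    refine mul_le_mul_of_nonneg_left ((norm_sum_le _ _).trans (Finset.sum_le_sum fun l _ => ?_))
      (norm_nonneg _)
    rw [norm_mul]
    exact mul_le_of_le_one_right (norm_nonneg _) (hind _ _)

/-- The Faber-Schauder system `T_{g_{-1}}, T_{g_{0,0,1}}, …` in `SCH([0,1]^d)`, as a sequence. -/
def faberSchauder {d : ℕ} (K : DyadicNumbering d) (j : ℕ) : SCH d :=
  ⟨T (haarSeq K j) (measurable_haarSeq K j) (bounded_haarSeq K j), T_mem_SCH _ _ _⟩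

/-- The series with terms `a 0, a 1, a 2, …` converges in `SCH([0,1]^d)`. -/
def SeriesConverges {d : ℕ} (a : ℕ → SCH d) : Prop :=
  ∃ α : SCH d, Tendsto (fun N => ∑ j ∈ Finset.range N, a j) atTop (𝓝 α)

end StrongCharge

end

namespace StrongCharge

open scoped Convolution

variable {d : ℕ}

/-! Let S_N u be the N-th partial sum of the Haar expansion of u in `BV` (`haarSum`). If Δ_f extends
to B ↦ α(1_B), then λ_j(f) = α(g_j), and the N-th partial sum of the Faber–Schauder series is the
functional α ∘ S_N. Norm convergence to α therefore means |α(S_N u) - α(u)| ≤ ε‖u‖ for all u once N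
is large (`exists_abs_haarSum_sub_le`). Two facts give this.

The operators S_N are uniformly bounded on `BV` (`exists_norm_haarSum_le`). After a complete
generation n, S_N is the averaging over the dyadic cubes of side 2^(-n). It contracts the L¹ norm
and the L¹ moduli of lattice translations, and for functions constant on cells these moduli at the
single scale 2^(-n) control the variation (`IsGrid.variation_le`). Within a generation, the Haar
coefficients are combinations of differences of integrals over neighbouring cells, so the remainder
has L¹ norm O(2^(-n)‖u‖). It is constant on the cells of generation n + 1, hence its variation
exceeds its L¹ norm by a factor O(2^n) at most, and the powers of 2 cancel.

The functionals T_h with h continuous are dense in `SCH` (`exists_continuous_approx`), by the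
embedding of `BV` in L^(d/(d-1)) and Hölder's inequality. For such h, averaging costs only the
oscillation of h on small cubes, and the remainder vanishes in L¹.

Conversely, let the series converge to α. The density of the T_h also shows that B ↦ α(1_B) is a
charge (`tendsto_of_mem_SCH`). By the orthogonality of the Hadamard matrix, the partial sum over the
generations below n takes exactly the value Δ_f(R) on a rectangle R with vertices in the lattice of
mesh 2^(-n) (`partialSum_apply_rect`). An arbitrary rectangle is approximated by such rectangles:
the indicators stay bounded in `BV`, so norm convergence of the partial sums, continuity of the
charge and continuity of f identify α(1_R) with Δ_f(R). Additivity on figures comes from additivity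
of the charge. -/

/-! ### Variation and `L¹` moduli of translation. -/

/-- The `L¹` modulus of translation `∫ |u(x + z) - u(x)| dx`. -/
noncomputable def modulus (u : E d → ℝ) (z : E d) : ℝ := ∫ x, |u (x + z) - u x|

/-- The `i`-th vector of the standard basis. -/
noncomputable abbrev unitVec (i : Fin d) : E d := EuclideanSpace.single i 1

theorem modulus_nonneg (u : E d → ℝ) (z : E d) : 0 ≤ modulus u z :=
  integral_nonneg fun _ => abs_nonneg _

theorem modulus_zero_right (u : E d → ℝ) : modulus u 0 = 0 := by simp [modulus]

theorem comp_add_right_ae_eq {u w : E d → ℝ} (h : u =ᵐ[volume] w) (z : E d) :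
    (fun x => u (x + z)) =ᵐ[volume] fun x => w (x + z) :=
  (measurePreserving_add_right volume z).quasiMeasurePreserving.ae_eq_comp h

theorem modulus_congr {u w : E d → ℝ} (h : u =ᵐ[volume] w) (z : E d) :
    modulus u z = modulus w z := by
  refine integral_congr_ae ?_
  filter_upwards [h, comp_add_right_ae_eq h z] with x h1 h2
  rw [h1, h2]

theorem integrable_translate_sub {u : E d → ℝ} (hu : Integrable u) (z : E d) :
    Integrable fun x => u (x + z) - u x := (hu.comp_add_right z).sub hu

theorem modulus_le_two_mul {u : E d → ℝ} (hu : Integrable u) (z : E d) :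
    modulus u z ≤ 2 * ∫ x, |u x| := by
  calc modulus u z ≤ ∫ x, (|u (x + z)| + |u x|) :=
        integral_mono (integrable_translate_sub hu z).abs ((hu.comp_add_right z).abs.add hu.abs)
          fun x => abs_sub _ _
    _ = 2 * ∫ x, |u x| := by
        rw [integral_add (hu.comp_add_right z).abs hu.abs,
          integral_add_right_eq_self (fun x => |u x|) z]
        ring

theorem modulus_add_le {u : E d → ℝ} (hu : Integrable u) (z z' : E d) :
    modulus u (z + z') ≤ modulus u z + modulus u z' := by
  have h1 := (integrable_translate_sub hu z').abs.comp_add_right z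
  have h2 := (integrable_translate_sub hu z).abs
  calc modulus u (z + z')
      ≤ ∫ x, (|u (x + z + z') - u (x + z)| + |u (x + z) - u x|) := by
        refine integral_mono (integrable_translate_sub hu _).abs (h1.add h2) fun x => ?_
        simp only [← add_assoc]
        exact abs_sub_le _ _ _
    _ = modulus u z + modulus u z' := by
        rw [integral_add h1 h2, add_comm]
        congr 1
        exact integral_add_right_eq_self (fun x => |u (x + z') - u x|) z

/-- The directional derivative as a limit of difference quotients, tested against `w`. -/
theorem integral_mul_fderiv_le_of_modulus_le {w φ : E d → ℝ} (hw : Integrable w)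
    (hφ : ContDiff ℝ 1 φ) (hφc : HasCompactSupport φ) (hφ1 : ∀ x, |φ x| ≤ 1) (e : E d)
    {t : ℕ → ℝ} (ht : ∀ m, 0 < t m) (ht0 : Tendsto t atTop (𝓝 0)) {C : ℝ}
    (h : ∀ m, modulus w (t m • e) ≤ C * t m) : ∫ x, w x * fderiv ℝ φ x e ≤ C := by
  obtain ⟨L, hL⟩ := hφ.lipschitzWith_of_hasCompactSupport hφc (by norm_num)
  have hφi : ∀ z : E d, Integrable fun x => w x * φ (x - z) := fun z =>
    hw.mul_bdd (c := 1) (hφ.continuous.comp (continuous_id.sub continuous_const)).aestronglyMeasurable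
      (Eventually.of_forall fun x => hφ1 _)
  have hlim : Tendsto (fun m => ∫ x, w x * ((t m)⁻¹ * (φ x - φ (x - t m • e)))) atTop
      (𝓝 (∫ x, w x * fderiv ℝ φ x e)) := by
    refine tendsto_integral_of_dominated_convergence (fun x => |w x| * (L * ‖e‖)) (fun m => ?_)
      (hw.abs.mul_const _) (fun m => Eventually.of_forall fun x => ?_)
      (Eventually.of_forall fun x => ?_)
    · refine hw.aestronglyMeasurable.mul (Continuous.aestronglyMeasurable ?_)
      have := hφ.continuous
      fun_prop
    · rw [norm_mul, Real.norm_eq_abs]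
      refine mul_le_mul_of_nonneg_left ?_ (abs_nonneg _)
      rw [norm_mul, norm_inv, Real.norm_eq_abs (t m), abs_of_pos (ht m), inv_mul_le_iff₀ (ht m),
        ← dist_eq_norm]
      refine (hL.dist_le_mul _ _).trans_eq ?_
      rw [dist_eq_norm, sub_sub_cancel, norm_smul, Real.norm_eq_abs, abs_of_pos (ht m)]
      ring
    · refine Tendsto.const_mul _ ?_
      have hd := ((hφ.differentiable (by norm_num)) x).hasFDerivAt.hasLineDerivAt e
      have h2 := hd.tendsto_slope_zero
      -- The difference quotient of φ uses the step -t, so that the change of variables below turns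
      -- it into the forward difference of w.
      have ht1 : Tendsto (fun m => - t m) atTop (𝓝[≠] 0) := by
        refine tendsto_nhdsWithin_iff.2 ⟨by simpa using ht0.neg, Eventually.of_forall fun m => ?_⟩
        simpa using (ht m).ne'
      refine (h2.comp ht1).congr fun m => ?_
      simp only [Function.comp, smul_eq_mul, neg_smul, inv_neg,
        sub_eq_add_neg]
      ring
  refine le_of_tendsto' hlim fun m => ?_
  have e1 : ∫ x, w x * ((t m)⁻¹ * (φ x - φ (x - t m • e)))
      = (t m)⁻¹ * ∫ x, (w x - w (x + t m • e)) * φ x := by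
    have i1 := hφi 0
    simp only [sub_zero] at i1
    have i2 := (hφi (t m • e)).comp_add_right (t m • e)
    simp only [add_sub_cancel_right] at i2
    have : ∫ x, w x * φ (x - t m • e) = ∫ x, w (x + t m • e) * φ x := by
      rw [← integral_add_right_eq_self (fun x => w x * φ (x - t m • e)) (t m • e)]
      simp only [add_sub_cancel_right]
    simp only [sub_mul]
    rw [integral_sub i1 i2, ← this, ← integral_sub i1 (hφi _), ← integral_const_mul]
    congr 1 with x
    ring
  rw [e1, inv_mul_le_iff₀ (ht m), mul_comm (t m)]
  refine le_trans ?_ (h m)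
  have h0 := (integrable_translate_sub hw (t m • e)).abs
  refine (le_abs_self _).trans ((abs_integral_le_integral_abs).trans ?_)
  refine integral_mono_of_nonneg (Eventually.of_forall fun x => abs_nonneg _) h0
    (Eventually.of_forall fun x => ?_)
  simp only [abs_mul]
  rw [abs_sub_comm]
  exact mul_le_of_le_one_right (abs_nonneg _) (hφ1 x)

theorem abs_coord_le_norm (x : E d) (i : Fin d) : |x i| ≤ ‖x‖ := PiLp.norm_apply_le x i

theorem IsTestField.coord {v : E d → E d} (hv : IsTestField v) (i : Fin d) :
    ContDiff ℝ 1 (fun x => v x i) ∧ HasCompactSupport (fun x => v x i) ∧ (∀ x, |v x i| ≤ 1) ∧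
      ∀ x e, fderiv ℝ (fun x => v x i) x e = (fderiv ℝ v x e) i := by
  have hp : ContDiff ℝ 1 (fun x => v x i) := (contDiff_euclidean.1 hv.1) i
  refine ⟨hp, ?_, fun x => (abs_coord_le_norm _ _).trans (hv.2.2 x), fun x e => ?_⟩
  · refine hv.2.1.mono fun x hx => ?_
    contrapose! hx
    simp only [Function.mem_support, not_not] at hx ⊢
    simp [hx]
  · have h1 := ((hv.1.differentiable (by norm_num)) x).hasFDerivAt
    have h2 := (EuclideanSpace.proj (𝕜 := ℝ) i).hasFDerivAt.comp x h1
    have h3 : HasFDerivAt (fun x => v x i)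
      ((EuclideanSpace.proj (𝕜 := ℝ) i).comp (fderiv ℝ v x)) x := h2
    rw [h3.fderiv]
    rfl

/-- The divergence is split by coordinates, and each coordinate of a test field is itself bounded by
1. Only one sequence of scales tending to 0 is required; for functions constant on cells, suitable
fractions of the mesh will serve. -/
theorem variation_le_of_modulus_le {w : E d → ℝ} (hw : Integrable w) {t : ℕ → ℝ}
    (ht : ∀ m, 0 < t m) (ht0 : Tendsto t atTop (𝓝 0)) {C : Fin d → ℝ}
    (h : ∀ i m, modulus w (t m • unitVec i) ≤ C i * t m) :
    variation w ≤ ENNReal.ofReal (∑ i, C i) := by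
  refine iSup₂_le fun v hv => ENNReal.ofReal_le_ofReal ?_
  have hi : ∀ i : Fin d, Integrable fun x => w x * (fderiv ℝ v x (unitVec i)) i := fun i => by
    obtain ⟨h1, h2, h3, h4⟩ := hv.coord i
    have hc : Continuous fun x => (fderiv ℝ v x (unitVec i)) i := by
      have := hv.1.continuous_fderiv (by norm_num)
      fun_prop
    have hs : HasCompactSupport fun x => (fderiv ℝ v x (unitVec i)) i := by
      refine (hv.2.1.fderiv (𝕜 := ℝ)).mono fun x hx => ?_
      contrapose! hx
      simp only [Function.mem_support, not_not] at hx ⊢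
      simp [hx]
    obtain ⟨B, hB⟩ := hc.bounded_above_of_compact_support hs
    exact hw.mul_bdd hc.aestronglyMeasurable (Eventually.of_forall hB)
  simp only [divergence, Finset.mul_sum]
  rw [integral_finsetSum _ fun i _ => hi i]
  refine Finset.sum_le_sum fun i _ => ?_
  obtain ⟨h1, h2, h3, h4⟩ := hv.coord i
  simp only [← h4]
  exact integral_mul_fderiv_le_of_modulus_le hw h1 h2 h3 _ ht ht0 (h i)

/-! ### Mollification and smooth approximation in `BV`. -/

/-- The convolution of `f` with `ρ`. -/
noncomputable def mollify (f ρ : E d → ℝ) (x : E d) : ℝ := ∫ y, f y * ρ (x - y)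

theorem mollify_eq_convolution (f ρ : E d → ℝ) :
    mollify f ρ = f ⋆[ContinuousLinearMap.lsmul ℝ ℝ, volume] ρ := rfl

theorem contDiff_mollify {f ρ : E d → ℝ} (hf : LocallyIntegrable f) (hρ : ContDiff ℝ 1 ρ)
    (hρc : HasCompactSupport ρ) : ContDiff ℝ 1 (mollify f ρ) := by
  rw [mollify_eq_convolution]
  refine contDiff_one_iff_hasFDerivAt.2
    ⟨_, ?_, fun x => hρc.hasFDerivAt_convolution_right _ hf hρ x⟩
  exact HasCompactSupport.continuous_convolution_right _ (hρc.fderiv (𝕜 := ℝ)) hf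
    (hρ.continuous_fderiv (by norm_num))

theorem hasCompactSupport_mollify {f ρ : E d → ℝ} (hf : HasCompactSupport f)
    (hρ : HasCompactSupport ρ) : HasCompactSupport (mollify f ρ) := by
  rw [mollify_eq_convolution]
  exact hf.convolution _ hρ

open ContinuousLinearMap in
theorem fderiv_mollify_apply {f ρ : E d → ℝ} (hf : LocallyIntegrable f) (hρ : ContDiff ℝ 1 ρ)
    (hρc : HasCompactSupport ρ) (x e : E d) :
    fderiv ℝ (mollify f ρ) x e = ∫ y, f y * fderiv ℝ ρ (x - y) e := by
  rw [mollify_eq_convolution, (hρc.hasFDerivAt_convolution_right (lsmul ℝ ℝ) hf hρ x).fderiv,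
    convolution_precompR_apply (lsmul ℝ ℝ) hf (hρc.fderiv (𝕜 := ℝ))
      (hρ.continuous_fderiv (by norm_num))]
  rfl

theorem HasCompactSupport.fderiv_apply' {U : E d → ℝ} (hU : HasCompactSupport U) (e : E d) :
    HasCompactSupport fun x => fderiv ℝ U x e := by
  refine (hU.fderiv (𝕜 := ℝ)).mono fun x hx => ?_
  contrapose! hx
  simp only [Function.mem_support, not_not] at hx ⊢
  simp [hx]

theorem continuous_fderiv_apply' {U : E d → ℝ} (hU : ContDiff ℝ 1 U) (e : E d) :
    Continuous fun x => fderiv ℝ U x e := by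
  have := hU.continuous_fderiv (by norm_num)
  fun_prop

/-- A bounded compactly supported function whose product with the continuous compactly supported
function `D` is `-|D|`. -/
theorem exists_neg_sign {D : E d → ℝ} (hD : Continuous D) (hDc : HasCompactSupport D) :
    ∃ s : E d → ℝ, Integrable s ∧ HasCompactSupport s ∧ (∀ x, |s x| ≤ 1) ∧
      ∀ x, s x * D x = -|D x| := by
  let s : E d → ℝ := fun x => - SignType.sign (D x)
  have hs1 : ∀ x, |s x| ≤ 1 := fun x => by
    simp only [s, abs_neg]
    rcases lt_trichotomy (D x) 0 with h | h | h <;> simp [h]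
  have hsm : Measurable s := by
    have hm := hD.measurable
    have : s = fun x => if 0 < D x then (-1 : ℝ) else if D x < 0 then 1 else 0 := by
      funext x
      simp only [s, sign_apply]
      split_ifs <;> simp
    rw [this]
    exact Measurable.ite (measurableSet_lt measurable_const hm) measurable_const
      (Measurable.ite (measurableSet_lt hm measurable_const) measurable_const measurable_const)
  have hsc : HasCompactSupport s := by
    refine hDc.mono fun x hx => ?_
    contrapose! hx
    simp only [Function.mem_support, not_not] at hx ⊢
    simp [s, hx]
  refine ⟨s, ?_, hsc, hs1, fun x => ?_⟩
  · refine (integrable_indicator_iff (s := tsupport s) (isClosed_tsupport s).measurableSet).2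
      (IntegrableOn.of_bound hsc.isCompact.measure_lt_top hsm.aestronglyMeasurable 1
        (Eventually.of_forall hs1)) |>.congr (Eventually.of_forall fun x => ?_)
    by_cases hx : x ∈ tsupport s
    · simp [hx]
    · simp [hx, image_eq_zero_of_notMem_tsupport hx]
  · simp only [s, neg_mul, sign_mul_self]

theorem fderiv_even {ρ : E d → ℝ} (hρ : ContDiff ℝ 1 ρ) (hev : ∀ x, ρ (-x) = ρ x) (x e : E d) :
    fderiv ℝ ρ (-x) e = - fderiv ℝ ρ x e := by
  have h1 : HasFDerivAt ρ (fderiv ℝ ρ (-x)) (-x) :=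
    ((hρ.differentiable (by norm_num)) (-x)).hasFDerivAt
  have h2 := h1.comp x (hasFDerivAt_id x).neg
  have h3 : ρ ∘ (fun x => -x) = ρ := funext hev
  have h4 : HasFDerivAt ρ ((fderiv ℝ ρ (-x)).comp (-(ContinuousLinearMap.id ℝ (E d)))) x := by
    have := h2
    rwa [show ρ ∘ Neg.neg = ρ from h3] at this
  rw [h4.fderiv]
  simp

theorem integral_mul_fderiv_le_variation {u g : E d → ℝ} (hv : variation u < ∞)
    (hg : ContDiff ℝ 1 g) (hgc : HasCompactSupport g) (hg1 : ∀ x, |g x| ≤ 1) (i : Fin d) :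
    ∫ x, u x * fderiv ℝ g x (unitVec i) ≤ (variation u).toReal := by
  let v : E d → E d := fun x => g x • unitVec i
  have hvt : IsTestField v := by
    refine ⟨hg.smul contDiff_const, hgc.smul_right, fun x => ?_⟩
    simp only [v, norm_smul]
    simpa using hg1 x
  have hdiv : ∀ x, divergence v x = fderiv ℝ g x (unitVec i) := fun x => by
    have h1 : HasFDerivAt v ((fderiv ℝ g x).smulRight (unitVec i)) x :=
      ((hg.differentiable (by norm_num)) x).hasFDerivAt.smul_const _
    unfold divergence
    rw [h1.fderiv, Finset.sum_eq_single i]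
    · simp
    · intro j _ hj
      simp [hj.symm]
    · simp
  have := le_iSup₂ (f := fun (v : E d → E d) (_ : IsTestField v) =>
      ENNReal.ofReal (∫ x, u x * divergence v x)) v hvt
  simp only [hdiv] at this
  exact (ENNReal.ofReal_le_iff_le_toReal hv.ne).1 this

/-- An even kernel has odd derivatives, so Fubini's theorem makes the derivative of the
mollification skew-adjoint. -/
theorem integral_mul_fderiv_mollify {u s ρ : E d → ℝ} (hu : Integrable u) (hs : Integrable s)
    (hρ : ContDiff ℝ 1 ρ) (hρc : HasCompactSupport ρ) (hev : ∀ x, ρ (-x) = ρ x) (e : E d) :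
    ∫ x, s x * fderiv ℝ (mollify u ρ) x e = - ∫ y, u y * fderiv ℝ (mollify s ρ) y e := by
  have hρd := continuous_fderiv_apply' hρ e
  obtain ⟨B, hB⟩ := hρd.bounded_above_of_compact_support
    (HasCompactSupport.fderiv_apply' hρc e)
  have hF : Integrable (fun p : E d × E d => s p.1 * u p.2 * fderiv ℝ ρ (p.1 - p.2) e)
      (volume.prod volume) :=
    (hs.mul_prod hu).mul_bdd (c := B)
      (hρd.comp (continuous_fst.sub continuous_snd)).aestronglyMeasurable
      (Eventually.of_forall fun p => hB _)
  calc ∫ x, s x * fderiv ℝ (mollify u ρ) x e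
      = ∫ x, ∫ y, s x * u y * fderiv ℝ ρ (x - y) e := by
        congr 1 with x
        simp only [mul_assoc]
        rw [integral_const_mul, fderiv_mollify_apply hu.locallyIntegrable hρ hρc]
    _ = ∫ y, ∫ x, s x * u y * fderiv ℝ ρ (x - y) e := integral_integral_swap hF
    _ = - ∫ y, u y * fderiv ℝ (mollify s ρ) y e := by
        rw [← integral_neg]
        congr 1 with y
        rw [fderiv_mollify_apply hs.locallyIntegrable hρ hρc, ← integral_const_mul, ← integral_neg]
        congr 1 with x
        rw [← neg_sub y x, fderiv_even hρ hev]
        ring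

theorem abs_mollify_le {s ρ : E d → ℝ} (hs1 : ∀ x, |s x| ≤ 1) (hρ : ContDiff ℝ 1 ρ)
    (hρc : HasCompactSupport ρ) (hρ0 : ∀ x, 0 ≤ ρ x) (hρ1 : ∫ x, ρ x = 1) (y : E d) :
    |mollify s ρ y| ≤ 1 := by
  have hρi : Integrable ρ := hρ.continuous.integrable_of_hasCompactSupport hρc
  rw [← Real.norm_eq_abs, ← hρ1, ← integral_sub_left_eq_self ρ volume y]
  refine norm_integral_le_of_norm_le (hρi.comp_sub_left y) (Eventually.of_forall fun x => ?_)
  rw [norm_mul, Real.norm_eq_abs, Real.norm_eq_abs, abs_of_nonneg (hρ0 _)]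
  exact mul_le_of_le_one_left (hρ0 _) (hs1 x)

/-- Duality: the L¹ norm of the derivative is attained against a sign function s, and
skew-adjointness moves the derivative onto the mollification of s. That is C¹, compactly supported
and bounded by 1, hence an admissible test function for the variation of u. -/
theorem integral_abs_fderiv_mollify_le {u ρ : E d → ℝ} (hu : Integrable u)
    (huc : HasCompactSupport u) (hv : variation u < ∞) (hρ : ContDiff ℝ 1 ρ)
    (hρc : HasCompactSupport ρ) (hρ0 : ∀ x, 0 ≤ ρ x) (hev : ∀ x, ρ (-x) = ρ x)
    (hρ1 : ∫ x, ρ x = 1) (i : Fin d) :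
    ∫ x, |fderiv ℝ (mollify u ρ) x (unitVec i)| ≤ (variation u).toReal := by
  obtain ⟨s, hsi, hsc, hs1, hsD⟩ := exists_neg_sign
    (continuous_fderiv_apply' (contDiff_mollify hu.locallyIntegrable hρ hρc) (unitVec i))
    (HasCompactSupport.fderiv_apply' (hasCompactSupport_mollify huc hρc) _)
  have key := integral_mul_fderiv_mollify hu hsi hρ hρc hev (unitVec i)
  -- The minus sign in the choice of s cancels that of the integration by parts.
  simp only [hsD, integral_neg, neg_inj] at key
  rw [key]
  exact integral_mul_fderiv_le_variation hv (contDiff_mollify hsi.locallyIntegrable hρ hρc)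
    (hasCompactSupport_mollify hsc hρc) (abs_mollify_le hs1 hρ hρc hρ0 hρ1) i

theorem ae_tendsto_mollify {u : E d → ℝ} (hu : Integrable u) (φ : ℕ → ContDiffBump (0 : E d))
    (h0 : Tendsto (fun n => (φ n).rOut) atTop (𝓝 0)) (h2 : ∀ n, (φ n).rOut ≤ 2 * (φ n).rIn) :
    ∀ᵐ x, Tendsto (fun n => mollify u ((φ n).normed volume) x) atTop (𝓝 (u x)) := by
  have := ContDiffBump.ae_convolution_tendsto_right_of_locallyIntegrable (μ := volume) (K := 2) h0
    (Eventually.of_forall h2) hu.locallyIntegrable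
  filter_upwards [this] with x hx
  refine hx.congr fun n => ?_
  rw [convolution_eq_swap, mollify]
  simp only [ContinuousLinearMap.lsmul_apply, smul_eq_mul, mul_comm]

/-- Approximation of a function of bounded variation by compactly supported `C^1` functions. -/
theorem exists_smooth_approx {u : E d → ℝ} (hu : Integrable u)
    (huc : HasCompactSupport u) (hv : variation u < ∞) :
    ∃ U : ℕ → E d → ℝ, (∀ n, ContDiff ℝ 1 (U n) ∧ HasCompactSupport (U n) ∧
      ∀ i, ∫ x, |fderiv ℝ (U n) x (unitVec i)| ≤ (variation u).toReal) ∧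
      ∀ᵐ x, Tendsto (fun n => U n x) atTop (𝓝 (u x)) := by
  -- The ratio 2 of the radii stays bounded, as needed for a.e. convergence by Lebesgue
  -- differentiation.
  let φ : ℕ → ContDiffBump (0 : E d) := fun n =>
    ⟨1 / ((n : ℝ) + 1), 2 * (1 / ((n : ℝ) + 1)), by positivity, by
      have : (0 : ℝ) < 1 / ((n : ℝ) + 1) := by positivity
      linarith⟩
  have h0 : Tendsto (fun n => (φ n).rOut) atTop (𝓝 0) := by
    simpa [φ] using (tendsto_one_div_add_atTop_nhds_zero_nat (𝕜 := ℝ)).const_mul 2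
  refine ⟨fun n => mollify u ((φ n).normed volume), fun n => ?_,
    ae_tendsto_mollify hu φ h0 fun n => le_rfl⟩
  have h1 : ContDiff ℝ 1 ((φ n).normed volume) := (φ n).contDiff_normed (n := 1)
  have h2 := (φ n).hasCompactSupport_normed (μ := volume)
  exact ⟨contDiff_mollify hu.locallyIntegrable h1 h2, hasCompactSupport_mollify huc h2,
    integral_abs_fderiv_mollify_le hu huc hv h1 h2 (φ n).nonneg_normed (φ n).normed_neg
      (φ n).integral_normed⟩

theorem modulus_eq_toReal_eLpNorm {u : E d → ℝ} (hu : AEStronglyMeasurable u) (z : E d) :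
    modulus u z = (eLpNorm (fun x => u (x + z) - u x) 1 volume).toReal := by
  have hm : AEStronglyMeasurable (fun x => u (x + z) - u x) :=
    (hu.comp_measurePreserving (measurePreserving_add_right volume z)).sub hu
  rw [eLpNorm_one_eq_lintegral_enorm, modulus, ← integral_norm_eq_lintegral_enorm hm]
  rfl

/-- Fundamental theorem of calculus along the segment from x to x + z, then Tonelli and translation
invariance of the measure. -/
theorem eLpNorm_translate_sub_le {U : E d → ℝ} (hU : ContDiff ℝ 1 U) (z : E d) :
    eLpNorm (fun x => U (x + z) - U x) 1 volume ≤ eLpNorm (fun x => fderiv ℝ U x z) 1 volume := by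
  have hc : Continuous fun x => fderiv ℝ U x z := by
    have := hU.continuous_fderiv (by norm_num)
    fun_prop
  simp only [eLpNorm_one_eq_lintegral_enorm]
  calc ∫⁻ x, ‖U (x + z) - U x‖ₑ
      ≤ ∫⁻ x, ∫⁻ s in Set.Ioc (0 : ℝ) 1, ‖fderiv ℝ U (x + s • z) z‖ₑ := by
        refine lintegral_mono fun x => ?_
        have hd : ∀ s : ℝ, HasDerivAt (fun s : ℝ => U (x + s • z)) (fderiv ℝ U (x + s • z) z) s := by
          intro s
          have h1 := ((hU.differentiable (by norm_num)) (x + s • z)).hasFDerivAt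
          have h2 : HasDerivAt (fun s : ℝ => x + s • z) z s := by
            simpa using ((hasDerivAt_id s).smul_const z).const_add x
          exact h1.comp_hasDerivAt s h2
        have hcs : Continuous fun s : ℝ => fderiv ℝ U (x + s • z) z := by fun_prop
        have := intervalIntegral.integral_eq_sub_of_hasDerivAt (a := 0) (b := 1)
          (fun s _ => hd s) (hcs.intervalIntegrable _ _)
        simp only [one_smul, zero_smul, add_zero] at this
        rw [← this, intervalIntegral.integral_of_le zero_le_one]
        exact enorm_integral_le_lintegral_enorm _
    _ = ∫⁻ s in Set.Ioc (0 : ℝ) 1, ∫⁻ x, ‖fderiv ℝ U (x + s • z) z‖ₑ := by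
        refine lintegral_lintegral_swap ?_
        refine Continuous.aemeasurable ?_
        simp only [Function.uncurry_def]
        fun_prop
    _ = ∫⁻ s in Set.Ioc (0 : ℝ) 1, ∫⁻ x, ‖fderiv ℝ U x z‖ₑ := by
        refine lintegral_congr fun s => ?_
        exact lintegral_add_right_eq_self (fun x => ‖fderiv ℝ U x z‖ₑ) _
    _ = ∫⁻ x, ‖fderiv ℝ U x z‖ₑ := by simp

theorem eLpNorm_fderiv_le {U : E d → ℝ} (hU : ContDiff ℝ 1 U) (hUc : HasCompactSupport U)
    {V : ℝ} {e : E d} (h : ∫ x, |fderiv ℝ U x e| ≤ V) :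
    eLpNorm (fun x => fderiv ℝ U x e) 1 volume ≤ ENNReal.ofReal V := by
  have hc : Continuous fun x => fderiv ℝ U x e := by
    have := hU.continuous_fderiv (by norm_num)
    fun_prop
  have hs : HasCompactSupport fun x => fderiv ℝ U x e := by
    refine (hUc.fderiv (𝕜 := ℝ)).mono fun x hx => ?_
    contrapose! hx
    simp only [Function.mem_support, not_not] at hx ⊢
    simp [hx]
  have hi := hc.integrable_of_hasCompactSupport (μ := volume) hs
  rw [eLpNorm_one_eq_lintegral_enorm, ← ofReal_integral_norm_eq_lintegral_enorm hi]
  exact ENNReal.ofReal_le_ofReal h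

/-- The bound holds for the smooth approximations with the same constant, and Fatou's lemma carries
it to the a.e. limit. -/
theorem modulus_smul_unitVec_le {u : E d → ℝ} (hu : Integrable u)
    (huc : HasCompactSupport u) (hv : variation u < ∞) (i : Fin d) (t : ℝ) :
    modulus u (t • unitVec i) ≤ |t| * (variation u).toReal := by
  obtain ⟨U, hU, hlim⟩ := exists_smooth_approx hu huc hv
  rw [modulus_eq_toReal_eLpNorm hu.aestronglyMeasurable]
  refine ENNReal.toReal_le_of_le_ofReal (by positivity) ?_
  refine (Lp.eLpNorm_lim_le_liminf_eLpNorm (f := fun n x => U n (x + t • unitVec i) - U n x)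
    (fun n => ?_) _ ?_).trans ?_
  · have := (hU n).1.continuous
    exact Continuous.aestronglyMeasurable (by fun_prop)
  · filter_upwards [hlim, (measurePreserving_add_right volume
      (t • unitVec i : E d)).quasiMeasurePreserving.ae hlim] with x h1 h2
    exact h2.sub h1
  · refine liminf_le_of_frequently_le' (Eventually.of_forall fun n => ?_).frequently
    refine (eLpNorm_translate_sub_le (hU n).1 _).trans
      (eLpNorm_fderiv_le (hU n).1 (hU n).2.1 ?_)
    simp only [map_smul, smul_eq_mul, abs_mul]
    rw [integral_const_mul]
    exact mul_le_mul_of_nonneg_left ((hU n).2.2 i) (abs_nonneg _)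

/-! ### The Sobolev inequality. -/

theorem norm_fderiv_le_sum (U : E d → ℝ) (x : E d) :
    ‖fderiv ℝ U x‖ ≤ ∑ i, ‖fderiv ℝ U x (unitVec i)‖ := by
  refine ContinuousLinearMap.opNorm_le_bound _ (by positivity) fun v => ?_
  have hv : v = ∑ i, v i • unitVec i := by
    ext j
    simp [Finset.sum_apply, Pi.single_apply]
  conv_lhs => rw [hv, map_sum]
  refine (norm_sum_le _ _).trans ?_
  rw [Finset.sum_mul]
  refine Finset.sum_le_sum fun i _ => ?_
  rw [map_smul, norm_smul, mul_comm]
  exact mul_le_mul_of_nonneg_left (abs_coord_le_norm v i) (norm_nonneg _)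

theorem measurePreserving_line (x : E 1) :
    MeasurePreserving (fun s : ℝ => x + s • unitVec 0) volume volume := by
  have h1 := (volume_preserving_funUnique (Fin 1) ℝ).symm
  have h2 := EuclideanSpace.volume_preserving_symm_measurableEquiv_toLp (Fin 1)
  have h3 := ((measurePreserving_add_left volume x).comp (h2.symm.comp h1))
  convert h3 using 1
  funext s
  ext j
  fin_cases j
  simp [MeasurableEquiv.funUnique]

/-- The value at x is the integral of the derivative over a half-line, and in dimension one the line
through x is the whole space. -/
theorem eLpNorm_top_le_of_dim_one {U : E 1 → ℝ} (hU : ContDiff ℝ 1 U) (hUc : HasCompactSupport U) :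
    eLpNorm U ∞ volume ≤ eLpNorm (fderiv ℝ U) 1 volume := by
  rw [eLpNorm_exponent_top]
  refine eLpNormEssSup_le_of_ae_enorm_bound (Eventually.of_forall fun x => ?_)
  have hcont : Continuous (fderiv ℝ U) := hU.continuous_fderiv (by norm_num)
  let f : ℝ → ℝ := fun s => U (x + s • unitVec 0)
  have hl : ContDiff ℝ 1 fun s : ℝ => x + s • (unitVec 0 : E 1) := by fun_prop
  have hf : ContDiff ℝ 1 f := hU.comp hl
  have hfc : HasCompactSupport f := by
    refine hUc.comp_isClosedEmbedding ?_
    have hi : Isometry fun s : ℝ => x + s • (unitVec 0 : E 1) := by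
      refine Isometry.of_dist_eq fun s t => ?_
      rw [dist_add_left, dist_eq_norm, ← sub_smul, norm_smul]
      simp [dist_eq_norm]
    exact hi.isClosedEmbedding
  have h0 : ∀ s, ‖deriv f s‖ₑ ≤ ‖fderiv ℝ U (x + s • unitVec 0)‖ₑ := fun s => by
    have h1 := ((hU.differentiable (by norm_num)) (x + s • unitVec 0)).hasFDerivAt
    have h2 : HasDerivAt (fun s : ℝ => x + s • (unitVec 0 : E 1)) (unitVec 0) s := by
      simpa using ((hasDerivAt_id s).smul_const (unitVec 0 : E 1)).const_add x
    have h3 : HasDerivAt f (fderiv ℝ U (x + s • unitVec 0) (unitVec 0)) s :=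
      h1.comp_hasDerivAt s h2
    rw [h3.deriv, enorm_le_iff_norm_le]
    refine (ContinuousLinearMap.le_opNorm _ _).trans ?_
    simp
  calc ‖U x‖ₑ = ‖f 0‖ₑ := by simp [f]
    _ ≤ ∫⁻ y in Set.Iic 0, ‖deriv f y‖ₑ := hfc.enorm_le_lintegral_Ici_deriv hf 0
    _ ≤ ∫⁻ y, ‖fderiv ℝ U (x + y • unitVec 0)‖ₑ :=
        (setLIntegral_le_lintegral _ _).trans (lintegral_mono h0)
    _ = eLpNorm (fderiv ℝ U) 1 volume := by
        rw [eLpNorm_one_eq_lintegral_enorm]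
        exact (measurePreserving_line x).lintegral_comp (f := fun y => ‖fderiv ℝ U y‖ₑ)
          (by fun_prop)

/-- The exponent p is the conjugate of d. The Gagliardo–Nirenberg–Sobolev inequality needs d > 1;
for d = 1 the exponent is ∞ and the preceding bound takes its place. -/
theorem exists_eLpNorm_le_fderiv (hd : 1 ≤ d) :
    ∃ (p : ℝ≥0∞) (C : NNReal), ENNReal.HolderTriple d p 1 ∧ ∀ U : E d → ℝ, ContDiff ℝ 1 U →
      HasCompactSupport U → eLpNorm U p volume ≤ C * eLpNorm (fderiv ℝ U) 1 volume := by
  rcases hd.eq_or_lt with rfl | hd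
  · refine ⟨∞, 1, ?_, fun U hU hUc => by simpa using eLpNorm_top_le_of_dim_one hU hUc⟩
    rw [Nat.cast_one]
    infer_instance
  · have h1 : (1 : NNReal) < d := by exact_mod_cast hd
    have hp := NNReal.HolderConjugate.conjExponent h1
    refine ⟨(NNReal.conjExponent d : NNReal), _, ?_, fun U hU hUc =>
      eLpNorm_le_eLpNorm_fderiv_one volume hU hUc (by simpa using hp)⟩
    have := hp.coe_ennreal
    simpa using this

/-- The Sobolev inequality in `BV`. -/
theorem exists_eLpNorm_le_variation (hd : 1 ≤ d) :
    ∃ (p : ℝ≥0∞) (C : NNReal), ENNReal.HolderTriple d p 1 ∧ ∀ u : E d → ℝ, Integrable u →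
      HasCompactSupport u → variation u < ∞ → eLpNorm u p volume ≤ C * variation u := by
  obtain ⟨p, C, hp, h⟩ := exists_eLpNorm_le_fderiv hd
  -- The factor d comes from bounding the norm of the derivative by the sum of the d partial
  -- derivatives.
  refine ⟨p, C * d, hp, fun u hu huc hv => ?_⟩
  obtain ⟨U, hU, hlim⟩ := exists_smooth_approx hu huc hv
  refine (Lp.eLpNorm_lim_le_liminf_eLpNorm (f := U)
    (fun n => (hU n).1.continuous.aestronglyMeasurable) _ hlim).trans ?_
  refine liminf_le_of_frequently_le' (Eventually.of_forall fun n => ?_).frequently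
  refine (h _ (hU n).1 (hU n).2.1).trans ?_
  rw [ENNReal.coe_mul, mul_assoc]
  gcongr
  have hc := (hU n).1.continuous_fderiv (by norm_num)
  calc eLpNorm (fderiv ℝ (U n)) 1 volume
      ≤ eLpNorm (fun x => ∑ i, ‖fderiv ℝ (U n) x (unitVec i)‖) 1 volume :=
        eLpNorm_mono_real fun x => norm_fderiv_le_sum _ _
    _ = eLpNorm (∑ i, fun x => ‖fderiv ℝ (U n) x (unitVec i)‖) 1 volume := by
        congr 1 with x
        simp
    _ ≤ ∑ i, eLpNorm (fun x => ‖fderiv ℝ (U n) x (unitVec i)‖) 1 volume :=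
        eLpNorm_sum_le (fun i _ => Continuous.aestronglyMeasurable (by fun_prop)) le_rfl
    _ ≤ ∑ i : Fin d, variation u := by
        refine Finset.sum_le_sum fun i _ => ?_
        rw [eLpNorm_norm]
        refine (eLpNorm_fderiv_le (hU n).1 (hU n).2.1 ((hU n).2.2 i)).trans ?_
        exact ENNReal.ofReal_toReal_le
    _ = (d : NNReal) * variation u := by simp

/-! ### The Hadamard matrices -/

theorem sum_range_two_pow_succ {M : Type*} [AddCommMonoid M] (d : ℕ) (F : ℕ → M) :
    ∑ l ∈ Finset.range (2 ^ (d + 1)), F l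
      = ∑ l ∈ Finset.range (2 ^ d), F l + ∑ l ∈ Finset.range (2 ^ d), F (2 ^ d + l) := by
  rw [pow_succ, mul_two, Finset.sum_range_add]

theorem hadamard_succ_lo {d r : ℕ} (hr : r < 2 ^ d) (l : ℕ) :
    hadamard (d + 1) r l = hadamard d r (l % 2 ^ d) := by
  rw [hadamard, if_neg (by omega), Nat.mod_eq_of_lt hr, one_mul]

theorem hadamard_succ_hi {d r : ℕ} (hr : r < 2 ^ d) (l : ℕ) :
    hadamard (d + 1) (2 ^ d + r) l
      = (if 2 ^ d ≤ l then -1 else 1) * hadamard d r (l % 2 ^ d) := by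
  rw [hadamard, Nat.add_mod_left, Nat.mod_eq_of_lt hr]
  simp

theorem hadamard_comm (d r l : ℕ) : hadamard d r l = hadamard d l r := by
  induction d generalizing r l with
  | zero => rfl
  | succ d ih =>
    rw [hadamard, hadamard, ih]
    congr 1
    simp only [and_comm]

theorem hadamard_zero_left (d l : ℕ) : hadamard d 0 l = 1 := by
  induction d generalizing l with
  | zero => rfl
  | succ d ih => rw [hadamard_succ_lo (by positivity), ih]

theorem abs_hadamard (d r l : ℕ) : |hadamard d r l| = 1 := by
  induction d generalizing r l with
  | zero => simp [hadamard]
  | succ d ih =>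
    rw [hadamard, abs_mul, ih, mul_one]
    split_ifs <;> simp

/-- Orthogonality of the columns, by induction on the block form: the two halves of the sum
contribute the same inner product of reduced columns, with a sign that cancels them when the columns
lie in different blocks. -/
theorem sum_hadamard_mul (d : ℕ) {l l' : ℕ} (hl : l < 2 ^ d) (hl' : l' < 2 ^ d) :
    ∑ r ∈ Finset.range (2 ^ d), hadamard d r l * hadamard d r l'
      = if l = l' then (2 : ℝ) ^ d else 0 := by
  induction d generalizing l l' with
  | zero =>
    have h1 : l = 0 := by simpa using hl
    have h2 : l' = 0 := by simpa using hl'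
    simp [h1, h2, hadamard]
  | succ d ih =>
    have hpos : 0 < 2 ^ d := by positivity
    rw [pow_succ] at hl hl'
    have h1 := ih (Nat.mod_lt l hpos) (Nat.mod_lt l' hpos)
    rw [sum_range_two_pow_succ,
      Finset.sum_congr rfl (g := fun r => hadamard d r (l % 2 ^ d) * hadamard d r (l' % 2 ^ d))
        fun r hr => by
          rw [hadamard_succ_lo (Finset.mem_range.1 hr), hadamard_succ_lo (Finset.mem_range.1 hr)],
      Finset.sum_congr rfl (s₁ := Finset.range (2 ^ d))
        (f := fun r => hadamard (d + 1) (2 ^ d + r) l * hadamard (d + 1) (2 ^ d + r) l')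
        (g := fun r => ((if 2 ^ d ≤ l then -1 else 1) * (if 2 ^ d ≤ l' then -1 else 1)) *
          (hadamard d r (l % 2 ^ d) * hadamard d r (l' % 2 ^ d)))
        fun r hr => by
          rw [hadamard_succ_hi (Finset.mem_range.1 hr), hadamard_succ_hi (Finset.mem_range.1 hr)]
          ring,
      ← Finset.mul_sum, h1]
    have hm : ∀ m, m < 2 ^ d * 2 → m % 2 ^ d = if 2 ^ d ≤ m then m - 2 ^ d else m := fun m hm => by
      split_ifs with h
      · rw [Nat.mod_eq_sub_mod h, Nat.mod_eq_of_lt (by omega)]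
      · exact Nat.mod_eq_of_lt (by omega)
    rw [hm l hl, hm l' hl']
    by_cases a1 : 2 ^ d ≤ l <;> by_cases a2 : 2 ^ d ≤ l' <;> by_cases a3 : l = l' <;>
      simp only [a1, a2, a3, if_true, if_false]
    all_goals first
      | (subst a3; exact absurd ‹2 ^ d ≤ l› ‹¬ 2 ^ d ≤ l›)
      | (rw [if_neg (by omega)]; ring)
      | skip
    all_goals ring

/-- This is orthogonality to row 0, which is constant, after using the symmetry of the matrix. It
gives the Haar functions mean zero. -/
theorem sum_hadamard_row (d : ℕ) {r : ℕ} (hr : r < 2 ^ d) (hr0 : r ≠ 0) :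
    ∑ l ∈ Finset.range (2 ^ d), hadamard d r l = 0 := by
  have := sum_hadamard_mul d hr (l' := 0) (by positivity)
  rw [if_neg hr0] at this
  rw [← this]
  refine Finset.sum_congr rfl fun l _ => ?_
  rw [hadamard_comm d r l, hadamard_comm d l 0, hadamard_zero_left, mul_one]

/-! ### Haar coefficients of functions of dyadic cubes -/

section HaarCoef

variable {M M' : Type*} [AddCommGroup M] [Module ℝ M] [AddCommGroup M'] [Module ℝ M']

/-- The Haar coefficients of a function `a` of dyadic cubes. -/
noncomputable def haarCoef (d : ℕ) (a : ℕ → ℕ → M) (n k r : ℕ) : M :=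
  (2 : ℝ) ^ ((n * d : ℝ) / 2) • ∑ l ∈ Finset.range (2 ^ d),
    hadamard d r l • a (n + 1) (2 ^ d * k + l)

/-- The Haar coefficients of a function of dyadic cubes, in the lexicographic order. -/
noncomputable def haarCoefSeq (d : ℕ) (a : ℕ → ℕ → M) : ℕ → M
  | 0 => a 0 0
  | j + 1 => haarCoef d a (genNo d (j + 1)) (cubeNo d (j + 1)) (typeNo d (j + 1))

/-- Additivity of a function of dyadic cubes. -/
def DyadicAdditive (d : ℕ) (a : ℕ → ℕ → M) : Prop :=
  ∀ n k, k < 2 ^ (n * d) → ∑ l ∈ Finset.range (2 ^ d), a (n + 1) (2 ^ d * k + l) = a n k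

theorem map_haarCoefSeq (φ : M →ₗ[ℝ] M') (a : ℕ → ℕ → M) (j : ℕ) :
    φ (haarCoefSeq d a j) = haarCoefSeq d (fun n k => φ (a n k)) j := by
  cases j with
  | zero => rfl
  | succ j => simp [haarCoefSeq, haarCoef, map_sum]

/-- Here r starts at 0, while the type numbers start at 1: hence the shift to r + 1. The term that
would have type 0 is the one belonging to the cube itself. -/
theorem haarCoefSeq_eq (hd : 1 ≤ d) (a : ℕ → ℕ → M) {n k r : ℕ} (hk : k < 2 ^ (n * d))
    (hr : r < 2 ^ d - 1) :
    haarCoefSeq d a (2 ^ (n * d) + (2 ^ d - 1) * k + r) = haarCoef d a n k (r + 1) := by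
  obtain ⟨h1, h2, h3⟩ := index_of_rank d n k (r + 1) hd hk (by omega) (by omega)
  simp only [Nat.add_sub_cancel] at h1 h2 h3
  have hp : 0 < 2 ^ (n * d) := by positivity
  obtain ⟨j, hj⟩ : ∃ j, 2 ^ (n * d) + (2 ^ d - 1) * k + r = j + 1 :=
    ⟨2 ^ (n * d) + (2 ^ d - 1) * k + r - 1, by omega⟩
  rw [hj] at h1 h2 h3 ⊢
  rw [haarCoefSeq, h1, h2, h3]

theorem sum_range_add_mul {M : Type*} [AddCommMonoid M] (F : ℕ → M) (p m q : ℕ) :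
    ∑ j ∈ Finset.range (p + m * q), F j = ∑ j ∈ Finset.range p, F j
      + ∑ k ∈ Finset.range q, ∑ r ∈ Finset.range m, F (p + m * k + r) := by
  induction q with
  | zero => simp
  | succ q ih => rw [mul_add, mul_one, ← add_assoc, Finset.sum_range_add, ih,
      Finset.sum_range_succ, add_assoc]

theorem two_pow_generation (d n : ℕ) :
    2 ^ ((n + 1) * d) = 2 ^ (n * d) + (2 ^ d - 1) * 2 ^ (n * d) := by
  have h : 1 ≤ 2 ^ d := Nat.one_le_two_pow
  rw [Nat.sub_mul, one_mul, ← Nat.add_sub_assoc (Nat.le_mul_of_pos_left _ h), Nat.add_sub_cancel_left]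
  ring

/-- The sum over the indices of generation `n`. -/
theorem sum_generation {M : Type*} [AddCommMonoid M] (F : ℕ → M) (d n : ℕ) :
    ∑ j ∈ Finset.range (2 ^ ((n + 1) * d)), F j = ∑ j ∈ Finset.range (2 ^ (n * d)), F j
      + ∑ k ∈ Finset.range (2 ^ (n * d)), ∑ r ∈ Finset.range (2 ^ d - 1),
        F (2 ^ (n * d) + (2 ^ d - 1) * k + r) := by
  rw [two_pow_generation, sum_range_add_mul]

theorem two_rpow_half_mul_self (n d : ℕ) :
    (2 : ℝ) ^ ((n * d : ℝ) / 2) * (2 : ℝ) ^ ((n * d : ℝ) / 2) = 2 ^ (n * d) := by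
  rw [← Real.rpow_add (by norm_num), add_halves, ← Nat.cast_mul, Real.rpow_natCast]

/-- Parseval's identity on one cube. By additivity, the second term on the left is the missing term
r = 0; with it, the sum over all rows collapses to the diagonal by column orthogonality. -/
theorem sum_haarCoef_smul {a : ℕ → ℕ → ℝ} {b : ℕ → ℕ → M} (ha : DyadicAdditive d a)
    (hb : DyadicAdditive d b) {n k : ℕ} (hk : k < 2 ^ (n * d)) :
    ∑ r ∈ Finset.range (2 ^ d - 1), haarCoef d a n k (r + 1) • haarCoef d b n k (r + 1)
        + (2 ^ (n * d) * a n k) • b n k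
      = ∑ l ∈ Finset.range (2 ^ d),
        (2 ^ ((n + 1) * d) * a (n + 1) (2 ^ d * k + l)) • b (n + 1) (2 ^ d * k + l) := by
  let R : ℕ → M := fun r => haarCoef d a n k r • haarCoef d b n k r
  have h0 : R 0 = (2 ^ (n * d) * a n k) • b n k := by
    simp only [R, haarCoef, hadamard_zero_left, one_smul, one_mul, ha n k hk, hb n k hk, smul_smul,
      smul_eq_mul]
    rw [mul_assoc, mul_comm (a n k), ← mul_assoc, two_rpow_half_mul_self]
  have hpos : 1 ≤ 2 ^ d := Nat.one_le_two_pow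
  rw [← h0, ← Finset.sum_range_succ' R, Nat.sub_add_cancel hpos]
  have hR : ∀ r, R r = ∑ l ∈ Finset.range (2 ^ d), ∑ l' ∈ Finset.range (2 ^ d),
      (2 ^ (n * d) * a (n + 1) (2 ^ d * k + l) * (hadamard d r l * hadamard d r l')) •
        b (n + 1) (2 ^ d * k + l') := fun r => by
    simp only [R, haarCoef, smul_smul, smul_eq_mul]
    rw [mul_right_comm, two_rpow_half_mul_self, Finset.mul_sum, Finset.sum_smul]
    refine Finset.sum_congr rfl fun l _ => ?_
    rw [Finset.smul_sum]
    refine Finset.sum_congr rfl fun l' _ => ?_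
    rw [smul_smul]
    congr 1
    ring
  simp only [hR]
  rw [Finset.sum_comm]
  refine Finset.sum_congr rfl fun l hl => ?_
  rw [Finset.sum_comm]
  have : ∀ l' ∈ Finset.range (2 ^ d), ∑ r ∈ Finset.range (2 ^ d),
      (2 ^ (n * d) * a (n + 1) (2 ^ d * k + l) * (hadamard d r l * hadamard d r l')) •
        b (n + 1) (2 ^ d * k + l')
      = if l = l' then
        (2 ^ ((n + 1) * d) * a (n + 1) (2 ^ d * k + l)) • b (n + 1) (2 ^ d * k + l) else 0 := by
    intro l' hl'
    rw [← Finset.sum_smul, ← Finset.mul_sum,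
      sum_hadamard_mul d (Finset.mem_range.1 hl) (Finset.mem_range.1 hl')]
    split_ifs with h
    · subst h
      congr 1
      ring
    · simp
  rw [Finset.sum_congr rfl this, Finset.sum_ite_eq, if_pos hl]

theorem sum_range_two_pow_mul {M : Type*} [AddCommMonoid M] (F : ℕ → M) (d n : ℕ) :
    ∑ k ∈ Finset.range (2 ^ ((n + 1) * d)), F k
      = ∑ k ∈ Finset.range (2 ^ (n * d)), ∑ l ∈ Finset.range (2 ^ d), F (2 ^ d * k + l) := by
  have := sum_range_add_mul F 0 (2 ^ d) (2 ^ (n * d))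
  simp only [zero_add, Finset.range_zero, Finset.sum_empty] at this
  rw [← this]
  congr 2
  ring

/-- Telescoping of the one-cube identity over generations. The values b lie in an arbitrary vector
space because the identity is used twice: for the Haar sums in `BV`, and for the partial sums of the
Faber–Schauder series in the dual. -/
theorem sum_haarCoefSeq_smul (hd : 1 ≤ d) {a : ℕ → ℕ → ℝ} {b : ℕ → ℕ → M}
    (ha : DyadicAdditive d a) (hb : DyadicAdditive d b) (n : ℕ) :
    ∑ j ∈ Finset.range (2 ^ (n * d)), haarCoefSeq d a j • haarCoefSeq d b j
      = ∑ k ∈ Finset.range (2 ^ (n * d)), (2 ^ (n * d) * a n k) • b n k := by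
  induction n with
  | zero => simp [haarCoefSeq]
  | succ n ih =>
    rw [sum_generation, ih, add_comm, ← Finset.sum_add_distrib, sum_range_two_pow_mul]
    refine Finset.sum_congr rfl fun k hk => ?_
    rw [← sum_haarCoef_smul ha hb (Finset.mem_range.1 hk)]
    congr 1
    refine Finset.sum_congr rfl fun r hr => ?_
    rw [haarCoefSeq_eq hd a (Finset.mem_range.1 hk) (Finset.mem_range.1 hr),
      haarCoefSeq_eq hd b (Finset.mem_range.1 hk) (Finset.mem_range.1 hr)]

theorem DyadicAdditive.sum_eq {N : Type*} [AddCommGroup N] {a : ℕ → ℕ → N} (ha : DyadicAdditive d a) (n : ℕ) :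
    ∑ k ∈ Finset.range (2 ^ (n * d)), a n k = a 0 0 := by
  induction n with
  | zero => simp
  | succ n ih =>
    rw [sum_range_two_pow_mul, ← ih]
    exact Finset.sum_congr rfl fun k hk => ha n k (Finset.mem_range.1 hk)

end HaarCoef

/-! ### Dyadic numberings -/

namespace DyadicNumbering

variable (K : DyadicNumbering d)

theorem corner_lt {n k : ℕ} (hk : k < 2 ^ (n * d)) (i : Fin d) : K.corner n k i < 2 ^ n :=
  (K.bijOn n).mapsTo hk i

theorem corner_zero : K.corner 0 0 = fun _ => 0 := by
  funext i
  have := K.corner_lt (n := 0) (k := 0) (by simp) i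
  simpa using this

theorem child_lt {n k l : ℕ} (hk : k < 2 ^ (n * d)) (hl : l < 2 ^ d) :
    2 ^ d * k + l < 2 ^ ((n + 1) * d) := by
  have h1 : 2 ^ d * (k + 1) ≤ 2 ^ d * 2 ^ (n * d) := Nat.mul_le_mul_left _ hk
  have h2 : 2 ^ ((n + 1) * d) = 2 ^ d * 2 ^ (n * d) := by ring
  rw [h2]
  rw [mul_add] at h1
  omega

theorem sum_corner {M : Type*} [AddCommMonoid M] (F : (Fin d → ℕ) → M) (n : ℕ) :
    ∑ k ∈ Finset.range (2 ^ (n * d)), F (K.corner n k)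
      = ∑ m ∈ Fintype.piFinset fun _ => Finset.range (2 ^ n), F m := by
  refine Finset.sum_bij (fun k _ => K.corner n k) (fun k hk => ?_) (fun k hk k' hk' h => ?_)
    (fun m hm => ?_) (fun _ _ => rfl)
  · simp only [Fintype.mem_piFinset, Finset.mem_range]
    exact K.corner_lt (Finset.mem_range.1 hk)
  · exact (K.bijOn n).injOn (by simpa using hk) (by simpa using hk') h
  · simp only [Fintype.mem_piFinset, Finset.mem_range] at hm
    obtain ⟨k, hk, h⟩ := (K.bijOn n).surjOn (a := m) hm
    exact ⟨k, Finset.mem_range.2 hk, h⟩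

/-- The 2^d children have distinct corners, and each halves to the corner of the parent. Counting
shows that they exhaust the corners with this property. -/
theorem sum_child {M : Type*} [AddCommMonoid M] (F : (Fin d → ℕ) → M) {n k : ℕ}
    (hk : k < 2 ^ (n * d)) :
    ∑ l ∈ Finset.range (2 ^ d), F (K.corner (n + 1) (2 ^ d * k + l))
      = ∑ m ∈ Fintype.piFinset fun i =>
        Finset.Ico (2 * K.corner n k i) (2 * K.corner n k i + 2), F m := by
  have hinj : Set.InjOn (fun l => K.corner (n + 1) (2 ^ d * k + l)) (Finset.range (2 ^ d)) := by
    intro l hl l' hl' h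
    have := (K.bijOn (n + 1)).injOn (child_lt hk (by simpa using hl))
      (child_lt hk (by simpa using hl')) h
    omega
  have himg : Finset.image (fun l => K.corner (n + 1) (2 ^ d * k + l)) (Finset.range (2 ^ d))
      = Fintype.piFinset fun i =>
        Finset.Ico (2 * K.corner n k i) (2 * K.corner n k i + 2) := by
    refine Finset.eq_of_subset_of_card_le (fun m hm => ?_) ?_
    · obtain ⟨l, hl, rfl⟩ := Finset.mem_image.1 hm
      simp only [Fintype.mem_piFinset, Finset.mem_Ico]
      intro i
      have := K.subcube n k l hk (Finset.mem_range.1 hl) i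
      omega
    · rw [Finset.card_image_of_injOn hinj, Fintype.card_piFinset]
      simp
  rw [← himg, Finset.sum_image hinj]

end DyadicNumbering

/-! ### Increments -/

/-- The increment of a function of integer points on the box with opposite vertices `p`, `q`. -/
def gridIncrement (φ : (Fin d → ℕ) → ℝ) (p q : Fin d → ℕ) : ℝ :=
  ∑ S : Finset (Fin d), (-1) ^ S.card * φ fun i => if i ∈ S then p i else q i

theorem gridIncrement_prod (ψ : Fin d → ℕ → ℝ) (p q : Fin d → ℕ) :
    gridIncrement (fun m => ∏ i, ψ i (m i)) p q = ∏ i, (ψ i (q i) - ψ i (p i)) := by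
  rw [Finset.prod_sub, Finset.powerset_univ, gridIncrement]
  refine Finset.sum_congr rfl fun S _ => ?_
  rw [mul_assoc]
  congr 1
  rw [mul_comm, ← Finset.prod_mul_prod_compl S, Finset.compl_eq_univ_sdiff]
  congr 1
  · exact Finset.prod_congr rfl fun i hi => by simp only [if_pos hi]
  · exact Finset.prod_congr rfl fun i hi => by simp only [if_neg (Finset.mem_sdiff.1 hi).2]

theorem sum_gridIncrement_prod (ψ : Fin d → ℕ → ℝ) {p q : Fin d → ℕ} (hpq : ∀ i, p i ≤ q i) :
    ∑ m ∈ Fintype.piFinset fun i => Finset.Ico (p i) (q i),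
      gridIncrement (fun m => ∏ i, ψ i (m i)) m (fun i => m i + 1)
      = gridIncrement (fun m => ∏ i, ψ i (m i)) p q := by
  simp only [gridIncrement_prod]
  refine (Finset.prod_univ_sum _ fun i k => ψ i (k + 1) - ψ i k).symm.trans ?_
  refine Finset.prod_congr rfl fun i _ => ?_
  rw [Finset.sum_Ico_eq_sub _ (hpq i), Finset.sum_range_sub, Finset.sum_range_sub]
  ring

/-- Both sides are linear in φ. On products of one-variable functions the increment factors, and the
sum telescopes in each coordinate; point masses are such products. -/
theorem sum_gridIncrement (φ : (Fin d → ℕ) → ℝ) {p q : Fin d → ℕ} (hpq : ∀ i, p i ≤ q i) :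
    ∑ m ∈ Fintype.piFinset fun i => Finset.Ico (p i) (q i),
      gridIncrement φ m (fun i => m i + 1) = gridIncrement φ p q := by
  -- This finite box contains every vertex that occurs, so on it φ is a finite combination of point
  -- masses.
  set Z := Fintype.piFinset fun i => Finset.range (q i + 1)
  let δ : (Fin d → ℕ) → (Fin d → ℕ) → ℝ := fun z m => ∏ i, if m i = z i then 1 else 0
  have hδ : ∀ m ∈ Z, φ m = ∑ z ∈ Z, φ z * δ z m := fun m hm => by
    rw [Finset.sum_eq_single m]
    · simp [δ]
    · intro z _ hz
      obtain ⟨i, hi⟩ := Function.ne_iff.1 hz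
      have : δ z m = 0 := Finset.prod_eq_zero (Finset.mem_univ i) (if_neg (Ne.symm hi))
      rw [this, mul_zero]
    · exact fun h => absurd hm h
  have hlin : ∀ p' q' : Fin d → ℕ, (∀ i, p' i ≤ q i) → (∀ i, q' i ≤ q i) →
      gridIncrement φ p' q' = ∑ z ∈ Z, φ z * gridIncrement (δ z) p' q' := fun p' q' h1 h2 => by
    simp only [gridIncrement, Finset.mul_sum]
    rw [Finset.sum_comm]
    refine Finset.sum_congr rfl fun S _ => ?_
    rw [hδ _, Finset.mul_sum]
    · exact Finset.sum_congr rfl fun z _ => by ring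
    · simp only [Z, Fintype.mem_piFinset, Finset.mem_range]
      intro i
      split_ifs
      · exact Nat.lt_succ_of_le (h1 i)
      · exact Nat.lt_succ_of_le (h2 i)
  rw [hlin p q hpq fun _ => le_rfl]
  rw [Finset.sum_congr rfl fun m hm => hlin m (fun i => m i + 1) ?_ ?_]
  · rw [Finset.sum_comm]
    refine Finset.sum_congr rfl fun z _ => ?_
    rw [← Finset.mul_sum, sum_gridIncrement_prod (fun i k => if k = z i then 1 else 0) hpq]
  · intro i
    have := Fintype.mem_piFinset.1 hm i
    exact (Finset.mem_Ico.1 this).2.le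
  · intro i
    have := Fintype.mem_piFinset.1 hm i
    exact (Finset.mem_Ico.1 this).2

theorem rectIncrement_grid (f : E d → ℝ) (n : ℕ) (p q : Fin d → ℕ) :
    rectIncrement f (dyadicLo n p) (dyadicLo n q)
      = gridIncrement (fun m => f (WithLp.toLp 2 (dyadicLo n m))) p q := by
  unfold rectIncrement gridIncrement
  refine Finset.sum_congr rfl fun S _ => ?_
  congr 3
  funext i
  simp only [dyadicLo]
  split_ifs <;> rfl

theorem dyadicHi_eq (n : ℕ) (m : Fin d → ℕ) : dyadicHi n m = dyadicLo n fun i => m i + 1 := by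
  funext i
  simp [dyadicHi, dyadicLo]

theorem sum_rectIncrement (f : E d → ℝ) (n : ℕ) {p q : Fin d → ℕ} (hpq : ∀ i, p i ≤ q i) :
    ∑ m ∈ Fintype.piFinset fun i => Finset.Ico (p i) (q i),
      rectIncrement f (dyadicLo n m) (dyadicHi n m)
      = rectIncrement f (dyadicLo n p) (dyadicLo n q) := by
  simp only [dyadicHi_eq, rectIncrement_grid]
  exact sum_gridIncrement _ hpq

theorem dyadicLo_succ_two_mul (n : ℕ) (m : Fin d → ℕ) :
    dyadicLo (n + 1) (fun i => 2 * m i) = dyadicLo n m := by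
  funext i
  simp only [dyadicLo, pow_succ]
  push_cast
  field_simp

theorem DyadicNumbering.dyadicAdditive_increment (K : DyadicNumbering d) (f : E d → ℝ) :
    DyadicAdditive d (K.increment f) := fun n k hk => by
  unfold DyadicNumbering.increment
  rw [K.sum_child (fun m => rectIncrement f (dyadicLo (n + 1) m) (dyadicHi (n + 1) m)) hk,
    sum_rectIncrement f (n + 1) (p := fun i => 2 * K.corner n k i)
      (q := fun i => 2 * K.corner n k i + 2) fun i => by omega, dyadicLo_succ_two_mul, dyadicHi_eq,
    ← dyadicLo_succ_two_mul n (fun i => K.corner n k i + 1)]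
  rfl

theorem lamSeq_eq (K : DyadicNumbering d) (f : E d → ℝ) (j : ℕ) :
    lamSeq K f j = haarCoefSeq d (K.increment f) j := by
  cases j with
  | zero =>
    show _ = rectIncrement f (dyadicLo 0 (K.corner 0 0)) (dyadicHi 0 (K.corner 0 0))
    rw [K.corner_zero, lamSeq]
    congr 1 <;> funext i <;> simp [dyadicLo, dyadicHi]
  | succ j => rfl

/-! ### Rectangles and half-open dyadic cells -/

theorem volume_rect (a b : Fin d → ℝ) : volume (rect a b) = ∏ i, ENNReal.ofReal (b i - a i) := by
  rw [← Real.volume_Icc_pi, ← (PiLp.volume_preserving_ofLp (Fin d)).measure_preimage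
    measurableSet_Icc.nullMeasurableSet]
  congr 1
  ext x
  simp [rect, Pi.le_def, forall_and]

theorem ae_coord_ne (i : Fin d) (c : ℝ) : ∀ᵐ x : E d, x i ≠ c := by
  have h : ∀ᵐ y : Fin d → ℝ, y i ≠ c := by
    rw [ae_iff]
    simpa [← volume_pi] using Measure.pi_hyperplane (fun _ : Fin d => (volume : Measure ℝ)) i c
  exact (PiLp.volume_preserving_ofLp (Fin d)).quasiMeasurePreserving.ae h

/-- The index of the half-open dyadic cell of generation `n` containing `x`. -/
noncomputable def cellIndex (n : ℕ) (x : E d) : Fin d → ℤ := fun i => ⌊2 ^ n * x i⌋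

/-- The half-open dyadic cell with index `m`. -/
def cell (n : ℕ) (m : Fin d → ℤ) : Set (E d) := {x | cellIndex n x = m}

theorem mem_cell {n : ℕ} {m : Fin d → ℤ} {x : E d} : x ∈ cell n m ↔ cellIndex n x = m := Iff.rfl

theorem measurable_cellIndex (n : ℕ) : Measurable (cellIndex n : E d → Fin d → ℤ) := by
  refine measurable_pi_lambda _ fun i => ?_
  exact Int.measurable_floor.comp (Measurable.const_mul (by fun_prop) _)

theorem measurableSet_cell (n : ℕ) (m : Fin d → ℤ) : MeasurableSet (cell n m) :=
  measurable_cellIndex n (measurableSet_singleton m)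

/-- Closed cubes share faces, whereas half-open cells partition the space and are permuted by
lattice translations. The two differ by null sets, so integrals may be computed on cells. -/
theorem rect_ae_eq_cell (n : ℕ) (m : Fin d → ℕ) :
    rect (dyadicLo n m) (dyadicHi n m) =ᵐ[volume] cell n fun i => (m i : ℤ) := by
  have h : ∀ᵐ x : E d, ∀ i, x i ≠ dyadicHi n m i := ae_all_iff.2 fun i => ae_coord_ne i _
  filter_upwards [h] with x hx
  refine propext ?_
  have hp : (0 : ℝ) < 2 ^ n := by positivity
  show (∀ i, dyadicLo n m i ≤ x i ∧ x i ≤ dyadicHi n m i) ↔ cellIndex n x = _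
  rw [funext_iff]
  refine forall_congr' fun i => ?_
  have hi := hx i
  simp only [cellIndex, dyadicLo, dyadicHi, Int.floor_eq_iff, Int.cast_natCast] at hi ⊢
  rw [div_le_iff₀ hp, mul_comm (x i)]
  refine and_congr_right fun _ => ⟨fun h1 => ?_, fun h1 => ?_⟩
  · rw [mul_comm, ← lt_div_iff₀ hp]
    exact lt_of_le_of_ne h1 hi
  · rw [le_div_iff₀ hp, mul_comm]
    exact h1.le

theorem volume_dyadic (n : ℕ) (m : Fin d → ℕ) :
    volume (rect (dyadicLo n m) (dyadicHi n m)) = ENNReal.ofReal (2 ^ (n * d))⁻¹ := by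
  have h : ∀ i, dyadicHi n m i - dyadicLo n m i = (2 ^ n)⁻¹ := fun i => by
    simp only [dyadicHi, dyadicLo]
    ring
  simp only [volume_rect, h, Finset.prod_const, Finset.card_univ, Fintype.card_fin]
  rw [← ENNReal.ofReal_pow (by positivity), inv_pow, pow_mul]

/-- The vector of the lattice `2^(-n) ℤ^d` with integer coordinates `v`. -/
noncomputable def latVec (n : ℕ) (v : Fin d → ℤ) : E d := WithLp.toLp 2 fun i => (v i : ℝ) / 2 ^ n

theorem latVec_single (n : ℕ) (i : Fin d) :
    latVec n (Pi.single i 1) = ((2 : ℝ) ^ n)⁻¹ • (unitVec i : E d) := by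
  ext j
  by_cases h : j = i
  · subst h; simp [latVec]
  · simp [latVec, h]

theorem cellIndex_add_latVec (n : ℕ) (x : E d) (v : Fin d → ℤ) :
    cellIndex n (x + latVec n v) = cellIndex n x + v := by
  funext i
  have hp : (2 : ℝ) ^ n ≠ 0 := by positivity
  simp only [cellIndex, latVec, PiLp.add_apply, Pi.add_apply, mul_add, mul_div_cancel₀ _ hp]
  rw [Int.floor_add_intCast]

theorem preimage_cell_add (n : ℕ) (m v : Fin d → ℤ) :
    (fun x : E d => x + latVec n v) ⁻¹' cell n (m + v) = cell n m := by
  ext x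
  rw [Set.mem_preimage, mem_cell, mem_cell, cellIndex_add_latVec]
  exact add_left_inj v

theorem setIntegral_cell_add (u : E d → ℝ) (n : ℕ) (m v : Fin d → ℤ) :
    ∫ x in cell n (m + v), u x = ∫ x in cell n m, u (x + latVec n v) := by
  rw [← (measurePreserving_add_right volume (latVec n v)).setIntegral_preimage_emb
    (measurableEmbedding_addRight _) u, preimage_cell_add]

theorem volume_cell (n : ℕ) (m : Fin d → ℤ) :
    volume (cell n m) = ENNReal.ofReal (2 ^ (n * d))⁻¹ := by
  have h : volume (cell n m) = volume (cell n (0 : Fin d → ℤ)) := by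
    rw [← preimage_cell_add n 0 m, zero_add, measure_preimage_add_right]
  rw [h, ← volume_dyadic n (0 : Fin d → ℕ), measure_congr (rect_ae_eq_cell n _)]
  rfl

theorem cellIndex_succ_div (n : ℕ) (x : E d) (i : Fin d) :
    cellIndex (n + 1) x i / 2 = cellIndex n x i := by
  simp only [cellIndex]
  rw [← Nat.cast_ofNat (R := ℤ), ← Int.floor_div_natCast]
  congr 1
  rw [pow_succ]
  push_cast
  ring

/-! ### Functions that are constant on the cells of a generation -/

/-- `w` is constant on the cells of generation `n`. -/
def IsGrid (n : ℕ) (w : E d → ℝ) : Prop := ∀ x y, cellIndex n x = cellIndex n y → w x = w y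

/-- The index is monotone and rises by at most 1, so s changes value at most once and its total
variation is its net change. -/
theorem sum_abs_sub_of_step {s : ℕ → ℝ} {g : ℕ → ℤ} (hg : Monotone g)
    (hs : ∀ i j, g i = g j → s i = s j) {N : ℕ} (hN : g N ≤ g 0 + 1) :
    ∑ j ∈ Finset.range N, |s (j + 1) - s j| = |s N - s 0| := by
  induction N with
  | zero => simp
  | succ N ih =>
    have h1 := hg (Nat.le_succ N)
    have h2 := hg (Nat.zero_le N)
    simp only [Nat.succ_eq_add_one] at h1
    rw [Finset.sum_range_succ, ih (by omega)]
    rcases eq_or_ne (g N) (g 0) with h | h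
    · rw [hs _ _ h]; simp
    · rw [hs (N + 1) N (by omega)]; simp

/-- A translation by the mesh size in direction i crosses a single wall orthogonal to it. Cut into m
+ 1 equal steps, only one of them can change w, so the absolute increments add up exactly;
translation invariance makes their integrals equal. -/
theorem IsGrid.modulus_div {n : ℕ} {w : E d → ℝ} (hg : IsGrid n w) (hw : Integrable w)
    (i : Fin d) (m : ℕ) :
    ((m : ℝ) + 1) * modulus w ((((2 : ℝ) ^ n)⁻¹ / ((m : ℝ) + 1)) • unitVec i)
      = modulus w (((2 : ℝ) ^ n)⁻¹ • unitVec i) := by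
  set t : ℝ := ((2 : ℝ) ^ n)⁻¹ / ((m : ℝ) + 1) with ht
  have hm : (0 : ℝ) < (m : ℝ) + 1 := by positivity
  have h2n : (0 : ℝ) < 2 ^ n := by positivity
  have hshift : ∀ j : ℕ, modulus w (t • unitVec i)
      = ∫ x, |w (x + ((j + 1 : ℕ) * t) • unitVec i) - w (x + ((j : ℕ) * t) • unitVec i)| := by
    intro j
    rw [modulus, ← integral_add_right_eq_self (fun x => |w (x + t • unitVec i) - w x|)
      ((j * t) • unitVec i)]
    congr 1 with x
    rw [add_assoc, ← add_smul]
    congr 5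
    push_cast
    ring
  have hint : ∀ j : ℕ, Integrable fun x =>
      |w (x + ((j + 1 : ℕ) * t) • unitVec i) - w (x + ((j : ℕ) * t) • unitVec i)| := fun j =>
    ((hw.comp_add_right _).sub (hw.comp_add_right _)).abs
  calc ((m : ℝ) + 1) * modulus w (t • unitVec i)
      = ∑ j ∈ Finset.range (m + 1), modulus w (t • unitVec i) := by simp
    _ = ∑ j ∈ Finset.range (m + 1), ∫ x,
        |w (x + ((j + 1 : ℕ) * t) • unitVec i) - w (x + ((j : ℕ) * t) • unitVec i)| :=
        Finset.sum_congr rfl fun j _ => hshift j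
    _ = ∫ x, ∑ j ∈ Finset.range (m + 1),
        |w (x + ((j + 1 : ℕ) * t) • unitVec i) - w (x + ((j : ℕ) * t) • unitVec i)| :=
        (integral_finsetSum _ fun j _ => hint j).symm
    _ = modulus w (((2 : ℝ) ^ n)⁻¹ • unitVec i) := by
        unfold modulus
        congr 1 with x
        have hidx : ∀ j : ℕ, ∀ l, cellIndex n (x + ((j : ℕ) * t) • unitVec i) l
            = if l = i then ⌊2 ^ n * x i + j / ((m : ℝ) + 1)⌋ else cellIndex n x l := fun j l => by
          split_ifs with h
          · subst h
            simp only [cellIndex, PiLp.add_apply, PiLp.smul_apply, smul_eq_mul, ht]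
            congr 1
            simp
            field_simp
          · simp [cellIndex, h]
        -- After all m + 1 steps the i-th index has risen by exactly 1, since ⌊y + 1⌋ = ⌊y⌋ + 1.
        have := sum_abs_sub_of_step (N := m + 1)
          (s := fun j : ℕ => w (x + ((j : ℕ) * t) • unitVec i))
          (g := fun j : ℕ => ⌊2 ^ n * x i + j / ((m : ℝ) + 1)⌋)
          (fun j j' h => Int.floor_mono (by gcongr))
          (fun j j' h => hg _ _ (funext fun l => by
            rw [hidx, hidx]
            split_ifs
            · exact h
            · rfl))
          (by
            rw [Nat.cast_zero, zero_div, add_zero, Nat.cast_add, Nat.cast_one, div_self hm.ne',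
              Int.floor_add_one])
        rw [this]
        simp only [Nat.cast_zero, zero_mul, zero_smul, add_zero]
        congr 5
        rw [ht]
        push_cast
        field_simp

/-- By the previous identity, the difference quotient at scale 2^(-n)/(m + 1) does not depend on m,
so its value at the mesh size bounds the variation. -/
theorem IsGrid.variation_le {n : ℕ} {w : E d → ℝ} (hg : IsGrid n w) (hw : Integrable w) :
    variation w ≤ ENNReal.ofReal
      (∑ i : Fin d, 2 ^ n * modulus w (((2 : ℝ) ^ n)⁻¹ • unitVec i)) := by
  refine variation_le_of_modulus_le hw (t := fun m => ((2 : ℝ) ^ n)⁻¹ / ((m : ℝ) + 1))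
    (fun m => by positivity) ?_ fun i m => ?_
  · have := (tendsto_one_div_add_atTop_nhds_zero_nat (𝕜 := ℝ)).const_mul ((2 : ℝ) ^ n)⁻¹
    simpa [div_eq_mul_inv] using this
  · rw [← hg.modulus_div hw i m]
    have : (0 : ℝ) < 2 ^ n := by positivity
    have : (0 : ℝ) < (m : ℝ) + 1 := by positivity
    apply le_of_eq
    field_simp

/-! ### Averaging over the cells of a generation -/

/-- The function equal on each cell of generation `n` to the mean value of `u` over that cell. -/
noncomputable def cellAverage (n : ℕ) (u : E d → ℝ) (x : E d) : ℝ :=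
  2 ^ (n * d) * ∫ y in cell n (cellIndex n x), u y

theorem isGrid_cellAverage (n : ℕ) (u : E d → ℝ) : IsGrid n (cellAverage n u) := fun x y h => by
  rw [cellAverage, h, cellAverage]

theorem measurable_cellAverage (n : ℕ) (u : E d → ℝ) : Measurable (cellAverage n u) := by
  have : cellAverage n u = (fun m => 2 ^ (n * d) * ∫ y in cell n m, u y) ∘ cellIndex n := rfl
  rw [this]
  exact Measurable.of_discrete.comp (measurable_cellIndex n)

theorem iUnion_cell (n : ℕ) : ⋃ m : Fin d → ℤ, cell n m = (Set.univ : Set (E d)) :=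
  Set.iUnion_eq_univ_iff.2 fun x => ⟨cellIndex n x, rfl⟩

theorem pairwise_disjoint_cell (n : ℕ) :
    Pairwise (Function.onFun Disjoint (cell n : (Fin d → ℤ) → Set (E d))) := fun m m' h =>
  Set.disjoint_left.2 fun x h1 h2 => h (by rw [← mem_cell.1 h1, ← mem_cell.1 h2])

/-- The triangle inequality for the integral on each cell, summed over the countable partition into
cells. -/
theorem lintegral_cellAverage_le (n : ℕ) (u : E d → ℝ) :
    ∫⁻ x, ‖cellAverage n u x‖ₑ ≤ ∫⁻ x, ‖u x‖ₑ := by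
  rw [← setLIntegral_univ, ← setLIntegral_univ (f := fun x => ‖u x‖ₑ), ← iUnion_cell n,
    lintegral_iUnion (measurableSet_cell n) (pairwise_disjoint_cell n),
    lintegral_iUnion (measurableSet_cell n) (pairwise_disjoint_cell n)]
  refine ENNReal.tsum_le_tsum fun m => ?_
  calc ∫⁻ x in cell n m, ‖cellAverage n u x‖ₑ
      = ∫⁻ x in cell n m, ‖2 ^ (n * d) * ∫ y in cell n m, u y‖ₑ :=
        setLIntegral_congr_fun (measurableSet_cell n m) fun x hx => by
          rw [cellAverage, mem_cell.1 hx]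
    _ = ‖∫ y in cell n m, u y‖ₑ := by
        rw [lintegral_const, Measure.restrict_apply_univ, volume_cell, enorm_mul, mul_right_comm]
        have : ‖(2 : ℝ) ^ (n * d)‖ₑ * ENNReal.ofReal (2 ^ (n * d))⁻¹ = 1 := by
          rw [Real.enorm_eq_ofReal (by positivity), ← ENNReal.ofReal_mul (by positivity),
            mul_inv_cancel₀ (by positivity), ENNReal.ofReal_one]
        rw [this, one_mul]
    _ ≤ ∫⁻ x in cell n m, ‖u x‖ₑ := enorm_integral_le_lintegral_enorm _

theorem integrable_cellAverage (n : ℕ) {u : E d → ℝ} (hu : Integrable u) :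
    Integrable (cellAverage n u) :=
  ⟨(measurable_cellAverage n u).aestronglyMeasurable,
    (lintegral_cellAverage_le n u).trans_lt hu.2⟩

theorem integral_abs_cellAverage_le (n : ℕ) {u : E d → ℝ} (hu : Integrable u) :
    ∫ x, |cellAverage n u x| ≤ ∫ x, |u x| := by
  have h1 := integral_norm_eq_lintegral_enorm (integrable_cellAverage n hu).aestronglyMeasurable
  have h2 := integral_norm_eq_lintegral_enorm hu.aestronglyMeasurable
  simp only [Real.norm_eq_abs] at h1 h2
  rw [h1, h2]
  exact ENNReal.toReal_mono hu.2.ne (lintegral_cellAverage_le n u)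

/-- Averaging commutes with translations by lattice vectors, because these permute the cells. -/
theorem cellAverage_translate_sub (n : ℕ) {u : E d → ℝ} (hu : Integrable u) (v : Fin d → ℤ)
    (x : E d) : cellAverage n u (x + latVec n v) - cellAverage n u x
      = cellAverage n (fun y => u (y + latVec n v) - u y) x := by
  simp only [cellAverage]
  rw [cellIndex_add_latVec, setIntegral_cell_add, ← mul_sub,
    integral_sub (hu.comp_add_right _).integrableOn hu.integrableOn]

theorem modulus_cellAverage_le (n : ℕ) {u : E d → ℝ} (hu : Integrable u) (v : Fin d → ℤ) :
    modulus (cellAverage n u) (latVec n v) ≤ modulus u (latVec n v) := by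
  unfold modulus
  simp only [cellAverage_translate_sub n hu]
  exact integral_abs_cellAverage_le n (integrable_translate_sub hu _)

/-! ### Translates of indicator functions -/

theorem integral_indicator_one {B : Set (E d)} (hB : MeasurableSet B) :
    ∫ x, B.indicator (fun _ => (1 : ℝ)) x = volume.real B := by
  rw [integral_indicator hB]
  simp

theorem volume_rect_update (i : Fin d) {c t : ℝ} (ht : 0 ≤ t) :
    volume.real (rect (Function.update (fun _ : Fin d => (0 : ℝ)) i (c - t))
      (Function.update (fun _ => 1) i c)) = t := by
  rw [Measure.real, volume_rect, Finset.prod_eq_single i]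
  · simp [ENNReal.toReal_ofReal ht]
  · intro j _ hj
    simp [hj]
  · simp

theorem mem_rect_update {i : Fin d} {c t : ℝ} {x : E d} (h : ∀ j ≠ i, 0 ≤ x j ∧ x j ≤ 1)
    (h1 : c - t ≤ x i) (h2 : x i ≤ c) :
    x ∈ rect (Function.update (fun _ : Fin d => (0 : ℝ)) i (c - t))
      (Function.update (fun _ => 1) i c) := fun j => by
  by_cases hj : j = i
  · subst hj; simpa using ⟨by linarith, h2⟩
  · simpa [hj] using h j hj

/-- The indicator changes under the translation only for points within t below one of the two faces
orthogonal to direction i. -/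
theorem modulus_rect_le {a b : Fin d → ℝ} (ha : ∀ i, 0 ≤ a i) (hb : ∀ i, b i ≤ 1) (i : Fin d)
    {t : ℝ} (ht : 0 ≤ t) :
    modulus ((rect a b).indicator fun _ => 1) (t • unitVec i) ≤ 2 * t := by
  -- The slab of thickness t below the hyperplane x_i = c, spanning [0,1] in the other coordinates:
  -- its volume is t.
  let R : ℝ → Set (E d) := fun c => rect (Function.update (fun _ : Fin d => (0 : ℝ)) i (c - t))
      (Function.update (fun _ => 1) i c)
  have hRm : ∀ c, MeasurableSet (R c) := fun c => measurableSet_rect _ _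
  have hRi : ∀ c, Integrable ((R c).indicator fun _ => (1 : ℝ)) := fun c =>
    (integrable_indicator_iff (hRm c)).2
      (integrableOn_const (isBounded_rect _ _).measure_lt_top.ne)
  have hpt : ∀ x : E d, |(rect a b).indicator (fun _ => (1 : ℝ)) (x + t • unitVec i)
      - (rect a b).indicator (fun _ => (1 : ℝ)) x|
      ≤ (R (a i)).indicator (fun _ => (1 : ℝ)) x + (R (b i)).indicator (fun _ => (1 : ℝ)) x := by
    intro x
    have hnn : ∀ c, 0 ≤ (R c).indicator (fun _ => (1 : ℝ)) x := fun c =>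
      Set.indicator_nonneg (fun _ _ => zero_le_one) x
    have hi : (x + t • unitVec i) i = x i + t := by simp
    have hj : ∀ j, j ≠ i → (x + t • unitVec i) j = x j := fun j hj => by simp [hj]
    by_cases h1 : x + t • unitVec i ∈ rect a b <;> by_cases h2 : x ∈ rect a b
    · simp only [Set.indicator_of_mem h1, Set.indicator_of_mem h2, sub_self, abs_zero]
      exact add_nonneg (hnn _) (hnn _)
    · have hxj : ∀ j, j ≠ i → a j ≤ x j ∧ x j ≤ b j := fun j h => by
        have := h1 j
        rwa [hj j h] at this
      have hxi := h1 i
      rw [hi] at hxi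
      have hlt : x i < a i := by
        by_contra hcon
        refine h2 fun j => ?_
        by_cases h : j = i
        · subst h; exact ⟨by linarith, by linarith⟩
        · exact hxj j h
      have hmem : x ∈ R (a i) := mem_rect_update
        (fun j h => ⟨(ha j).trans (hxj j h).1, (hxj j h).2.trans (hb j)⟩) (by linarith) hlt.le
      simp only [Set.indicator_of_mem h1, Set.indicator_of_notMem h2, Set.indicator_of_mem hmem]
      have := hnn (b i)
      simp only [sub_zero, abs_one]
      linarith
    · have hlt : b i < x i + t := by
        by_contra hcon
        refine h1 fun j => ?_
        have := h2 j
        by_cases h : j = i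
        · subst h; rw [hi]; exact ⟨by linarith, by linarith⟩
        · rwa [hj j h]
      have hmem : x ∈ R (b i) := mem_rect_update
        (fun j h => ⟨(ha j).trans (h2 j).1, (h2 j).2.trans (hb j)⟩) (by linarith) (h2 i).2
      simp only [Set.indicator_of_notMem h1, Set.indicator_of_mem h2, Set.indicator_of_mem hmem]
      have := hnn (a i)
      simp only [zero_sub, abs_neg, abs_one]
      linarith
    · simp only [Set.indicator_of_notMem h1, Set.indicator_of_notMem h2, sub_self, abs_zero]
      exact add_nonneg (hnn _) (hnn _)
  calc modulus ((rect a b).indicator fun _ => 1) (t • unitVec i)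
      ≤ ∫ x, ((R (a i)).indicator (fun _ => (1 : ℝ)) x
          + (R (b i)).indicator (fun _ => (1 : ℝ)) x) :=
        integral_mono_of_nonneg (Eventually.of_forall fun x => abs_nonneg _)
          ((hRi _).add (hRi _)) (Eventually.of_forall hpt)
    _ = 2 * t := by
        rw [integral_add (hRi _) (hRi _), integral_indicator_one (hRm _),
          integral_indicator_one (hRm _), volume_rect_update i ht, volume_rect_update i ht]
        ring

/-! ### Elements of `BV` -/

namespace BV

theorem ae_eq_zero (u : BV d) : ∀ᵐ x, x ∉ cube d → u x = 0 :=
  (show toL1 u ∈ bvSubmodule d from Subtype.property (p := (· ∈ bvSubmodule d)) u).1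

theorem norm_toL1 (u : BV d) : ‖toL1 u‖ = ∫ x, |u x| := L1.norm_eq_integral_norm _

theorem norm_toL1_le (u : BV d) : ‖toL1 u‖ ≤ ‖u‖ := by
  rw [norm_def]
  exact le_add_of_nonneg_right ENNReal.toReal_nonneg

theorem variation_le_norm (u : BV d) : (variation (u : E d → ℝ)).toReal ≤ ‖u‖ := by
  rw [norm_def]
  exact le_add_of_nonneg_left (norm_nonneg _)

theorem ext_ae {u w : BV d} (h : (u : E d → ℝ) =ᵐ[volume] w) : u = w :=
  Subtype.ext (Lp.ext h)

theorem coe_zero : ((0 : BV d) : E d → ℝ) =ᵐ[volume] fun _ => 0 := by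
  rw [map_zero]; exact Lp.coeFn_zero _ _ _

theorem coe_sum {ι : Type*} (s : Finset ι) (u : ι → BV d) :
    ((∑ i ∈ s, u i : BV d) : E d → ℝ) =ᵐ[volume] fun x => ∑ i ∈ s, u i x := by
  classical
  induction s using Finset.induction_on with
  | empty => simpa using coe_zero
  | insert i s hi ih =>
    rw [Finset.sum_insert hi]
    filter_upwards [coe_add (u i) (∑ i ∈ s, u i), ih] with x h1 h2
    rw [h1, h2, Finset.sum_insert hi]

/-- A representative that vanishes only a.e. off the cube need not have compact support. Cutting it
off gives one to which the smooth approximation applies. -/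
theorem indicator_cube_ae_eq (u : BV d) :
    (cube d).indicator (u : E d → ℝ) =ᵐ[volume] (u : E d → ℝ) := by
  filter_upwards [u.ae_eq_zero] with x hx
  by_cases h : x ∈ cube d
  · rw [Set.indicator_of_mem h]
  · rw [Set.indicator_of_notMem h, hx h]

theorem hasCompactSupport_indicator_cube (u : BV d) :
    HasCompactSupport ((cube d).indicator (u : E d → ℝ)) := by
  refine HasCompactSupport.intro' (K := closure (cube d)) ?_ isClosed_closure fun x hx => ?_
  · exact (isBounded_rect _ _).isCompact_closure
  · exact Set.indicator_of_notMem (fun h => hx (subset_closure h)) _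

theorem modulus_smul_unitVec_le (u : BV d) (i : Fin d) (t : ℝ) :
    modulus u (t • unitVec i) ≤ |t| * (variation (u : E d → ℝ)).toReal := by
  have h := u.indicator_cube_ae_eq
  rw [← modulus_congr h, ← variation_congr h]
  refine StrongCharge.modulus_smul_unitVec_le (u.integrable.congr h.symm)
    u.hasCompactSupport_indicator_cube ?_ i t
  rw [variation_congr h]
  exact u.variation_lt_top

end BV

theorem modulus_sum_le {u : E d → ℝ} (hu : Integrable u) {ι : Type*} (s : Finset ι)
    (z : ι → E d) : modulus u (∑ i ∈ s, z i) ≤ ∑ i ∈ s, modulus u (z i) := by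
  classical
  induction s using Finset.induction_on with
  | empty => simp [modulus_zero_right]
  | insert i s hi ih =>
    rw [Finset.sum_insert hi, Finset.sum_insert hi]
    exact (modulus_add_le hu _ _).trans (by gcongr)

theorem BV.modulus_latVec_le (u : BV d) (n : ℕ) {v : Fin d → ℤ} (hv : ∀ i, |v i| ≤ 1) :
    modulus u (latVec n v) ≤ d * ((2 ^ n)⁻¹ * (variation (u : E d → ℝ)).toReal) := by
  have h : latVec n v = ∑ i, ((v i : ℝ) / 2 ^ n) • unitVec i := by
    ext j
    simp [latVec, Finset.sum_apply, Pi.single_apply]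
  rw [h]
  refine (modulus_sum_le u.integrable _ _).trans ?_
  calc ∑ i, modulus u (((v i : ℝ) / 2 ^ n) • unitVec i)
      ≤ ∑ i : Fin d, (2 ^ n)⁻¹ * (variation (u : E d → ℝ)).toReal := by
        refine Finset.sum_le_sum fun i _ => (u.modulus_smul_unitVec_le i _).trans ?_
        refine mul_le_mul_of_nonneg_right ?_ ENNReal.toReal_nonneg
        have h1 : |(v i : ℝ)| ≤ 1 := by exact_mod_cast hv i
        have h2 : (0 : ℝ) < 2 ^ n := by positivity
        rw [abs_div, abs_of_pos h2, div_eq_mul_inv]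
        exact mul_le_of_le_one_left (by positivity) h1
    _ = d * ((2 ^ n)⁻¹ * (variation (u : E d → ℝ)).toReal) := by simp

theorem IsBVSet.coe_indicatorBV {B : Set (E d)} (hB : IsBVSet B) :
    (hB.indicatorBV : E d → ℝ) =ᵐ[volume] B.indicator fun _ => (1 : ℝ) :=
  hB.integrable_indicator.coeFn_toL1

open Classical in
/-- The indicator function of `B` as an element of `BV`, when `B` is a `BV`-set. -/
noncomputable def indBV (B : Set (E d)) : BV d := if h : IsBVSet B then h.indicatorBV else 0

theorem indBV_eq {B : Set (E d)} (hB : IsBVSet B) : indBV B = hB.indicatorBV := dif_pos hB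

theorem coe_indBV {B : Set (E d)} (hB : IsBVSet B) :
    (indBV B : E d → ℝ) =ᵐ[volume] B.indicator fun _ => (1 : ℝ) := by
  rw [indBV_eq hB]; exact hB.coe_indicatorBV

theorem perimeter_le_of_modulus_le {B : Set (E d)}
    (hB : Integrable (B.indicator fun _ => (1 : ℝ))) {C : ℝ}
    (h : ∀ i, ∀ t, 0 ≤ t → modulus (B.indicator fun _ => (1 : ℝ)) (t • unitVec i) ≤ C * t) :
    perimeter B ≤ ENNReal.ofReal (d * C) := by
  have := variation_le_of_modulus_le hB (t := fun m => 1 / ((m : ℝ) + 1)) (fun m => by positivity)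
    tendsto_one_div_add_atTop_nhds_zero_nat (C := fun _ => C) fun i m => h i _ (by positivity)
  simpa [perimeter] using this

theorem rect_subset_cube {a b : Fin d → ℝ} (ha : ∀ i, 0 ≤ a i) (hb : ∀ i, b i ≤ 1) :
    rect a b ⊆ cube d := fun _ hx i => ⟨(ha i).trans (hx i).1, (hx i).2.trans (hb i)⟩

theorem integrable_indicator_rect (a b : Fin d → ℝ) :
    Integrable ((rect a b).indicator fun _ => (1 : ℝ)) :=
  (integrable_indicator_iff (measurableSet_rect a b)).2
    (integrableOn_const (isBounded_rect _ _).measure_lt_top.ne)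

theorem perimeter_rect_le {a b : Fin d → ℝ} (ha : ∀ i, 0 ≤ a i) (hb : ∀ i, b i ≤ 1) :
    perimeter (rect a b) ≤ ENNReal.ofReal (d * 2) :=
  perimeter_le_of_modulus_le (integrable_indicator_rect a b)
    fun i _ ht => modulus_rect_le ha hb i ht

theorem isBVSet_rect {a b : Fin d → ℝ} (ha : ∀ i, 0 ≤ a i) (hb : ∀ i, b i ≤ 1) :
    IsBVSet (rect a b) :=
  ⟨rect_subset_cube ha hb, (measurableSet_rect a b).nullMeasurableSet,
    (perimeter_rect_le ha hb).trans_lt ENNReal.ofReal_lt_top⟩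

theorem norm_toL1_indBV {B : Set (E d)} (hB : IsBVSet B) :
    ‖BV.toL1 (indBV B)‖ = volume.real B := by
  rw [BV.norm_toL1, integral_congr_ae (g := B.indicator fun _ => (1 : ℝ))]
  · rw [integral_indicator₀ hB.2.1]
    simp
  · filter_upwards [coe_indBV hB] with x hx
    rw [hx]
    exact abs_of_nonneg (Set.indicator_nonneg (fun _ _ => zero_le_one) x)

/-! ### The functionals `T` -/

theorem T_apply (g : E d → ℝ) (hg : Measurable g) (hb : ∃ C, ∀ x, ‖g x‖ ≤ C) (u : BV d) :
    T g hg hb u = ∫ x, g x * u x := by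
  show ∫ x in cube d, g x * u x = _
  refine setIntegral_eq_integral_of_ae_compl_eq_zero ?_
  filter_upwards [u.ae_eq_zero] with x hx h
  rw [hx h, mul_zero]

theorem abs_T_le {g : E d → ℝ} (hg : Measurable g) {C : ℝ} (hC : ∀ x, ‖g x‖ ≤ C) (u : BV d) :
    |T g hg ⟨C, hC⟩ u| ≤ C * ‖BV.toL1 u‖ := by
  rw [T_apply, BV.norm_toL1, ← integral_const_mul, ← Real.norm_eq_abs]
  refine norm_integral_le_of_norm_le (u.integrable.abs.const_mul C)
    (Eventually.of_forall fun x => ?_)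
  rw [norm_mul]
  exact mul_le_mul_of_nonneg_right (hC x) (norm_nonneg _)

theorem norm_indicator_one_le (B : Set (E d)) (x : E d) :
    ‖B.indicator (fun _ => (1 : ℝ)) x‖ ≤ 1 :=
  (norm_indicator_le_norm_self _ _).trans (by simp)

/-! ### Dyadic cubes as functionals and as elements of `BV`. -/

namespace DyadicNumbering

variable (K : DyadicNumbering d)

theorem measurableSet_set (n k : ℕ) : MeasurableSet (K.set n k) := measurableSet_rect _ _

/-- The functional `T_g` for the indicator function `g` of the cube `K_{n,k}`. -/
noncomputable def cubeT (n k : ℕ) : BV d →L[ℝ] ℝ :=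
  T ((K.set n k).indicator fun _ => (1 : ℝ))
    (measurable_const.indicator (K.measurableSet_set n k)) ⟨1, norm_indicator_one_le _⟩

theorem cubeT_apply (n k : ℕ) (u : BV d) : K.cubeT n k u = ∫ x in K.set n k, u x := by
  rw [cubeT, T_apply, ← integral_indicator (K.measurableSet_set n k)]
  congr 1 with x
  by_cases h : x ∈ K.set n k <;> simp [h]

/-- The indicator function of the cube `K_{n,k}` as an element of `BV`. -/
noncomputable def cubeBV (n k : ℕ) : BV d := indBV (K.set n k)

theorem dyadicLo_nonneg (n : ℕ) (m : Fin d → ℕ) (i : Fin d) : 0 ≤ dyadicLo n m i := by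
  unfold dyadicLo; positivity

theorem dyadicHi_le_one {n : ℕ} {m : Fin d → ℕ} (hm : ∀ i, m i < 2 ^ n) (i : Fin d) :
    dyadicHi n m i ≤ 1 := by
  unfold dyadicHi
  rw [div_le_one (by positivity)]
  exact_mod_cast hm i

theorem isBVSet_set {n k : ℕ} (hk : k < 2 ^ (n * d)) : IsBVSet (K.set n k) :=
  isBVSet_rect (dyadicLo_nonneg n _) (dyadicHi_le_one (K.corner_lt hk))

theorem set_ae_eq_cell (n k : ℕ) :
    K.set n k =ᵐ[volume] cell n fun i => (K.corner n k i : ℤ) := rect_ae_eq_cell n _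

theorem volume_set (n k : ℕ) : volume (K.set n k) = ENNReal.ofReal (2 ^ (n * d))⁻¹ :=
  volume_dyadic n _

theorem set_zero : K.set 0 0 = cube d := by
  rw [DyadicNumbering.set, K.corner_zero, cube]
  congr 1 <;> funext i <;> simp [dyadicLo, dyadicHi]

/-- Up to null sets the cubes are half-open cells, and halving the index of the fine cell containing
x gives that of its coarse cell, so exactly one child contains a given point of the parent. -/
theorem sum_indicator_child {n k : ℕ} (hk : k < 2 ^ (n * d)) :
    (fun x => ∑ l ∈ Finset.range (2 ^ d),
      (K.set (n + 1) (2 ^ d * k + l)).indicator (fun _ => (1 : ℝ)) x)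
      =ᵐ[volume] (K.set n k).indicator fun _ => (1 : ℝ) := by
  have h : ∀ᵐ x, ∀ l, (K.set (n + 1) (2 ^ d * k + l)).indicator (fun _ => (1 : ℝ)) x
      = (cell (n + 1) fun i => (K.corner (n + 1) (2 ^ d * k + l) i : ℤ)).indicator
        (fun _ => (1 : ℝ)) x :=
    ae_all_iff.2 fun l => indicator_ae_eq_of_ae_eq_set (K.set_ae_eq_cell _ _)
  filter_upwards [h, indicator_ae_eq_of_ae_eq_set (f := fun _ => (1 : ℝ)) (K.set_ae_eq_cell n k)]
    with x h1 h2
  rw [h2, Finset.sum_congr rfl fun l _ => h1 l,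
    K.sum_child (fun m => (cell (n + 1) fun i => (m i : ℤ)).indicator (fun _ => (1 : ℝ)) x) hk]
  by_cases hx : x ∈ cell n fun i => (K.corner n k i : ℤ)
  · rw [Set.indicator_of_mem hx]
    have hdiv : ∀ i, cellIndex (n + 1) x i / 2 = K.corner n k i := fun i => by
      rw [cellIndex_succ_div, mem_cell.1 hx]
    rw [Finset.sum_eq_single fun i => (cellIndex (n + 1) x i).toNat]
    · refine Set.indicator_of_mem (mem_cell.2 (funext fun i => ?_)) _
      have := hdiv i
      show cellIndex (n + 1) x i = ((cellIndex (n + 1) x i).toNat : ℤ)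
      omega
    · intro m _ hm
      refine Set.indicator_of_notMem (fun hxm => hm (funext fun i => ?_)) _
      rw [mem_cell.1 hxm]
      simp
    · intro hm
      refine absurd ?_ hm
      simp only [Fintype.mem_piFinset, Finset.mem_Ico]
      intro i
      have := hdiv i
      omega
  · rw [Set.indicator_of_notMem hx]
    refine Finset.sum_eq_zero fun m hm => Set.indicator_of_notMem (fun hxm => hx ?_) _
    refine mem_cell.2 (funext fun i => ?_)
    rw [← cellIndex_succ_div, mem_cell.1 hxm]
    have := Finset.mem_Ico.1 (Fintype.mem_piFinset.1 hm i)
    show (m i : ℤ) / 2 = _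
    omega

theorem dyadicAdditive_setIntegral {φ : E d → ℝ} (hφ : Integrable φ) :
    DyadicAdditive d fun n k => ∫ x in K.set n k, φ x := fun n k hk => by
  simp only
  rw [← integral_indicator (K.measurableSet_set n k)]
  simp only [← integral_indicator (K.measurableSet_set _ _)]
  rw [← integral_finsetSum _ fun l _ => hφ.indicator (K.measurableSet_set _ _)]
  refine integral_congr_ae ?_
  filter_upwards [K.sum_indicator_child hk] with x hx
  have : ∀ B : Set (E d), B.indicator φ x = B.indicator (fun _ => (1 : ℝ)) x * φ x := fun B => by
    by_cases h : x ∈ B <;> simp [h]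
  simp only [this, ← hx, Finset.sum_mul]

theorem dyadicAdditive_cubeT : DyadicAdditive d K.cubeT := fun n k hk => by
  ext u
  rw [sum_apply]
  simp only [cubeT_apply]
  exact K.dyadicAdditive_setIntegral u.integrable n k hk

theorem dyadicAdditive_cubeBV : DyadicAdditive d K.cubeBV := fun n k hk => by
  refine BV.ext_ae ?_
  have h : ∀ᵐ x, ∀ l, l < 2 ^ d → K.cubeBV (n + 1) (2 ^ d * k + l) x
      = (K.set (n + 1) (2 ^ d * k + l)).indicator (fun _ => (1 : ℝ)) x :=
    ae_all_iff.2 fun l => by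
      by_cases hl : l < 2 ^ d
      · filter_upwards [coe_indBV (K.isBVSet_set (child_lt hk hl))] with x hx _
        exact hx
      · exact Eventually.of_forall fun x h => absurd h hl
  filter_upwards [BV.coe_sum (Finset.range (2 ^ d)) fun l => K.cubeBV (n + 1) (2 ^ d * k + l), h,
    K.sum_indicator_child hk, coe_indBV (K.isBVSet_set hk)] with x h1 h2 h3 h4
  rw [h1, cubeBV, h4, ← h3]
  exact Finset.sum_congr rfl fun l hl => h2 l (Finset.mem_range.1 hl)

/-- The Faber–Schauder functionals are the Haar coefficients of the additive family of cube
functionals; this is what brings the abstract Parseval identity to bear on the series. -/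
theorem faberSchauder_eq (j : ℕ) :
    (faberSchauder K j : BV d →L[ℝ] ℝ) = haarCoefSeq d K.cubeT j := by
  ext u
  show T (haarSeq K j) (measurable_haarSeq K j) (bounded_haarSeq K j) u = _
  rw [T_apply]
  cases j with
  | zero =>
    show _ = K.cubeT 0 0 u
    rw [cubeT, T_apply, K.set_zero]
    rfl
  | succ j =>
    simp only [haarCoefSeq, haarCoef, smul_apply,
      sum_apply, cubeT, T_apply, haarSeq, haar, smul_eq_mul]
    have hi : ∀ B : Set (E d), MeasurableSet B →
        Integrable fun x => B.indicator (fun _ => (1 : ℝ)) x * u x := fun B hB =>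
      u.integrable.bdd_mul (measurable_const.indicator hB).aestronglyMeasurable
        (Eventually.of_forall (norm_indicator_one_le B))
    simp only [mul_assoc, Finset.sum_mul, ← integral_const_mul]
    rw [← integral_finsetSum _ fun l _ =>
      (hi _ (K.measurableSet_set _ _)).const_mul _, ← integral_const_mul]

end DyadicNumbering

/-! ### Elements of `BV` that are constant on the cells of a generation -/

/-- The elements of `BV` that are a.e. constant on each cell of generation `n`. -/
def gridBV (d n : ℕ) : Submodule ℝ (BV d) where
  carrier := {u | ∃ w : E d → ℝ, IsGrid n w ∧ (u : E d → ℝ) =ᵐ[volume] w}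
  zero_mem' := ⟨fun _ => 0, fun _ _ _ => rfl, BV.coe_zero⟩
  add_mem' := by
    rintro u v ⟨w, hw, h⟩ ⟨w', hw', h'⟩
    refine ⟨fun x => w x + w' x, fun x y hxy => by simp only [hw x y hxy, hw' x y hxy], ?_⟩
    filter_upwards [BV.coe_add u v, h, h'] with x h1 h2 h3
    rw [h1, h2, h3]
  smul_mem' := by
    rintro c u ⟨w, hw, h⟩
    refine ⟨fun x => c * w x, fun x y hxy => by simp only [hw x y hxy], ?_⟩
    filter_upwards [BV.coe_smul c u, h] with x h1 h2
    rw [h1, h2]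

theorem variation_le_of_mem_gridBV {n : ℕ} {u : BV d} (hu : u ∈ gridBV d n) :
    (variation (u : E d → ℝ)).toReal
      ≤ ∑ i : Fin d, 2 ^ n * modulus u (((2 : ℝ) ^ n)⁻¹ • unitVec i) := by
  obtain ⟨w, hw, h⟩ := hu
  rw [variation_congr h]
  simp only [modulus_congr h]
  refine ENNReal.toReal_le_of_le_ofReal ?_ (hw.variation_le (u.integrable.congr h))
  exact Finset.sum_nonneg fun i _ => mul_nonneg (by positivity) (modulus_nonneg _ _)

/-- An inverse inequality: on functions constant on cells, the modulus at the mesh size is at most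
twice the L¹ norm, and dividing by the mesh costs 2^n. -/
theorem variation_le_norm_toL1 {n : ℕ} {u : BV d} (hu : u ∈ gridBV d n) :
    (variation (u : E d → ℝ)).toReal ≤ d * (2 ^ n * (2 * ‖BV.toL1 u‖)) := by
  refine (variation_le_of_mem_gridBV hu).trans ?_
  calc ∑ i : Fin d, 2 ^ n * modulus u (((2 : ℝ) ^ n)⁻¹ • unitVec i)
      ≤ ∑ i : Fin d, 2 ^ n * (2 * ‖BV.toL1 u‖) := by
        refine Finset.sum_le_sum fun i _ => ?_
        rw [BV.norm_toL1]
        gcongr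
        exact modulus_le_two_mul u.integrable _
    _ = d * (2 ^ n * (2 * ‖BV.toL1 u‖)) := by simp

namespace DyadicNumbering

variable (K : DyadicNumbering d)

theorem cubeBV_mem_gridBV {n k : ℕ} (hk : k < 2 ^ (n * d)) : K.cubeBV n k ∈ gridBV d n := by
  refine ⟨(cell n fun i => (K.corner n k i : ℤ)).indicator fun _ => 1, fun x y h => ?_, ?_⟩
  · by_cases hx : x ∈ cell n fun i => (K.corner n k i : ℤ)
    · rw [Set.indicator_of_mem hx, Set.indicator_of_mem (mem_cell.2 (h ▸ mem_cell.1 hx))]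
    · rw [Set.indicator_of_notMem hx,
        Set.indicator_of_notMem fun hy => hx (mem_cell.2 (h ▸ mem_cell.1 hy))]
  · exact (coe_indBV (K.isBVSet_set hk)).trans
      (indicator_ae_eq_of_ae_eq_set (K.set_ae_eq_cell n k))

/-! ### The averaging operators -/

/-- The conditional expectation of `u` with respect to the dyadic cubes of generation `n`. -/
noncomputable def bvAverage (n : ℕ) (u : BV d) : BV d :=
  ∑ k ∈ Finset.range (2 ^ (n * d)), (2 ^ (n * d) * K.cubeT n k u) • K.cubeBV n k

theorem cellAverage_eq_zero (u : BV d) {n : ℕ} {x : E d}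
    (hx : ¬ ∀ i, 0 ≤ cellIndex n x i ∧ cellIndex n x i < 2 ^ n) : cellAverage n u x = 0 := by
  -- The closed cube also meets cells with an index equal to 2^n, but only in the null set of its
  -- upper faces.
  have h1 : ∀ᵐ y : E d, ∀ i, y i ≠ 1 := ae_all_iff.2 fun i => ae_coord_ne i 1
  rw [cellAverage, setIntegral_eq_zero_of_ae_eq_zero, mul_zero]
  filter_upwards [h1, u.ae_eq_zero] with y hy hu hyc
  refine hu fun hcube => hx fun i => ?_
  rw [← mem_cell.1 hyc]
  have hp : (0 : ℝ) < 2 ^ n := by positivity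
  have hlt : y i < 1 := lt_of_le_of_ne (hcube i).2 (hy i)
  have h0 : 0 ≤ y i := (hcube i).1
  refine ⟨Int.floor_nonneg.2 (by positivity), Int.floor_lt.2 ?_⟩
  push_cast
  exact mul_lt_of_lt_one_right hp hlt

theorem coe_bvAverage (n : ℕ) (u : BV d) :
    (K.bvAverage n u : E d → ℝ) =ᵐ[volume] cellAverage n u := by
  have h : ∀ᵐ x, ∀ k, k < 2 ^ (n * d) →
      ((2 ^ (n * d) * K.cubeT n k u) • K.cubeBV n k : BV d) x
      = 2 ^ (n * d) * (∫ y in cell n fun i => (K.corner n k i : ℤ), u y) *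
        (cell n fun i => (K.corner n k i : ℤ)).indicator (fun _ => (1 : ℝ)) x :=
    ae_all_iff.2 fun k => by
      by_cases hk : k < 2 ^ (n * d)
      · filter_upwards [BV.coe_smul (2 ^ (n * d) * K.cubeT n k u) (K.cubeBV n k),
          coe_indBV (K.isBVSet_set hk),
          indicator_ae_eq_of_ae_eq_set (f := fun _ => (1 : ℝ)) (K.set_ae_eq_cell n k)]
          with x h1 h2 h3 _
        rw [h1, cubeBV, h2, h3, cubeT_apply, setIntegral_congr_set (K.set_ae_eq_cell n k)]
      · exact Eventually.of_forall fun x h => absurd h hk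
  filter_upwards [BV.coe_sum (Finset.range (2 ^ (n * d)))
    fun k => (2 ^ (n * d) * K.cubeT n k u) • K.cubeBV n k, h] with x h1 h2
  rw [bvAverage, h1, Finset.sum_congr rfl fun k hk => h2 k (Finset.mem_range.1 hk),
    K.sum_corner (fun m => 2 ^ (n * d) * (∫ y in cell n fun i => (m i : ℤ), u y) *
        (cell n fun i => (m i : ℤ)).indicator (fun _ => (1 : ℝ)) x)]
  by_cases hx : ∀ i, 0 ≤ cellIndex n x i ∧ cellIndex n x i < 2 ^ n
  · have hm : (fun i => ((cellIndex n x i).toNat : ℤ)) = cellIndex n x :=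
      funext fun i => Int.toNat_of_nonneg (hx i).1
    rw [Finset.sum_eq_single fun i => (cellIndex n x i).toNat]
    · simp only [hm]
      rw [Set.indicator_of_mem (mem_cell.2 rfl), mul_one, cellAverage]
    · intro m _ hne
      rw [Set.indicator_of_notMem, mul_zero]
      refine fun hxm => hne (funext fun i => ?_)
      rw [mem_cell.1 hxm]
      simp
    · intro hnm
      refine absurd ?_ hnm
      simp only [Fintype.mem_piFinset, Finset.mem_range]
      intro i
      have := hx i
      zify
      rw [Int.toNat_of_nonneg this.1]
      exact this.2
  · rw [cellAverage_eq_zero u hx]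
    refine Finset.sum_eq_zero fun m hm => ?_
    rw [Set.indicator_of_notMem, mul_zero]
    refine fun hxm => hx fun i => ?_
    rw [mem_cell.1 hxm]
    have := Finset.mem_range.1 (Fintype.mem_piFinset.1 hm i)
    exact ⟨Int.natCast_nonneg _, show (m i : ℤ) < 2 ^ n by exact_mod_cast this⟩

theorem bvAverage_mem_gridBV (n : ℕ) (u : BV d) : K.bvAverage n u ∈ gridBV d n :=
  ⟨_, isGrid_cellAverage n u, K.coe_bvAverage n u⟩

/-- The L¹ part is a contraction. Each of the d directions contributes at most ‖u‖ to the variation: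
averaging does not increase the modulus at the mesh size, and the factor 2^n undoes the length of
the translation. -/
theorem norm_bvAverage_le (n : ℕ) (u : BV d) : ‖K.bvAverage n u‖ ≤ (1 + d) * ‖u‖ := by
  have h1 : ‖BV.toL1 (K.bvAverage n u)‖ ≤ ‖u‖ := by
    refine le_trans ?_ u.norm_toL1_le
    rw [BV.norm_toL1, BV.norm_toL1]
    refine le_trans (le_of_eq ?_) (integral_abs_cellAverage_le n u.integrable)
    refine integral_congr_ae ?_
    filter_upwards [K.coe_bvAverage n u] with x hx
    rw [hx]
  have h2 : (variation (K.bvAverage n u : E d → ℝ)).toReal ≤ d * ‖u‖ := by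
    refine (variation_le_of_mem_gridBV (K.bvAverage_mem_gridBV n u)).trans ?_
    calc ∑ i : Fin d, 2 ^ n * modulus (K.bvAverage n u) (((2 : ℝ) ^ n)⁻¹ • unitVec i)
        ≤ ∑ i : Fin d, ‖u‖ := by
          refine Finset.sum_le_sum fun i _ => ?_
          rw [modulus_congr (K.coe_bvAverage n u), ← latVec_single]
          have h3 : modulus (cellAverage n (u : E d → ℝ)) (latVec n (Pi.single i 1))
              ≤ (2 ^ n)⁻¹ * ‖u‖ := by
            refine (modulus_cellAverage_le n u.integrable _).trans ?_
            rw [latVec_single]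
            refine (u.modulus_smul_unitVec_le i _).trans ?_
            rw [abs_of_pos (by positivity)]
            exact mul_le_mul_of_nonneg_left u.variation_le_norm (by positivity)
          calc 2 ^ n * modulus (cellAverage n (u : E d → ℝ)) (latVec n (Pi.single i 1))
              ≤ 2 ^ n * ((2 ^ n)⁻¹ * ‖u‖) := by gcongr
            _ = ‖u‖ := by rw [← mul_assoc, mul_inv_cancel₀ (by positivity), one_mul]
      _ = d * ‖u‖ := by simp
  rw [BV.norm_def]
  linarith

/-! ### Partial sums of Haar series -/

/-- The partial sum of order `N` of the Haar series of `u`. -/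
noncomputable def haarSum (N : ℕ) (u : BV d) : BV d :=
  ∑ j ∈ Finset.range N, haarCoefSeq d K.cubeT j u • haarCoefSeq d K.cubeBV j

theorem haarCoef_cubeT_apply (n k r : ℕ) (u : BV d) :
    haarCoef d K.cubeT n k r u = haarCoef d (fun n k => K.cubeT n k u) n k r := by
  simp [haarCoef, sum_apply]

theorem haarCoefSeq_cubeT_apply (j : ℕ) (u : BV d) :
    haarCoefSeq d K.cubeT j u = haarCoefSeq d (fun n k => K.cubeT n k u) j := by
  cases j with
  | zero => rfl
  | succ j => exact K.haarCoef_cubeT_apply _ _ _ u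

theorem dyadicAdditive_cubeT_apply (u : BV d) : DyadicAdditive d fun n k => K.cubeT n k u := by
  simp only [cubeT_apply]
  exact K.dyadicAdditive_setIntegral u.integrable

theorem haarSum_two_pow (hd : 1 ≤ d) (n : ℕ) (u : BV d) :
    K.haarSum (2 ^ (n * d)) u = K.bvAverage n u := by
  simp only [haarSum, haarCoefSeq_cubeT_apply]
  exact sum_haarCoefSeq_smul hd (K.dyadicAdditive_cubeT_apply u) K.dyadicAdditive_cubeBV n

/-- The sum of the moduli of `u` for the translations between neighbouring cells. -/
noncomputable def neighbourDiff (u : BV d) (n : ℕ) (x : E d) : ℝ :=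
  ∑ v ∈ Fintype.piFinset fun _ : Fin d => Finset.Icc (-1 : ℤ) 1, |u (x + latVec n v) - u x|

theorem neighbourDiff_nonneg (u : BV d) (n : ℕ) (x : E d) : 0 ≤ neighbourDiff u n x :=
  Finset.sum_nonneg fun _ _ => abs_nonneg _

theorem integrable_neighbourDiff (u : BV d) (n : ℕ) : Integrable (neighbourDiff u n) :=
  integrable_finsetSum _ fun v _ => (integrable_translate_sub u.integrable (latVec n v)).abs

theorem integral_neighbourDiff_le (u : BV d) (n : ℕ) :
    ∫ x, neighbourDiff u n x ≤ 3 ^ d * (d * ((2 ^ n)⁻¹ * ‖u‖)) := by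
  unfold neighbourDiff
  rw [integral_finsetSum _ fun v _ => (integrable_translate_sub u.integrable (latVec n v)).abs]
  calc ∑ v ∈ Fintype.piFinset fun _ : Fin d => Finset.Icc (-1 : ℤ) 1,
        ∫ x, |u (x + latVec n v) - u x|
      ≤ ∑ v ∈ Fintype.piFinset fun _ : Fin d => Finset.Icc (-1 : ℤ) 1,
        d * ((2 ^ n)⁻¹ * ‖u‖) := by
        refine Finset.sum_le_sum fun v hv => ?_
        refine (u.modulus_latVec_le n fun i => ?_).trans ?_
        · exact abs_le.2 (Finset.mem_Icc.1 (Fintype.mem_piFinset.1 hv i))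
        · gcongr
          exact u.variation_le_norm
    _ = 3 ^ d * (d * ((2 ^ n)⁻¹ * ‖u‖)) := by
        rw [Finset.sum_const, Fintype.card_piFinset]
        simp

/-- Siblings have indices differing by at most 1 in each coordinate, so one integral is obtained
from the other by a lattice translation counted in `neighbourDiff`. -/
theorem abs_cubeT_sub_le {n k l : ℕ} (hk : k < 2 ^ (n * d)) (hl : l < 2 ^ d) (u : BV d) :
    |K.cubeT (n + 1) (2 ^ d * k + l) u - K.cubeT (n + 1) (2 ^ d * k) u|
      ≤ ∫ x in K.set (n + 1) (2 ^ d * k), neighbourDiff u (n + 1) x := by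
  set m : Fin d → ℤ := fun i => (K.corner (n + 1) (2 ^ d * k) i : ℤ) with hm
  set m' : Fin d → ℤ := fun i => (K.corner (n + 1) (2 ^ d * k + l) i : ℤ) with hm'
  have hv : m' = m + (m' - m) := by abel
  have hb : ∀ i, |(m' - m) i| ≤ 1 := fun i => by
    have h1 := K.subcube n k l hk hl i
    have h2 := K.subcube n k 0 hk (by positivity) i
    rw [add_zero] at h2
    simp only [Pi.sub_apply, hm, hm']
    rw [abs_le]
    omega
  rw [cubeT_apply, cubeT_apply, setIntegral_congr_set (K.set_ae_eq_cell _ _),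
    setIntegral_congr_set (K.set_ae_eq_cell _ (2 ^ d * k)),
    setIntegral_congr_set (f := neighbourDiff u (n + 1)) (K.set_ae_eq_cell _ (2 ^ d * k))]
  change |(∫ x in cell (n + 1) m', u x) - ∫ x in cell (n + 1) m, u x| ≤ _
  rw [hv, setIntegral_cell_add, ← integral_sub (u.integrable.comp_add_right _).integrableOn
    u.integrable.integrableOn]
  refine abs_integral_le_integral_abs.trans ?_
  refine setIntegral_mono (integrable_translate_sub u.integrable _).abs.integrableOn
    (integrable_neighbourDiff u _).integrableOn fun x => ?_
  refine Finset.single_le_sum (f := fun v => |u (x + latVec (n + 1) v) - u x|)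
    (fun v _ => abs_nonneg _) ?_
  simp only [Fintype.mem_piFinset, Finset.mem_Icc]
  exact fun i => abs_le.1 (hb i)

/-- For r ≠ 0 the row sums to zero, so the integral over the child with ℓ = 0 can be subtracted from
every term, leaving differences between siblings. -/
theorem abs_haarCoef_cubeT_le {n k r : ℕ} (hk : k < 2 ^ (n * d)) (hr : r < 2 ^ d) (hr0 : r ≠ 0)
    (u : BV d) : |haarCoef d K.cubeT n k r u| ≤ (2 : ℝ) ^ ((n * d : ℝ) / 2) *
      (2 ^ d * ∫ x in K.set (n + 1) (2 ^ d * k), neighbourDiff u (n + 1) x) := by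
  rw [haarCoef_cubeT_apply, haarCoef, smul_eq_mul, abs_mul, abs_of_pos (by positivity)]
  refine mul_le_mul_of_nonneg_left ?_ (by positivity)
  have h : ∑ l ∈ Finset.range (2 ^ d), hadamard d r l • K.cubeT (n + 1) (2 ^ d * k + l) u
      = ∑ l ∈ Finset.range (2 ^ d), hadamard d r l *
        (K.cubeT (n + 1) (2 ^ d * k + l) u - K.cubeT (n + 1) (2 ^ d * k) u) := by
    simp only [mul_sub, Finset.sum_sub_distrib, smul_eq_mul]
    rw [← Finset.sum_mul, sum_hadamard_row d hr hr0, zero_mul, sub_zero]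
  rw [h]
  refine (Finset.abs_sum_le_sum_abs _ _).trans ?_
  calc ∑ l ∈ Finset.range (2 ^ d), |hadamard d r l *
        (K.cubeT (n + 1) (2 ^ d * k + l) u - K.cubeT (n + 1) (2 ^ d * k) u)|
      ≤ ∑ l ∈ Finset.range (2 ^ d),
        ∫ x in K.set (n + 1) (2 ^ d * k), neighbourDiff u (n + 1) x := by
        refine Finset.sum_le_sum fun l hl => ?_
        rw [abs_mul, abs_hadamard, one_mul]
        exact K.abs_cubeT_sub_le hk (Finset.mem_range.1 hl) u
    _ = _ := by simp

theorem norm_toL1_haarCoef_cubeBV_le {n k : ℕ} (hk : k < 2 ^ (n * d)) (r : ℕ) :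
    ‖BV.toL1 (haarCoef d K.cubeBV n k r)‖
      ≤ (2 : ℝ) ^ ((n * d : ℝ) / 2) * (2 ^ (n * d))⁻¹ := by
  rw [haarCoef, map_smul, norm_smul, Real.norm_eq_abs, abs_of_pos (by positivity), map_sum]
  refine mul_le_mul_of_nonneg_left ((norm_sum_le _ _).trans ?_) (by positivity)
  calc ∑ l ∈ Finset.range (2 ^ d),
        ‖BV.toL1 (hadamard d r l • K.cubeBV (n + 1) (2 ^ d * k + l))‖
      = ∑ l ∈ Finset.range (2 ^ d), ((2 : ℝ) ^ ((n + 1) * d))⁻¹ := by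
        refine Finset.sum_congr rfl fun l hl => ?_
        rw [map_smul, norm_smul, Real.norm_eq_abs, abs_hadamard, one_mul, cubeBV,
          norm_toL1_indBV (K.isBVSet_set (child_lt hk (Finset.mem_range.1 hl))), Measure.real,
          volume_set, ENNReal.toReal_ofReal (by positivity)]
    _ = (2 ^ (n * d))⁻¹ := by
        rw [Finset.sum_const, Finset.card_range, nsmul_eq_mul, add_mul, one_mul, pow_add]
        push_cast
        field_simp
    _ ≤ _ := le_rfl

theorem sum_setIntegral_child_le {φ : E d → ℝ} (hφ : Integrable φ) (h0 : ∀ x, 0 ≤ φ x) (n : ℕ) :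
    ∑ k ∈ Finset.range (2 ^ (n * d)), ∫ x in K.set (n + 1) (2 ^ d * k), φ x ≤ ∫ x, φ x := by
  have hadd := K.dyadicAdditive_setIntegral hφ
  calc ∑ k ∈ Finset.range (2 ^ (n * d)), ∫ x in K.set (n + 1) (2 ^ d * k), φ x
      ≤ ∑ k ∈ Finset.range (2 ^ (n * d)), ∫ x in K.set n k, φ x := by
        refine Finset.sum_le_sum fun k hk => ?_
        refine le_trans ?_ (hadd n k (Finset.mem_range.1 hk)).le
        exact Finset.single_le_sum (f := fun l => ∫ x in K.set (n + 1) (2 ^ d * k + l), φ x)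
          (fun l _ => integral_nonneg h0) (Finset.mem_range.2 (by positivity : 0 < 2 ^ d))
    _ = ∫ x in K.set 0 0, φ x := hadd.sum_eq n
    _ ≤ ∫ x, φ x := setIntegral_le_integral hφ (Eventually.of_forall h0)

/-- The remainder of a Haar series within a generation is small in `L¹`. -/
theorem norm_toL1_haarSum_sub_le (hd : 1 ≤ d) {n N : ℕ} (h1 : 2 ^ (n * d) ≤ N)
    (h2 : N ≤ 2 ^ ((n + 1) * d)) (u : BV d) :
    ‖BV.toL1 (K.haarSum N u - K.bvAverage n u)‖ ≤ 12 ^ d * d * ((2 ^ (n + 1))⁻¹ * ‖u‖) := by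
  let F : ℕ → ℝ := fun j => |haarCoefSeq d K.cubeT j u| * ‖BV.toL1 (haarCoefSeq d K.cubeBV j)‖
  have hF0 : ∀ j, 0 ≤ F j := fun j => by positivity
  calc ‖BV.toL1 (K.haarSum N u - K.bvAverage n u)‖
      = ‖∑ j ∈ Finset.Ico (2 ^ (n * d)) N,
          BV.toL1 (haarCoefSeq d K.cubeT j u • haarCoefSeq d K.cubeBV j)‖ := by
        rw [← K.haarSum_two_pow hd n u, haarSum, haarSum, ← Finset.sum_Ico_eq_sub _ h1, map_sum]
    _ ≤ ∑ j ∈ Finset.Ico (2 ^ (n * d)) N, F j := by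
        refine (norm_sum_le _ _).trans (Finset.sum_le_sum fun j _ => ?_)
        rw [map_smul, norm_smul, Real.norm_eq_abs]
    -- The terms are now nonnegative, so an incomplete generation is bounded by the complete one.
    _ ≤ ∑ j ∈ Finset.Ico (2 ^ (n * d)) (2 ^ ((n + 1) * d)), F j :=
        Finset.sum_le_sum_of_subset_of_nonneg (Finset.Ico_subset_Ico_right h2) fun j _ _ => hF0 j
    _ = ∑ k ∈ Finset.range (2 ^ (n * d)), ∑ r ∈ Finset.range (2 ^ d - 1),
          F (2 ^ (n * d) + (2 ^ d - 1) * k + r) := by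
        rw [Finset.sum_Ico_eq_sub _ (h1.trans h2), sum_generation, add_sub_cancel_left]
    _ ≤ ∑ k ∈ Finset.range (2 ^ (n * d)), ∑ r ∈ Finset.range (2 ^ d - 1),
          2 ^ d * ∫ x in K.set (n + 1) (2 ^ d * k), neighbourDiff u (n + 1) x := by
        refine Finset.sum_le_sum fun k hk => Finset.sum_le_sum fun r hr => ?_
        have hk' := Finset.mem_range.1 hk
        have hr' := Finset.mem_range.1 hr
        simp only [F]
        rw [haarCoefSeq_eq hd _ hk' hr', haarCoefSeq_eq hd _ hk' hr']
        refine (mul_le_mul (K.abs_haarCoef_cubeT_le hk' (by omega) (by omega) u)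
          (K.norm_toL1_haarCoef_cubeBV_le hk' _) (norm_nonneg _) ?_).trans_eq ?_
        · exact mul_nonneg (by positivity) (mul_nonneg (by positivity)
            (integral_nonneg (neighbourDiff_nonneg u _)))
        · rw [mul_mul_mul_comm, mul_comm (2 ^ d * _), ← mul_assoc, ← mul_assoc, mul_assoc _ _ (2 ^ d)]
          rw [mul_right_comm, two_rpow_half_mul_self]
          field_simp
    -- Fewer than 2^d types, each with the factor 2^d, give 4^d. The 3^d neighbour vectors then make
    -- it 12^d.
    _ ≤ ∑ k ∈ Finset.range (2 ^ (n * d)), 4 ^ d *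
          ∫ x in K.set (n + 1) (2 ^ d * k), neighbourDiff u (n + 1) x := by
        refine Finset.sum_le_sum fun k _ => ?_
        rw [Finset.sum_const, Finset.card_range, nsmul_eq_mul, ← mul_assoc]
        refine mul_le_mul_of_nonneg_right ?_ (integral_nonneg (neighbourDiff_nonneg u _))
        have : ((2 ^ d - 1 : ℕ) : ℝ) ≤ 2 ^ d := by exact_mod_cast Nat.sub_le _ _
        calc ((2 ^ d - 1 : ℕ) : ℝ) * 2 ^ d ≤ 2 ^ d * 2 ^ d := by gcongr
          _ = 4 ^ d := by rw [← mul_pow]; norm_num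
    _ ≤ 4 ^ d * (3 ^ d * (d * ((2 ^ (n + 1))⁻¹ * ‖u‖))) := by
        rw [← Finset.mul_sum]
        refine mul_le_mul_of_nonneg_left ?_ (by positivity)
        exact (K.sum_setIntegral_child_le (integrable_neighbourDiff u _)
          (neighbourDiff_nonneg u _) n).trans (integral_neighbourDiff_le u _)
    _ = 12 ^ d * d * ((2 ^ (n + 1))⁻¹ * ‖u‖) := by
        rw [show (12 : ℝ) = 4 * 3 by norm_num, mul_pow]
        ring

theorem haarSum_sub_mem_gridBV (hd : 1 ≤ d) {n N : ℕ} (h1 : 2 ^ (n * d) ≤ N)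
    (h2 : N ≤ 2 ^ ((n + 1) * d)) (u : BV d) :
    K.haarSum N u - K.bvAverage n u ∈ gridBV d (n + 1) := by
  rw [← K.haarSum_two_pow hd n u, haarSum, haarSum, ← Finset.sum_Ico_eq_sub _ h1]
  refine Submodule.sum_mem _ fun j hj => Submodule.smul_mem _ _ ?_
  obtain ⟨hj1, hj2⟩ := Finset.mem_Ico.1 hj
  -- Division by 2^d - 1 inverts the lexicographic ranking within generation n.
  have hj3 : j - 2 ^ (n * d) < (2 ^ d - 1) * 2 ^ (n * d) := by
    have := two_pow_generation d n
    omega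
  have hm : 0 < 2 ^ d - 1 := by
    have : 2 ^ 1 ≤ 2 ^ d := Nat.pow_le_pow_right (by norm_num) hd
    omega
  have hk : (j - 2 ^ (n * d)) / (2 ^ d - 1) < 2 ^ (n * d) := Nat.div_lt_of_lt_mul hj3
  have hr := Nat.mod_lt (j - 2 ^ (n * d)) hm
  have hj4 : j = 2 ^ (n * d) + (2 ^ d - 1) * ((j - 2 ^ (n * d)) / (2 ^ d - 1))
      + (j - 2 ^ (n * d)) % (2 ^ d - 1) := by
    have := Nat.div_add_mod (j - 2 ^ (n * d)) (2 ^ d - 1)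
    omega
  rw [hj4, haarCoefSeq_eq hd _ hk hr]
  refine Submodule.smul_mem _ _ (Submodule.sum_mem _ fun l hl => Submodule.smul_mem _ _ ?_)
  exact K.cubeBV_mem_gridBV (child_lt hk (Finset.mem_range.1 hl))

theorem exists_generation (hd : 1 ≤ d) {N : ℕ} (hN : N ≠ 0) :
    ∃ n, 2 ^ (n * d) ≤ N ∧ N ≤ 2 ^ ((n + 1) * d) ∧ n = Nat.log (2 ^ d) N := by
  have hb : 1 < 2 ^ d := Nat.one_lt_two_pow (by omega)
  refine ⟨Nat.log (2 ^ d) N, ?_, ?_, rfl⟩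
  · rw [mul_comm, pow_mul]
    exact Nat.pow_log_le_self _ hN
  · rw [mul_comm, pow_mul]
    exact (Nat.lt_pow_succ_log_self hb N).le

/-- The partial sums of Haar series are uniformly bounded operators in `BV`. -/
theorem exists_norm_haarSum_le (hd : 1 ≤ d) : ∃ C : ℝ, 0 ≤ C ∧ ∀ N (u : BV d),
    ‖K.haarSum N u‖ ≤ C * ‖u‖ := by
  set A : ℝ := 12 ^ d * d with hA
  have hA0 : 0 ≤ A := by positivity
  refine ⟨(1 + d) + A * (1 + 2 * d), by positivity, fun N u => ?_⟩
  rcases eq_or_ne N 0 with rfl | hN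
  · simp only [haarSum, Finset.range_zero, Finset.sum_empty, norm_zero]
    positivity
  obtain ⟨n, h1, h2, -⟩ := exists_generation hd hN
  have e1 := K.norm_toL1_haarSum_sub_le hd h1 h2 u
  have e2 := variation_le_norm_toL1 (K.haarSum_sub_mem_gridBV hd h1 h2 u)
  have e3 : ‖K.haarSum N u - K.bvAverage n u‖ ≤ A * (1 + 2 * d) * ‖u‖ := by
    have hp : (0 : ℝ) < 2 ^ (n + 1) := by positivity
    have hp1 : ((2 : ℝ) ^ (n + 1))⁻¹ ≤ 1 := inv_le_one_of_one_le₀ (one_le_pow₀ (by norm_num))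
    have e4 : ‖BV.toL1 (K.haarSum N u - K.bvAverage n u)‖ ≤ A * ‖u‖ := by
      refine e1.trans (mul_le_mul_of_nonneg_left ?_ hA0)
      exact mul_le_of_le_one_left (norm_nonneg _) hp1
    -- The factor 2^(n+1) of the inverse inequality cancels against the decay of the L¹ remainder;
    -- this makes the bound uniform in N.
    have e5 : (variation (K.haarSum N u - K.bvAverage n u : BV d)).toReal
        ≤ A * (2 * d) * ‖u‖ := by
      refine e2.trans ?_
      calc (d : ℝ) * (2 ^ (n + 1) * (2 * ‖BV.toL1 (K.haarSum N u - K.bvAverage n u)‖))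
          ≤ d * (2 ^ (n + 1) * (2 * (A * ((2 ^ (n + 1))⁻¹ * ‖u‖)))) := by gcongr
        _ = A * (2 * d) * ‖u‖ := by field_simp
    rw [BV.norm_def]
    nlinarith
  calc ‖K.haarSum N u‖ = ‖K.bvAverage n u + (K.haarSum N u - K.bvAverage n u)‖ := by
        rw [add_sub_cancel]
    _ ≤ ‖K.bvAverage n u‖ + ‖K.haarSum N u - K.bvAverage n u‖ := norm_add_le _ _
    _ ≤ _ := by
        have := K.norm_bvAverage_le n u
        linarith

end DyadicNumbering

/-! ### Approximation of strong charge functionals -/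

theorem BV.exists_eLpNorm_le (hd : 1 ≤ d) :
    ∃ (p : ℝ≥0∞) (C : NNReal), ENNReal.HolderTriple d p 1 ∧ ∀ u : BV d,
      eLpNorm (u : E d → ℝ) p volume ≤ C * ENNReal.ofReal ‖u‖ := by
  obtain ⟨p, C, hp, h⟩ := exists_eLpNorm_le_variation hd
  refine ⟨p, C, hp, fun u => ?_⟩
  have hae := u.indicator_cube_ae_eq
  rw [← eLpNorm_congr_ae hae]
  have hv : variation (u : E d → ℝ) < ∞ := u.variation_lt_top
  rw [← variation_congr hae] at hv
  refine (h _ (u.integrable.congr hae.symm) u.hasCompactSupport_indicator_cube hv).trans ?_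
  rw [variation_congr hae]
  gcongr
  rw [← ENNReal.ofReal_toReal u.variation_lt_top.ne]
  exact ENNReal.ofReal_le_ofReal u.variation_le_norm

/-- Hölder's inequality and the Sobolev embedding bound the dual norm by the L^d norm of the
density, and compactly supported continuous functions are dense in L^d. -/
theorem exists_continuous_approx_of_mem_rangeT (hd : 1 ≤ d) {α : BV d →L[ℝ] ℝ} (hα : α ∈ rangeT d)
    {ε : ℝ} (hε : 0 < ε) : ∃ (h : E d → ℝ) (hc : Continuous h) (hs : HasCompactSupport h),
      ‖α - T h hc.measurable (hc.bounded_above_of_compact_support hs)‖ ≤ ε := by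
  obtain ⟨g, hg, hgα⟩ := hα
  obtain ⟨p, C, hp, hC⟩ := BV.exists_eLpNorm_le hd
  -- Dividing by C + 1 allows the Sobolev constant C to be zero.
  have hδ : ENNReal.ofReal (ε / (C + 1)) ≠ 0 := by
    rw [Ne, ENNReal.ofReal_eq_zero, not_le]
    positivity
  obtain ⟨h, hs, hle, hc, -⟩ := hg.exists_hasCompactSupport_eLpNorm_sub_le (by simp) hδ
  refine ⟨h, hc, hs, ContinuousLinearMap.opNorm_le_bound _ hε.le fun u => ?_⟩
  have hi2 : Integrable (fun x => h x * u x) (volume.restrict (cube d)) := by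
    obtain ⟨B, hB⟩ := hc.bounded_above_of_compact_support hs
    exact u.integrable.restrict.bdd_mul hc.aestronglyMeasurable (Eventually.of_forall hB)
  have e1 : (α - T h hc.measurable (hc.bounded_above_of_compact_support hs)) u
      = ∫ x in cube d, (g - h) x * u x := by
    simp only [Pi.sub_apply, sub_mul]
    rw [integral_sub (hgα u).1 hi2, ← (hgα u).2]
    rfl
  have hm1 : AEStronglyMeasurable (g - h) (volume.restrict (cube d)) :=
    hg.1.sub hc.aestronglyMeasurable
  have e2 : eLpNorm ((g - h) • (u : E d → ℝ)) 1 (volume.restrict (cube d))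
      ≤ ENNReal.ofReal (ε * ‖u‖) := by
    calc eLpNorm ((g - h) • (u : E d → ℝ)) 1 (volume.restrict (cube d))
        ≤ eLpNorm (g - h) d (volume.restrict (cube d))
          * eLpNorm (u : E d → ℝ) p (volume.restrict (cube d)) :=
          eLpNorm_smul_le_mul_eLpNorm u.integrable.aestronglyMeasurable.restrict hm1
      _ ≤ ENNReal.ofReal (ε / (C + 1)) * (C * ENNReal.ofReal ‖u‖) := by
          gcongr
          exact (eLpNorm_mono_measure _ Measure.restrict_le_self).trans (hC u)
      _ ≤ ENNReal.ofReal (ε * ‖u‖) := by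
          rw [← ENNReal.ofReal_coe_nnreal, ← ENNReal.ofReal_mul (by positivity),
            ← ENNReal.ofReal_mul (by positivity)]
          refine ENNReal.ofReal_le_ofReal ?_
          rw [← mul_assoc]
          refine mul_le_mul_of_nonneg_right ?_ (norm_nonneg _)
          rw [div_mul_eq_mul_div, div_le_iff₀ (by positivity)]
          exact mul_le_mul_of_nonneg_left (by simp) hε.le
  rw [e1, ← toReal_enorm]
  refine ENNReal.toReal_le_of_le_ofReal (by positivity) (le_trans ?_ e2)
  rw [eLpNorm_one_eq_lintegral_enorm]
  exact enorm_integral_le_lintegral_enorm _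

/-- The functionals `T_h` with `h` continuous are dense among the strong charge functionals. -/
theorem exists_continuous_approx (hd : 1 ≤ d) {α : BV d →L[ℝ] ℝ} (hα : α ∈ SCH d)
    {ε : ℝ} (hε : 0 < ε) : ∃ (h : E d → ℝ) (hc : Continuous h) (hs : HasCompactSupport h),
      ‖α - T h hc.measurable (hc.bounded_above_of_compact_support hs)‖ ≤ ε := by
  have hα' : α ∈ closure (rangeT d : Set (BV d →L[ℝ] ℝ)) := hα
  obtain ⟨β, hβ, hαβ⟩ := Metric.mem_closure_iff.1 hα' (ε / 2) (by positivity)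
  obtain ⟨h, hc, hs, hh⟩ := exists_continuous_approx_of_mem_rangeT hd hβ (half_pos hε)
  refine ⟨h, hc, hs, ?_⟩
  rw [dist_eq_norm] at hαβ
  calc _ = ‖(α - β) + (β - T h hc.measurable (hc.bounded_above_of_compact_support hs))‖ := by
        rw [sub_add_sub_cancel]
    _ ≤ _ := (norm_add_le _ _).trans (by linarith)

/-- Strong charge functionals are continuous for the `L¹` convergence of `BV`-bounded sequences. -/
theorem tendsto_of_mem_SCH (hd : 1 ≤ d) {α : BV d →L[ℝ] ℝ} (hα : α ∈ SCH d) {u : ℕ → BV d}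
    {v : BV d} {M : ℝ} (hM : ∀ n, ‖u n‖ ≤ M)
    (hu : Tendsto (fun n => ‖BV.toL1 (u n - v)‖) atTop (𝓝 0)) :
    Tendsto (fun n => α (u n)) atTop (𝓝 (α v)) := by
  have hM0 : 0 ≤ M := (norm_nonneg _).trans (hM 0)
  rw [Metric.tendsto_atTop]
  intro ε hε
  -- The norm of u n - v is at most M + ‖v‖, which controls the approximation error; the functional
  -- with bounded density is controlled by the L¹ distance alone.
  obtain ⟨h, hc, hs, hh⟩ := exists_continuous_approx hd hα
    (show 0 < ε / 2 / (M + ‖v‖ + 1) by positivity)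
  obtain ⟨B, hB⟩ := hc.bounded_above_of_compact_support hs
  have hB0 : 0 ≤ B := (norm_nonneg _).trans (hB 0)
  obtain ⟨N, hN⟩ := Metric.tendsto_atTop.1 hu (ε / 2 / (B + 1)) (by positivity)
  refine ⟨N, fun n hn => ?_⟩
  have h1 : ‖BV.toL1 (u n - v)‖ < ε / 2 / (B + 1) := by
    have := hN n hn
    rwa [Real.dist_eq, sub_zero, abs_of_nonneg (norm_nonneg _)] at this
  set τ := T h hc.measurable ⟨B, hB⟩ with hτ
  have h2 : |τ (u n - v)| ≤ B * ‖BV.toL1 (u n - v)‖ := abs_T_le hc.measurable hB _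
  have h3 : |(α - τ) (u n - v)| ≤ ε / 2 / (M + ‖v‖ + 1) * (M + ‖v‖) := by
    refine ((α - τ).le_opNorm _).trans ?_
    refine mul_le_mul hh ((norm_sub_le _ _).trans (by linarith [hM n])) (norm_nonneg _)
      (by positivity)
  have h4 : ε / 2 / (M + ‖v‖ + 1) * (M + ‖v‖) ≤ ε / 2 := by
    rw [div_mul_eq_mul_div, div_le_iff₀ (by positivity)]
    exact mul_le_mul_of_nonneg_left (by linarith) (by positivity)
  have h5 : B * ‖BV.toL1 (u n - v)‖ < ε / 2 := by
    calc B * ‖BV.toL1 (u n - v)‖ ≤ (B + 1) * ‖BV.toL1 (u n - v)‖ := by gcongr; linarith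
      _ < (B + 1) * (ε / 2 / (B + 1)) := by gcongr
      _ = ε / 2 := by field_simp
  rw [Real.dist_eq, ← map_sub]
  have h6 : α (u n - v) = (α - τ) (u n - v) + τ (u n - v) := by simp
  rw [h6]
  exact (abs_add_le _ _).trans_lt (by linarith)

/-! ### Convergence of Haar series -/

theorem norm_le_sum_abs (x : E d) : ‖x‖ ≤ ∑ i, |x i| := by
  have hx : x = ∑ i, x i • unitVec i := by
    ext j
    simp [Finset.sum_apply, Pi.single_apply]
  calc ‖x‖ = ‖∑ i, x i • unitVec i‖ := by rw [← hx]
    _ ≤ ∑ i, ‖x i • unitVec i‖ := norm_sum_le _ _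
    _ = ∑ i, |x i| := by simp [norm_smul]

namespace DyadicNumbering

variable (K : DyadicNumbering d)

theorem dist_le_of_mem_set {n k : ℕ} {x y : E d} (hx : x ∈ K.set n k) (hy : y ∈ K.set n k) :
    dist x y ≤ d * (2 ^ n)⁻¹ := by
  rw [dist_eq_norm]
  refine (norm_le_sum_abs _).trans ?_
  calc ∑ i, |(x - y) i| ≤ ∑ i : Fin d, ((2 : ℝ) ^ n)⁻¹ := by
        refine Finset.sum_le_sum fun i _ => ?_
        have h1 := hx i
        have h2 := hy i
        have h3 : dyadicHi n (K.corner n k) i - dyadicLo n (K.corner n k) i = (2 ^ n)⁻¹ := by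
          simp only [dyadicHi, dyadicLo]
          ring
        rw [PiLp.sub_apply, abs_le]
        constructor <;> linarith
    _ = d * (2 ^ n)⁻¹ := by simp

theorem T_cubeBV (h : E d → ℝ) (hm : Measurable h) (hb : ∃ C, ∀ x, ‖h x‖ ≤ C) {n k : ℕ}
    (hk : k < 2 ^ (n * d)) : T h hm hb (K.cubeBV n k) = ∫ x in K.set n k, h x := by
  rw [T_apply, ← integral_indicator (K.measurableSet_set n k)]
  refine integral_congr_ae ?_
  filter_upwards [coe_indBV (K.isBVSet_set hk)] with x hx
  rw [cubeBV, hx]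
  by_cases hxk : x ∈ K.set n k <;> simp [hxk]

theorem volume_real_set (n k : ℕ) : volume.real (K.set n k) = (2 ^ (n * d))⁻¹ := by
  rw [Measure.real, volume_set, ENNReal.toReal_ofReal (by positivity)]

/-- The left-hand product pairs u with the mean of h over the cube, and this mean is within the
oscillation ε of h itself. -/
theorem abs_mean_mul_sub_le {h : E d → ℝ} (hc : Continuous h) (hs : HasCompactSupport h) {n k : ℕ}
    {ε : ℝ} (hε : ∀ x ∈ K.set n k, ∀ y ∈ K.set n k, |h x - h y| ≤ ε) (u : BV d) :
    |2 ^ (n * d) * K.cubeT n k u * (∫ x in K.set n k, h x) - ∫ x in K.set n k, h x * u x|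
      ≤ ε * ∫ x in K.set n k, |u x| := by
  have hh : Integrable h := hc.integrable_of_hasCompactSupport hs
  obtain ⟨B, hB⟩ := hc.bounded_above_of_compact_support hs
  have hp : (0 : ℝ) < 2 ^ (n * d) := by positivity
  have hvol : volume (K.set n k) < ∞ := (isBounded_rect _ _).measure_lt_top
  set H : ℝ := 2 ^ (n * d) * ∫ x in K.set n k, h x with hH
  have hmean : ∀ x ∈ K.set n k, |H - h x| ≤ ε := fun x hx => by
    have e1 : H - h x = 2 ^ (n * d) * ∫ y in K.set n k, (h y - h x) := by
      rw [integral_sub hh.integrableOn (integrableOn_const hvol.ne), setIntegral_const,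
        K.volume_real_set, hH, smul_eq_mul]
      field_simp
    rw [e1, abs_mul, abs_of_pos hp]
    have := norm_setIntegral_le_of_norm_le_const (f := fun y => h y - h x) hvol
      fun y hy => hε y hy x hx
    rw [K.volume_real_set, Real.norm_eq_abs] at this
    calc 2 ^ (n * d) * |∫ y in K.set n k, (h y - h x)|
        ≤ 2 ^ (n * d) * (ε * (2 ^ (n * d))⁻¹) := by gcongr
      _ = ε := by field_simp
  have hi1 : IntegrableOn (fun x => h x * u x) (K.set n k) :=
    (u.integrable.bdd_mul hc.aestronglyMeasurable (Eventually.of_forall hB)).integrableOn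
  have e2 : 2 ^ (n * d) * K.cubeT n k u * (∫ x in K.set n k, h x) - ∫ x in K.set n k, h x * u x
      = ∫ x in K.set n k, (H - h x) * u x := by
    simp only [sub_mul]
    rw [integral_sub (u.integrable.integrableOn.const_mul H) hi1, integral_const_mul, cubeT_apply]
    ring
  rw [e2, ← integral_const_mul, ← Real.norm_eq_abs]
  refine norm_integral_le_of_norm_le (u.integrable.integrableOn.abs.const_mul ε) ?_
  refine (ae_restrict_iff' (K.measurableSet_set n k)).2 (Eventually.of_forall fun x hx => ?_)
  rw [norm_mul]
  exact mul_le_mul_of_nonneg_right (hmean x hx) (norm_nonneg _)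

theorem abs_T_bvAverage_sub_le {h : E d → ℝ} (hc : Continuous h) (hs : HasCompactSupport h) {n : ℕ}
    {ε : ℝ} (hε0 : 0 ≤ ε) (hε : ∀ x y, dist x y ≤ d * (2 ^ n)⁻¹ → |h x - h y| ≤ ε) (u : BV d) :
    |T h hc.measurable (hc.bounded_above_of_compact_support hs) (K.bvAverage n u)
      - T h hc.measurable (hc.bounded_above_of_compact_support hs) u| ≤ ε * ‖u‖ := by
  obtain ⟨B, hB⟩ := hc.bounded_above_of_compact_support hs
  have hi : Integrable fun x => h x * u x :=
    u.integrable.bdd_mul hc.aestronglyMeasurable (Eventually.of_forall hB)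
  have e1 : T h hc.measurable (hc.bounded_above_of_compact_support hs) (K.bvAverage n u)
      = ∑ k ∈ Finset.range (2 ^ (n * d)),
        2 ^ (n * d) * K.cubeT n k u * (∫ x in K.set n k, h x) := by
    rw [bvAverage, map_sum]
    refine Finset.sum_congr rfl fun k hk => ?_
    rw [map_smul, K.T_cubeBV _ _ _ (Finset.mem_range.1 hk), smul_eq_mul]
  have e2 : T h hc.measurable (hc.bounded_above_of_compact_support hs) u
      = ∑ k ∈ Finset.range (2 ^ (n * d)), ∫ x in K.set n k, h x * u x := by
    have h1 := (K.dyadicAdditive_setIntegral hi).sum_eq n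
    rw [h1, K.set_zero]
    rfl
  rw [e1, e2, ← Finset.sum_sub_distrib]
  refine (Finset.abs_sum_le_sum_abs _ _).trans ?_
  calc _ ≤ ∑ k ∈ Finset.range (2 ^ (n * d)), ε * ∫ x in K.set n k, |u x| :=
        Finset.sum_le_sum fun k _ => K.abs_mean_mul_sub_le hc hs
          (fun x hx y hy => hε x y (K.dist_le_of_mem_set hx hy)) u
    _ = ε * ∫ x in K.set 0 0, |u x| := by
        rw [← Finset.mul_sum]
        congr 1
        exact (K.dyadicAdditive_setIntegral u.integrable.abs).sum_eq n
    _ ≤ ε * ‖u‖ := by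
        refine mul_le_mul_of_nonneg_left ?_ hε0
        refine (setIntegral_le_integral u.integrable.abs
          (Eventually.of_forall fun x => abs_nonneg _)).trans ?_
        rw [← BV.norm_toL1]
        exact u.norm_toL1_le

/-- The error splits into the averaging error of the last complete generation, small by uniform
continuity of h, and the remainder within the next generation, small because h is bounded and the
remainder decays in L¹. -/
theorem exists_abs_T_haarSum_sub_le (hd : 1 ≤ d) {h : E d → ℝ} (hc : Continuous h)
    (hs : HasCompactSupport h) {ε : ℝ} (hε : 0 < ε) : ∃ N₀, ∀ N, N₀ ≤ N → ∀ u : BV d,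
    |T h hc.measurable (hc.bounded_above_of_compact_support hs) (K.haarSum N u)
      - T h hc.measurable (hc.bounded_above_of_compact_support hs) u| ≤ ε * ‖u‖ := by
  obtain ⟨B, hB⟩ := hc.bounded_above_of_compact_support hs
  have hB0 : 0 ≤ B := (norm_nonneg _).trans (hB 0)
  have huc : UniformContinuous h := hs.uniformContinuous_of_continuous hc
  obtain ⟨δ, hδ, hδh⟩ := Metric.uniformContinuous_iff.1 huc (ε / 2) (half_pos hε)
  have hpow : Tendsto (fun n : ℕ => ((2 : ℝ) ^ n)⁻¹) atTop (𝓝 0) := by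
    exact tendsto_inv_atTop_zero.comp (tendsto_pow_atTop_atTop_of_one_lt one_lt_two)
  have ev1 : ∀ᶠ n : ℕ in atTop, (d : ℝ) * ((2 : ℝ) ^ n)⁻¹ < δ :=
    (by simpa using hpow.const_mul (d : ℝ) : Tendsto _ _ (𝓝 (0 : ℝ))).eventually (gt_mem_nhds hδ)
  have ev2 : ∀ᶠ n : ℕ in atTop, B * (12 ^ d * d) * ((2 : ℝ) ^ (n + 1))⁻¹ < ε / 2 :=
    (by simpa using (hpow.comp (tendsto_add_atTop_nat 1)).const_mul (B * (12 ^ d * d)) :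
      Tendsto _ _ (𝓝 (0 : ℝ))).eventually (gt_mem_nhds (half_pos hε))
  obtain ⟨n₀, hn₀⟩ := eventually_atTop.1 (ev1.and ev2)
  have hb : 1 < 2 ^ d := Nat.one_lt_two_pow (by omega)
  refine ⟨(2 ^ d) ^ n₀, fun N hN u => ?_⟩
  have hN0 : N ≠ 0 := by
    have : 0 < (2 ^ d) ^ n₀ := by positivity
    omega
  obtain ⟨n, h1, h2, hn⟩ := exists_generation hd hN0
  have hnn : n₀ ≤ n := hn ▸ Nat.le_log_of_pow_le hb hN
  obtain ⟨hA, hC⟩ := hn₀ n hnn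
  set τ := T h hc.measurable (hc.bounded_above_of_compact_support hs) with hτ
  have e1 : |τ (K.bvAverage n u) - τ u| ≤ ε / 2 * ‖u‖ :=
    K.abs_T_bvAverage_sub_le hc hs (half_pos hε).le
      (fun x y hxy => (hδh (hxy.trans_lt hA)).le) u
  have e2 : |τ (K.haarSum N u - K.bvAverage n u)| ≤ ε / 2 * ‖u‖ := by
    refine (abs_T_le hc.measurable hB _).trans ?_
    calc B * ‖BV.toL1 (K.haarSum N u - K.bvAverage n u)‖
        ≤ B * (12 ^ d * d * ((2 ^ (n + 1))⁻¹ * ‖u‖)) :=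
          mul_le_mul_of_nonneg_left (K.norm_toL1_haarSum_sub_le hd h1 h2 u) hB0
      _ = (B * (12 ^ d * d) * (2 ^ (n + 1))⁻¹) * ‖u‖ := by ring
      _ ≤ ε / 2 * ‖u‖ := mul_le_mul_of_nonneg_right hC.le (norm_nonneg _)
  have e3 : τ (K.haarSum N u) - τ u
      = τ (K.haarSum N u - K.bvAverage n u) + (τ (K.bvAverage n u) - τ u) := by
    rw [map_sub]; ring
  rw [e3]
  exact (abs_add_le _ _).trans (by linarith)

/-- Haar series converge uniformly against strong charge functionals. -/
theorem exists_abs_haarSum_sub_le (hd : 1 ≤ d) {α : BV d →L[ℝ] ℝ} (hα : α ∈ SCH d)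
    {ε : ℝ} (hε : 0 < ε) : ∃ N₀, ∀ N, N₀ ≤ N → ∀ u : BV d,
    |α (K.haarSum N u) - α u| ≤ ε * ‖u‖ := by
  obtain ⟨C, hC0, hC⟩ := K.exists_norm_haarSum_le hd
  obtain ⟨h, hc, hs, hh⟩ := exists_continuous_approx hd hα
    (show 0 < ε / 2 / (C + 1) by positivity)
  obtain ⟨N₀, hN₀⟩ := K.exists_abs_T_haarSum_sub_le hd hc hs (half_pos hε)
  refine ⟨N₀, fun N hN u => ?_⟩
  -- α - τ is small in norm, and applying it to S_N u - u costs only C + 1, by uniform boundedness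
  -- of the Haar sums.
  set τ := T h hc.measurable (hc.bounded_above_of_compact_support hs) with hτ
  have e1 := hN₀ N hN u
  have e2 : |(α - τ) (K.haarSum N u - u)| ≤ ε / 2 * ‖u‖ := by
    have hnorm : ‖K.haarSum N u - u‖ ≤ (C + 1) * ‖u‖ :=
      (norm_sub_le _ _).trans (by linarith [hC N u])
    calc |(α - τ) (K.haarSum N u - u)| ≤ ‖α - τ‖ * ‖K.haarSum N u - u‖ := (α - τ).le_opNorm _
      _ ≤ ε / 2 / (C + 1) * ((C + 1) * ‖u‖) := by gcongr
      _ = ε / 2 * ‖u‖ := by field_simp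
  have e3 : α (K.haarSum N u) - α u
      = (α - τ) (K.haarSum N u - u) + (τ (K.haarSum N u) - τ u) := by
    rw [map_sub, sub_apply, sub_apply]
    ring
  rw [e3]
  exact (abs_add_le _ _).trans (by linarith)

end DyadicNumbering

/-! ### Strongly chargeable functions have convergent series -/

theorem cubeNo_lt (hd : 1 ≤ d) {j : ℕ} (hj : j ≠ 0) : cubeNo d j < 2 ^ (genNo d j * d) := by
  have hb : 1 < 2 ^ d := Nat.one_lt_two_pow (by omega)
  have h1 := Nat.lt_pow_succ_log_self hb j
  rw [← pow_mul, mul_comm, two_pow_generation] at h1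
  refine Nat.div_lt_of_lt_mul ?_
  have h2 : 2 ^ (genNo d j * d) ≤ j := by
    rw [mul_comm, pow_mul]
    exact Nat.pow_log_le_self _ hj
  have h3 : genNo d j = Nat.log (2 ^ d) j := rfl
  rw [← h3] at h1
  omega

/-- A numbering carries information only for k < 2^(nd). Agreement there suffices, because the cube
numbers in the enumeration stay in this range. -/
theorem haarCoefSeq_congr (hd : 1 ≤ d) {M : Type*} [AddCommGroup M] [Module ℝ M]
    {a b : ℕ → ℕ → M} (h : ∀ n k, k < 2 ^ (n * d) → a n k = b n k) (j : ℕ) :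
    haarCoefSeq d a j = haarCoefSeq d b j := by
  cases j with
  | zero => exact h 0 0 (by simp)
  | succ j =>
    simp only [haarCoefSeq, haarCoef]
    congr 1
    refine Finset.sum_congr rfl fun l hl => ?_
    rw [h _ _ (DyadicNumbering.child_lt (cubeNo_lt hd j.succ_ne_zero) (Finset.mem_range.1 hl))]

theorem DyadicNumbering.isRectBounds (K : DyadicNumbering d) {n k : ℕ} (hk : k < 2 ^ (n * d)) :
    IsRectBounds (dyadicLo n (K.corner n k)) (dyadicHi n (K.corner n k)) := fun i => by
  refine ⟨DyadicNumbering.dyadicLo_nonneg n _ i, ?_,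
    DyadicNumbering.dyadicHi_le_one (K.corner_lt hk) i⟩
  unfold dyadicLo dyadicHi
  gcongr
  exact lt_add_one _

theorem seriesConverges_of_stronglyChargeable (hd : 1 ≤ d) (K : DyadicNumbering d) {f : E d → ℝ}
    (h : StronglyChargeable f) :
    SeriesConverges fun j => lamSeq K f j • faberSchauder K j := by
  obtain ⟨μ, ⟨-, α, hα, hμ⟩, hrect, -⟩ := h
  have hcube : ∀ n k, k < 2 ^ (n * d) → K.increment f n k = α (K.cubeBV n k) := fun n k hk => by
    rw [DyadicNumbering.cubeBV, indBV_eq (K.isBVSet_set hk), ← hμ]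
    exact (hrect _ _ (K.isRectBounds hk)).symm
  -- By linearity, λ_j(f) is α evaluated at the j-th Haar function, since α gives the increments on
  -- dyadic cubes.
  have hlam : ∀ j, lamSeq K f j = α (haarCoefSeq d K.cubeBV j) := fun j => by
    rw [lamSeq_eq, haarCoefSeq_congr hd hcube]
    exact (map_haarCoefSeq (α : BV d →ₗ[ℝ] ℝ) K.cubeBV j).symm
  refine ⟨⟨α, hα⟩, ?_⟩
  rw [Metric.tendsto_atTop]
  intro ε hε
  obtain ⟨N₀, hN₀⟩ := K.exists_abs_haarSum_sub_le hd hα (half_pos hε)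
  refine ⟨N₀, fun N hN => ?_⟩
  rw [Subtype.dist_eq, dist_eq_norm]
  refine lt_of_le_of_lt ?_ (half_lt_self hε)
  refine ContinuousLinearMap.opNorm_le_bound _ (half_pos hε).le fun u => ?_
  -- The partial sum evaluated at u is α(S_N u), so the uniform estimate is a bound in operator
  -- norm.
  refine le_of_eq_of_le ?_ (hN₀ N hN u)
  rw [← Real.norm_eq_abs]
  congr 1
  simp only [Submodule.coe_sum, Submodule.coe_smul, sub_apply, sum_apply,
    smul_apply, K.faberSchauder_eq, hlam, DyadicNumbering.haarSum, map_sum, map_smul, smul_eq_mul]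
  congr 1
  exact Finset.sum_congr rfl fun j _ => mul_comm _ _

/-! ### The strong charge defined by a strong charge functional -/

theorem integrable_indicator_of_null {B : Set (E d)} (hB : B ⊆ cube d) (hm : NullMeasurableSet B) :
    Integrable (B.indicator fun _ => (1 : ℝ)) := by
  have h : IntegrableOn (fun _ => (1 : ℝ)) B :=
    integrableOn_const (((measure_mono hB).trans_lt (volume_cube_lt_top d)).ne)
  exact h.integrable_indicator₀ hm

theorem indicator_union_ae {B₁ B₂ : Set (E d)} (h : volume (B₁ ∩ B₂) = 0) :
    (B₁ ∪ B₂).indicator (fun _ => (1 : ℝ)) =ᵐ[volume]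
      fun x => B₁.indicator (fun _ => (1 : ℝ)) x + B₂.indicator (fun _ => (1 : ℝ)) x := by
  filter_upwards [measure_eq_zero_iff_ae_notMem.1 h] with x hx
  have hx' : ¬ (x ∈ B₁ ∧ x ∈ B₂) := hx
  by_cases h1 : x ∈ B₁ <;> by_cases h2 : x ∈ B₂ <;> simp_all

theorem IsBVSet.union {B₁ B₂ : Set (E d)} (h₁ : IsBVSet B₁) (h₂ : IsBVSet B₂)
    (h : volume (B₁ ∩ B₂) = 0) : IsBVSet (B₁ ∪ B₂) := by
  refine ⟨Set.union_subset h₁.1 h₂.1, h₁.2.1.union h₂.2.1, ?_⟩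
  rw [perimeter, variation_congr (indicator_union_ae h)]
  exact (variation_add_le h₁.integrable_indicator h₂.integrable_indicator).trans_lt
    (ENNReal.add_lt_top.2 ⟨h₁.2.2, h₂.2.2⟩)

theorem indBV_union {B₁ B₂ : Set (E d)} (h₁ : IsBVSet B₁) (h₂ : IsBVSet B₂)
    (h : volume (B₁ ∩ B₂) = 0) : indBV (B₁ ∪ B₂) = indBV B₁ + indBV B₂ := by
  refine BV.ext_ae ?_
  filter_upwards [coe_indBV (h₁.union h₂ h), coe_indBV h₁, coe_indBV h₂,
    BV.coe_add (indBV B₁) (indBV B₂), indicator_union_ae h] with x e1 e2 e3 e4 e5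
  rw [e1, e4, e2, e3, e5]

theorem norm_indBV {B : Set (E d)} (hB : IsBVSet B) :
    ‖indBV B‖ = volume.real B + (perimeter B).toReal := by
  rw [BV.norm_def, norm_toL1_indBV hB, variation_congr (coe_indBV hB), perimeter]

theorem norm_indBV_le {B : Set (E d)} (hB : IsBVSet B) :
    ‖indBV B‖ ≤ volume.real (cube d) + (perimeter B).toReal := by
  rw [norm_indBV hB]
  gcongr
  · exact (volume_cube_lt_top d).ne
  · exact hB.1

theorem norm_toL1_indBV_sub {A B : Set (E d)} (hA : IsBVSet A) (hB : IsBVSet B) :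
    ‖BV.toL1 (indBV A - indBV B)‖
      = ∫ x, |A.indicator (fun _ => (1 : ℝ)) x - B.indicator (fun _ => (1 : ℝ)) x| := by
  rw [map_sub, L1.norm_eq_integral_norm]
  refine integral_congr_ae ?_
  filter_upwards [coe_indBV hA, coe_indBV hB,
    Lp.coeFn_sub (BV.toL1 (indBV A)) (BV.toL1 (indBV B))] with x h1 h2 h3
  rw [h3, Pi.sub_apply, h1, h2, Real.norm_eq_abs]

theorem norm_toL1_indBV_sub_eq_symmDiff {A B : Set (E d)} (hA : IsBVSet A) (hB : IsBVSet B) :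
    ‖BV.toL1 (indBV A - indBV B)‖ = (volume (symmDiff A B)).toReal := by
  have hm : NullMeasurableSet (symmDiff A B) :=
    (hA.2.1.diff hB.2.1).union (hB.2.1.diff hA.2.1)
  have e : ∀ x, |A.indicator (fun _ => (1 : ℝ)) x - B.indicator (fun _ => (1 : ℝ)) x|
      = (symmDiff A B).indicator (fun _ => (1 : ℝ)) x := fun x => by
    by_cases h1 : x ∈ A <;> by_cases h2 : x ∈ B <;> simp [Set.mem_symmDiff, h1, h2]
  rw [norm_toL1_indBV_sub hA hB]
  simp only [e]
  rw [integral_indicator₀ hm]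
  simp [Measure.real]

/-- Additivity holds because the indicators add up in `BV`. The continuity of a charge is that of α
along `BV`-bounded sequences converging in L¹, the L¹ distance of indicators being the measure of
the symmetric difference. -/
theorem isStrongCharge_of_mem_SCH (hd : 1 ≤ d) {α : BV d →L[ℝ] ℝ} (hα : α ∈ SCH d) :
    IsStrongCharge fun B => α (indBV B) := by
  refine ⟨⟨fun B₁ B₂ h₁ h₂ h => ?_, fun B B' hB hB' hconv => ?_⟩, α, hα, fun B hB => ?_⟩
  · simp only [indBV_union h₁ h₂ h, map_add]
  · refine tendsto_of_mem_SCH hd hα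
      (M := volume.real (cube d) + (⨆ n, perimeter (B n)).toReal) (fun n => ?_) ?_
    · refine (norm_indBV_le (hB n)).trans ?_
      gcongr
      · exact hconv.1.ne
      · exact le_iSup (fun n => perimeter (B n)) n
    · simp only [norm_toL1_indBV_sub_eq_symmDiff (hB _) hB']
      have h := (ENNReal.tendsto_toReal ENNReal.zero_ne_top).comp hconv.2
      rw [ENNReal.toReal_zero] at h
      exact h
  · simp only [indBV_eq hB]

/-! ### Figures -/

/-- If membership of the union changes under translation, then membership of A or of B changes. No
disjointness is involved, so figures may be given by overlapping rectangles. -/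
theorem modulus_union_le {A B : Set (E d)} (hA : Integrable (A.indicator fun _ => (1 : ℝ)))
    (hB : Integrable (B.indicator fun _ => (1 : ℝ))) (z : E d) :
    modulus ((A ∪ B).indicator fun _ => 1) z
      ≤ modulus (A.indicator fun _ => 1) z + modulus (B.indicator fun _ => 1) z := by
  unfold modulus
  rw [← integral_add (integrable_translate_sub hA z).abs (integrable_translate_sub hB z).abs]
  refine integral_mono_of_nonneg (Eventually.of_forall fun x => abs_nonneg _)
    ((integrable_translate_sub hA z).abs.add (integrable_translate_sub hB z).abs)
    (Eventually.of_forall fun x => ?_)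
  by_cases h1 : x ∈ A <;> by_cases h2 : x ∈ B <;> by_cases h3 : x + z ∈ A <;>
    by_cases h4 : x + z ∈ B <;> simp [h1, h2, h3, h4]

theorem exists_modulus_biUnion_le (R : Finset ((Fin d → ℝ) × (Fin d → ℝ)))
    (hR : ∀ p ∈ R, IsRectBounds p.1 p.2) :
    (⋃ p ∈ R, rect p.1 p.2) ⊆ cube d ∧ MeasurableSet (⋃ p ∈ R, rect p.1 p.2) ∧
      ∀ i, ∀ t, 0 ≤ t → modulus ((⋃ p ∈ R, rect p.1 p.2).indicator fun _ => (1 : ℝ))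
        (t • unitVec i) ≤ (R.card * 2) * t := by
  classical
  induction R using Finset.induction_on with
  | empty => simp [modulus]
  | insert p R hp ih =>
    obtain ⟨h1, h2, h3⟩ := ih fun q hq => hR q (Finset.mem_insert_of_mem hq)
    have hb := hR p (Finset.mem_insert_self _ _)
    have ha : ∀ i, 0 ≤ p.1 i := fun i => (hb i).1
    have hb' : ∀ i, p.2 i ≤ 1 := fun i => (hb i).2.2
    rw [Finset.set_biUnion_insert]
    refine ⟨Set.union_subset (rect_subset_cube ha hb') h1, (measurableSet_rect _ _).union h2,
      fun i t ht => ?_⟩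
    refine (modulus_union_le (integrable_indicator_rect _ _)
      (integrable_indicator_of_null h1 h2.nullMeasurableSet) _).trans ?_
    rw [Finset.card_insert_of_notMem hp]
    have e1 := modulus_rect_le ha hb' i ht
    have e2 := h3 i t ht
    push_cast
    linarith

theorem IsFigure.isBVSet {F : Set (E d)} (hF : IsFigure F) : IsBVSet F := by
  obtain ⟨R, hR, rfl⟩ := hF
  obtain ⟨h1, h2, h3⟩ := exists_modulus_biUnion_le R hR
  exact ⟨h1, h2.nullMeasurableSet, (perimeter_le_of_modulus_le
    (integrable_indicator_of_null h1 h2.nullMeasurableSet) h3).trans_lt ENNReal.ofReal_lt_top⟩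

/-! ### Values of the limit of the series on rectangles -/

theorem mem_rect_dyadic_iff {n : ℕ} {p q : Fin d → ℕ} {x : E d}
    (hx : ∀ i, x i ≠ dyadicLo n q i) : x ∈ rect (dyadicLo n p) (dyadicLo n q) ↔
      ∀ i, (p i : ℤ) ≤ cellIndex n x i ∧ cellIndex n x i < q i := by
  have hp : (0 : ℝ) < 2 ^ n := by positivity
  refine forall_congr' fun i => and_congr ?_ ?_
  · rw [cellIndex, Int.le_floor, dyadicLo, div_le_iff₀ hp, mul_comm]
    simp
  · rw [(hx i).le_iff_lt, cellIndex, Int.floor_lt, dyadicLo, lt_div_iff₀ hp, mul_comm]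
    simp

theorem DyadicNumbering.cubeT_indBV_rect (K : DyadicNumbering d) (n k : ℕ) {p q : Fin d → ℕ}
    (hq : ∀ i, q i ≤ 2 ^ n) :
    K.cubeT n k (indBV (rect (dyadicLo n p) (dyadicLo n q)))
      = if K.corner n k ∈ Fintype.piFinset (fun i => Finset.Ico (p i) (q i))
        then (2 ^ (n * d))⁻¹ else 0 := by
  have hBV : IsBVSet (rect (dyadicLo n p) (dyadicLo n q)) := by
    refine isBVSet_rect (DyadicNumbering.dyadicLo_nonneg n p) fun i => ?_
    rw [dyadicLo, div_le_one (by positivity)]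
    exact_mod_cast hq i
  have hx : ∀ᵐ x : E d, ∀ i, x i ≠ dyadicLo n q i := ae_all_iff.2 fun i => ae_coord_ne i _
  have hmem : ∀ x ∈ cell n fun i => (K.corner n k i : ℤ), (∀ i, x i ≠ dyadicLo n q i) →
      (x ∈ rect (dyadicLo n p) (dyadicLo n q)
        ↔ K.corner n k ∈ Fintype.piFinset (fun i => Finset.Ico (p i) (q i))) := fun x hxc hx => by
    rw [mem_rect_dyadic_iff hx, mem_cell.1 hxc]
    simp
  rw [cubeT_apply, setIntegral_congr_set (K.set_ae_eq_cell n k),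
    setIntegral_congr_ae (g := fun _ =>
      if K.corner n k ∈ Fintype.piFinset (fun i => Finset.Ico (p i) (q i)) then (1 : ℝ) else 0)
      (measurableSet_cell _ _)]
  · rw [setIntegral_const, Measure.real, volume_cell, ENNReal.toReal_ofReal (by positivity)]
    simp
  · filter_upwards [hx, coe_indBV hBV] with x h1 h2 hxc
    rw [h2]
    have := hmem x hxc h1
    by_cases h : x ∈ rect (dyadicLo n p) (dyadicLo n q)
    · rw [Set.indicator_of_mem h, if_pos (this.1 h)]
    · rw [Set.indicator_of_notMem h, if_neg fun hc => h (this.2 hc)]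

/-- The Parseval identity rewrites the partial sum as Σ_k 2^(nd) Δ_f(K_{n,k}) times the functional
of K_{n,k}. On the indicator of the rectangle this leaves the sum of the increments of the cubes
inside it, which telescopes. -/
theorem DyadicNumbering.partialSum_apply_rect (hd : 1 ≤ d) (K : DyadicNumbering d) (f : E d → ℝ)
    (n : ℕ) {p q : Fin d → ℕ} (hpq : ∀ i, p i ≤ q i) (hq : ∀ i, q i ≤ 2 ^ n) :
    ((∑ j ∈ Finset.range (2 ^ (n * d)), lamSeq K f j • faberSchauder K j : SCH d) :
      BV d →L[ℝ] ℝ) (indBV (rect (dyadicLo n p) (dyadicLo n q)))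
      = rectIncrement f (dyadicLo n p) (dyadicLo n q) := by
  have h1 : ((∑ j ∈ Finset.range (2 ^ (n * d)), lamSeq K f j • faberSchauder K j : SCH d) :
      BV d →L[ℝ] ℝ)
      = ∑ k ∈ Finset.range (2 ^ (n * d)), (2 ^ (n * d) * K.increment f n k) • K.cubeT n k := by
    rw [← sum_haarCoefSeq_smul hd (K.dyadicAdditive_increment f) K.dyadicAdditive_cubeT]
    simp only [Submodule.coe_sum, Submodule.coe_smul, K.faberSchauder_eq, lamSeq_eq]
  rw [h1, sum_apply, ← sum_rectIncrement f n hpq]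
  simp only [smul_apply, K.cubeT_indBV_rect n _ hq, smul_eq_mul, mul_ite, mul_zero]
  have h2 : ∀ k, 2 ^ (n * d) * K.increment f n k * (2 ^ (n * d))⁻¹ = K.increment f n k :=
    fun k => by field_simp
  simp only [h2]
  simp only [DyadicNumbering.increment]
  rw [K.sum_corner (fun m => if m ∈ Fintype.piFinset (fun i => Finset.Ico (p i) (q i)) then
    rectIncrement f (dyadicLo n m) (dyadicHi n m) else 0), ← Finset.sum_filter]
  refine Finset.sum_congr (Finset.ext fun m => ?_) fun _ _ => rfl
  simp only [Finset.mem_filter, Fintype.mem_piFinset, Finset.mem_range, Finset.mem_Ico]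
  exact ⟨fun h => h.2, fun h => ⟨fun i => (h i).2.trans_le (hq i), h⟩⟩

/-- The numerators of the dyadic approximation from below. -/
noncomputable def dyadicFloor (n : ℕ) (a : Fin d → ℝ) : Fin d → ℕ := fun i => ⌊2 ^ n * a i⌋₊

theorem tendsto_dyadicFloor {a : Fin d → ℝ} (ha : ∀ i, 0 ≤ a i) (i : Fin d) :
    Tendsto (fun n => dyadicLo n (dyadicFloor n a) i) atTop (𝓝 (a i)) := by
  have h := (tendsto_nat_floor_mul_div_atTop (ha i)).comp
    (tendsto_pow_atTop_atTop_of_one_lt (one_lt_two : (1 : ℝ) < 2))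
  refine h.congr fun n => ?_
  simp [dyadicLo, dyadicFloor, mul_comm]

theorem dyadicFloor_mono {a b : Fin d → ℝ} (h : ∀ i, a i ≤ b i) (n : ℕ) (i : Fin d) :
    dyadicFloor n a i ≤ dyadicFloor n b i :=
  Nat.floor_mono (mul_le_mul_of_nonneg_left (h i) (by positivity))

theorem dyadicFloor_le {b : Fin d → ℝ} (h : ∀ i, b i ≤ 1) (n : ℕ) (i : Fin d) :
    dyadicFloor n b i ≤ 2 ^ n := by
  refine Nat.floor_le_of_le ?_
  push_cast
  exact mul_le_of_le_one_right (by positivity) (h i)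

theorem dyadicLo_le_one {n : ℕ} {q : Fin d → ℕ} (hq : ∀ i, q i ≤ 2 ^ n) (i : Fin d) :
    dyadicLo n q i ≤ 1 := by
  rw [dyadicLo, div_le_one (by positivity)]
  exact_mod_cast hq i

theorem tendsto_rectIncrement {f : E d → ℝ} (hf : ContinuousOn f (cube d)) {a b : Fin d → ℝ}
    {an bn : ℕ → Fin d → ℝ} (ha : ∀ i, a i ∈ Set.Icc (0 : ℝ) 1) (hb : ∀ i, b i ∈ Set.Icc (0 : ℝ) 1)
    (han : ∀ n i, an n i ∈ Set.Icc (0 : ℝ) 1) (hbn : ∀ n i, bn n i ∈ Set.Icc (0 : ℝ) 1)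
    (hta : ∀ i, Tendsto (fun n => an n i) atTop (𝓝 (a i)))
    (htb : ∀ i, Tendsto (fun n => bn n i) atTop (𝓝 (b i))) :
    Tendsto (fun n => rectIncrement f (an n) (bn n)) atTop (𝓝 (rectIncrement f a b)) := by
  refine tendsto_finsetSum _ fun S _ => Tendsto.const_mul _ ?_
  have hmem : (WithLp.toLp 2 fun i => if i ∈ S then a i else b i : E d) ∈ cube d := fun i => by
    show 0 ≤ (if i ∈ S then a i else b i) ∧ (if i ∈ S then a i else b i) ≤ 1
    split_ifs
    · exact ha i
    · exact hb i
  refine (hf _ hmem).tendsto.comp (tendsto_nhdsWithin_iff.2 ⟨?_, Eventually.of_forall fun n i => ?_⟩)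
  · refine ((PiLp.continuous_toLp 2 _).tendsto _).comp (tendsto_pi_nhds.2 fun i => ?_)
    split_ifs
    · exact hta i
    · exact htb i
  · show 0 ≤ (if i ∈ S then an n i else bn n i) ∧ (if i ∈ S then an n i else bn n i) ≤ 1
    split_ifs
    · exact han n i
    · exact hbn n i

theorem tendsto_indicator_rect {a b : Fin d → ℝ} {an bn : ℕ → Fin d → ℝ}
    (hta : ∀ i, Tendsto (fun n => an n i) atTop (𝓝 (a i)))
    (htb : ∀ i, Tendsto (fun n => bn n i) atTop (𝓝 (b i))) {x : E d}
    (hxa : ∀ i, x i ≠ a i) (hxb : ∀ i, x i ≠ b i) :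
    ∀ᶠ n in atTop, (x ∈ rect (an n) (bn n) ↔ x ∈ rect a b) := by
  have h1 : ∀ i, ∀ᶠ n in atTop, (an n i ≤ x i ↔ a i ≤ x i) := fun i => by
    rcases (hxa i).lt_or_gt with h | h
    · filter_upwards [(hta i).eventually (lt_mem_nhds h)] with n hn
      exact iff_of_false hn.not_ge h.not_ge
    · filter_upwards [(hta i).eventually (gt_mem_nhds h)] with n hn
      exact iff_of_true hn.le h.le
  have h2 : ∀ i, ∀ᶠ n in atTop, (x i ≤ bn n i ↔ x i ≤ b i) := fun i => by
    rcases (hxb i).lt_or_gt with h | h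
    · filter_upwards [(htb i).eventually (lt_mem_nhds h)] with n hn
      exact iff_of_true hn.le h.le
    · filter_upwards [(htb i).eventually (gt_mem_nhds h)] with n hn
      exact iff_of_false hn.not_ge h.not_ge
  filter_upwards [eventually_all.2 h1, eventually_all.2 h2] with n e1 e2
  exact forall_congr' fun i => and_congr (e1 i) (e2 i)

theorem tendsto_norm_toL1_indBV_rect {a b : Fin d → ℝ} {an bn : ℕ → Fin d → ℝ}
    (ha : ∀ i, 0 ≤ a i) (hb : ∀ i, b i ≤ 1) (han : ∀ n i, 0 ≤ an n i) (hbn : ∀ n i, bn n i ≤ 1)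
    (hta : ∀ i, Tendsto (fun n => an n i) atTop (𝓝 (a i)))
    (htb : ∀ i, Tendsto (fun n => bn n i) atTop (𝓝 (b i))) :
    Tendsto (fun n => ‖BV.toL1 (indBV (rect (an n) (bn n)) - indBV (rect a b))‖) atTop (𝓝 0) := by
  simp only [norm_toL1_indBV_sub (isBVSet_rect (han _) (hbn _)) (isBVSet_rect ha hb)]
  rw [← integral_zero (E d) ℝ (μ := volume)]
  have hsub : ∀ n, rect (an n) (bn n) ⊆ cube d := fun n => rect_subset_cube (han n) (hbn n)
  have hsub' : rect a b ⊆ cube d := rect_subset_cube ha hb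
  refine tendsto_integral_of_dominated_convergence ((cube d).indicator fun _ => (1 : ℝ))
    (fun n => ?_) (integrable_indicator_rect _ _) (fun n => Eventually.of_forall fun x => ?_) ?_
  · exact ((integrable_indicator_rect _ _).sub
      (integrable_indicator_rect _ _)).abs.aestronglyMeasurable
  · rw [Real.norm_eq_abs, abs_abs]
    by_cases h1 : x ∈ rect (an n) (bn n) <;> by_cases h2 : x ∈ rect a b
    · simp [h1, h2, hsub' h2]
    · simp [h1, h2, hsub n h1]
    · simp [h1, h2, hsub' h2]
    · simpa [h1, h2] using Set.indicator_nonneg (fun _ _ => zero_le_one) x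
  · filter_upwards [ae_all_iff.2 fun i => ae_coord_ne i (a i),
      ae_all_iff.2 fun i => ae_coord_ne i (b i)] with x hxa hxb
    refine tendsto_const_nhds.congr' ?_
    filter_upwards [tendsto_indicator_rect hta htb hxa hxb] with n hn
    by_cases h : x ∈ rect a b
    · simp [h, hn.2 h]
    · simp [h, mt hn.1 h]

/-- Along dyadic rectangles R_n approaching R, the partial sums of order 2^(nd) give Δ_f(R_n)
exactly. Since the indicators of R_n are bounded in `BV`, norm convergence of the partial sums
applies although the rectangle varies with n. -/
theorem apply_indBV_rect_of_tendsto (hd : 1 ≤ d) (K : DyadicNumbering d) {f : E d → ℝ}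
    (hf : ContinuousOn f (cube d)) {α : SCH d}
    (hα : Tendsto (fun N => ∑ j ∈ Finset.range N, lamSeq K f j • faberSchauder K j) atTop (𝓝 α))
    {a b : Fin d → ℝ} (hab : IsRectBounds a b) :
    (α : BV d →L[ℝ] ℝ) (indBV (rect a b)) = rectIncrement f a b := by
  have ha : ∀ i, 0 ≤ a i := fun i => (hab i).1
  have hle : ∀ i, a i ≤ b i := fun i => (hab i).2.1.le
  have hb : ∀ i, b i ≤ 1 := fun i => (hab i).2.2
  have hb0 : ∀ i, 0 ≤ b i := fun i => (ha i).trans (hle i)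
  have ha1 : ∀ i, a i ≤ 1 := fun i => (hle i).trans (hb i)
  -- For small n the approximating rectangle may be degenerate; the estimates and the exact formula
  -- used below allow this.
  let an : ℕ → Fin d → ℝ := fun n => dyadicLo n (dyadicFloor n a)
  let bn : ℕ → Fin d → ℝ := fun n => dyadicLo n (dyadicFloor n b)
  have han : ∀ n i, 0 ≤ an n i := fun n i => DyadicNumbering.dyadicLo_nonneg _ _ _
  have hbn : ∀ n i, bn n i ≤ 1 := fun n => dyadicLo_le_one (dyadicFloor_le hb n)
  have hBV : ∀ n, IsBVSet (rect (an n) (bn n)) := fun n => isBVSet_rect (han n) (hbn n)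
  set M : ℝ := volume.real (cube d) + d * 2 with hM
  have hM0 : 0 ≤ M := by positivity
  have hbound : ∀ n, ‖indBV (rect (an n) (bn n))‖ ≤ M := fun n => by
    refine (norm_indBV_le (hBV n)).trans ?_
    exact add_le_add le_rfl (ENNReal.toReal_le_of_le_ofReal (by positivity)
      (perimeter_rect_le (han n) (hbn n)))
  have h1 : Tendsto (fun n => (α : BV d →L[ℝ] ℝ) (indBV (rect (an n) (bn n)))) atTop
      (𝓝 ((α : BV d →L[ℝ] ℝ) (indBV (rect a b)))) :=
    tendsto_of_mem_SCH hd α.2 hbound (tendsto_norm_toL1_indBV_rect ha hb han hbn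
      (tendsto_dyadicFloor ha) (tendsto_dyadicFloor hb0))
  have h2 : Tendsto (fun n => rectIncrement f (an n) (bn n)) atTop (𝓝 (rectIncrement f a b)) :=
    tendsto_rectIncrement hf (fun i => ⟨ha i, ha1 i⟩) (fun i => ⟨hb0 i, hb i⟩)
      (fun n i => ⟨han n i, dyadicLo_le_one (dyadicFloor_le ha1 n) i⟩)
      (fun n i => ⟨DyadicNumbering.dyadicLo_nonneg _ _ _, hbn n i⟩)
      (tendsto_dyadicFloor ha) (tendsto_dyadicFloor hb0)
  let P : ℕ → SCH d := fun n =>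
    ∑ j ∈ Finset.range (2 ^ (n * d)), lamSeq K f j • faberSchauder K j
  have hP : ∀ n, (P n : BV d →L[ℝ] ℝ) (indBV (rect (an n) (bn n)))
      = rectIncrement f (an n) (bn n) := fun n =>
    K.partialSum_apply_rect hd f n (dyadicFloor_mono hle n) (dyadicFloor_le hb n)
  have hsub : Tendsto (fun n : ℕ => 2 ^ (n * d)) atTop atTop :=
    tendsto_atTop_mono (fun n => (Nat.le_mul_of_pos_right n hd).trans Nat.lt_two_pow_self.le)
      tendsto_id
  have hPα : Tendsto (fun n => (P n : BV d →L[ℝ] ℝ)) atTop (𝓝 (α : BV d →L[ℝ] ℝ)) :=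
    (continuous_subtype_val.tendsto α).comp (hα.comp hsub)
  have h3 : Tendsto (fun n => ‖(P n : BV d →L[ℝ] ℝ) - (α : BV d →L[ℝ] ℝ)‖ * M) atTop (𝓝 0) := by
    simpa using (tendsto_iff_norm_sub_tendsto_zero.1 hPα).mul_const M
  have h4 : Tendsto (fun n => rectIncrement f (an n) (bn n)
      - (α : BV d →L[ℝ] ℝ) (indBV (rect (an n) (bn n)))) atTop (𝓝 0) := by
    refine squeeze_zero_norm (fun n => ?_) h3
    rw [← hP n, ← sub_apply]
    refine (ContinuousLinearMap.le_opNorm _ _).trans ?_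
    exact mul_le_mul_of_nonneg_left (hbound n) (norm_nonneg _)
  -- The difference Δ_f(R_n) - α(1_{R_n}) tends both to 0 and to Δ_f(R) - α(1_R).
  have h5 := tendsto_nhds_unique h4 (h2.sub h1)
  linarith

theorem stronglyChargeable_of_seriesConverges (hd : 1 ≤ d) (K : DyadicNumbering d) {f : E d → ℝ}
    (hf : ContinuousOn f (cube d))
    (h : SeriesConverges fun j => lamSeq K f j • faberSchauder K j) : StronglyChargeable f := by
  obtain ⟨α, hα⟩ := h
  have hs := isStrongCharge_of_mem_SCH hd α.2
  exact ⟨_, hs, fun a b hab => apply_indBV_rect_of_tendsto hd K hf hα hab,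
    fun F₁ F₂ h₁ h₂ h => hs.1.1 F₁ F₂ h₁.isBVSet h₂.isBVSet h⟩

end StrongCharge

theorem mainTheorem7 (d : ℕ) (hd : 1 ≤ d) (K : StrongCharge.DyadicNumbering d)
    (f : StrongCharge.E d → ℝ) (hf : StrongCharge.MemC0 f) :
    StrongCharge.StronglyChargeable f ↔
      StrongCharge.SeriesConverges fun j =>
        StrongCharge.lamSeq K f j • StrongCharge.faberSchauder K j :=
  ⟨StrongCharge.seriesConverges_of_stronglyChargeable hd K,
    StrongCharge.stronglyChargeable_of_seriesConverges hd K hf.1⟩
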